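/- **The Hide and Seek algorithm factors $N$ in time $O(N^{1/3+\epsilon})$.** *Machine.* Programs run on a random access machine with finitely many registers and arrays of natural numbers. The available operations are $+,-,\times,\div,\bmod$, comparison, and array access. Running time is counted in bit operations: reading or writing a number costs its binary length, an array access costs the lengths of address and content, and an arithmetic operation costs the square of the total length of its operands, up to additive constants. *The search with parameters $(a,w,h)$.* Divide the plane into cells $\{iw\le x<(i+1)w,\ jh\le y<(j+1)h\}$. For $\delta=0,1$, compute all inverses modulo $a-\delta$ (by running through powers of residues), list all solutions of $xy\equiv N \bmod (a-\delta)$ with $0<x,y<a-\delta$, and put them into the cells. For $\delta=1$ also put in their translates by $a-1$ in either or both coordinates, which realises wrapping around at the borders. For each cell meeting $[0,a)^2$, compare each point $(x,y)$ modulo $a$ in it with each point $(x',y')$ modulo $a-1$ in the cell itself or an immediately neighbouring cell: set $U'=\max(x'-x,0)\,a+x$, $V'=\max(y'-y,0)\,a+y$, and record $(U',V')$ if $U'V'=N$ and $U',V'>1$. *Algorithm A (balanced factors).* Let $a=\lceil (2N)^{1/3}\rceil$. If $\gcd(a,N)>1$ or $\gcd(a-1,N)>1$, a factorization has been found. Otherwise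 search with $w=h=\lceil a^{1/2}\rceil$. *Algorithm B (general case).* Let $a=\lceil N^{1/3}\rceil$. Try the integers $2\le d\le a$ as divisors of $N$. If none divides $N$, search with $w=2,4,8,\dots$ and $h=\lceil 2a/w\rceil$ until a factorization is found. *Theorem.* For every $\epsilon>0$ there are constants $K_A, K_B$, depending only on $\epsilon$, such that: 1. if $N=UV$ with integers $1<U\le V<2U$, then Algorithm A, on input $N$, halts within time $K_A N^{1/3+\epsilon}$ and outputs integers $U',V'>1$ with $U'V'=N$; 2. if $N=UV$ with integers $1<U\le V$ (that is, $N$ is any composite number), then Algorithm B, on input $N$, halts within time $K_B N^{1/3+\epsilon}$ and outputs integers $U',V'>1$ with $U'V'=N$. -/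

import Mathlib

/-!
The "Hide and Seek" factoring algorithm as an explicit program for a random access machine
whose running time is counted in bit operations (logarithmic cost).
-/

namespace HideSeek

/-! ### The machine -/

/-- Scalar registers. The input is in `N`; the output is the pair `outU`, `outV`. -/
inductive Reg
  | N | a | b | w | h | m | d | g | r | p | q | k | n | x | y | c | rows | cols
  | i | j | i' | j' | s | t | u | v | outU | outV
  deriving DecidableEq

/-- Arrays of natural numbers. The arrays with an index `δ : Fin 2` serve the modulus `a - δ`:
`px δ`, `py δ` hold the coordinates of the listed points, `head δ` the first point of each cell,
`next δ` the point after a given one in the same cell (`0` is the null pointer). -/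
inductive Arr
  | mark | inv | stack
  | px (δ : Fin 2) | py (δ : Fin 2) | next (δ : Fin 2) | head (δ : Fin 2)
  deriving DecidableEq

/-- The elementary arithmetic operations (subtraction is truncated at `0`). -/
inductive Op
  | add | sub | mul | div | mod

/-- The value of an elementary operation. -/
def Op.eval : Op → ℕ → ℕ → ℕ
  | .add, x, y => x + y
  | .sub, x, y => x - y
  | .mul, x, y => x * y
  | .div, x, y => x / y
  | .mod, x, y => x % y

/-- Arithmetic expressions: constants, registers, array cells, elementary operations. -/
inductive Expr
  | num (n : ℕ)
  | reg (z : Reg)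
  | cell (A : Arr) (e : Expr)
  | bin (o : Op) (e f : Expr)

/-- Tests. -/
inductive Test
  | lt (e f : Expr)
  | eq (e f : Expr)
  | and (P Q : Test)

/-- Commands: structured programs over registers and arrays. -/
inductive Cmd
  | skip
  | assign (z : Reg) (e : Expr)
  | store (A : Arr) (e f : Expr)
  | seq (C D : Cmd)
  | branch (P : Test) (C D : Cmd)
  | loop (P : Test) (C : Cmd)

/-- A machine state. -/
structure State where
  reg : Reg → ℕ
  mem : Arr → ℕ → ℕ

/-- Overwrite one register. -/
def State.setReg (σ : State) (z : Reg) (n : ℕ) : State :=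
  { σ with reg := Function.update σ.reg z n }

/-- Overwrite one array cell. -/
def State.setMem (σ : State) (A : Arr) (l n : ℕ) : State :=
  { σ with mem := Function.update σ.mem A (Function.update (σ.mem A) l n) }

/-- The initial state on input `N`: everything else is zero. -/
def State.init (N : ℕ) : State where
  reg := Function.update (fun _ => 0) Reg.N N
  mem := fun _ _ => 0

/-- The value of an expression. -/
def Expr.eval (σ : State) : Expr → ℕ
  | .num n => n
  | .reg z => σ.reg z
  | .cell A e => σ.mem A (e.eval σ)
  | .bin o e f => o.eval (e.eval σ) (f.eval σ)

/-- The time to evaluate an expression, in bit operations. `Nat.size` is the binary length.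
Reading a number costs its length; an array access costs the lengths of the address and of the
content; an elementary operation costs the square of the joint length of its operands (enough
for schoolbook multiplication and division). -/
def Expr.cost (σ : State) : Expr → ℕ
  | .num n => n.size + 1
  | .reg z => (σ.reg z).size + 1
  | .cell A e => e.cost σ + (e.eval σ).size + (σ.mem A (e.eval σ)).size + 1
  | .bin _ e f => e.cost σ + f.cost σ + ((e.eval σ).size + (f.eval σ).size + 1) ^ 2

/-- The truth value of a test. -/
def Test.Holds (σ : State) : Test → Prop
  | .lt e f => e.eval σ < f.eval σ
  | .eq e f => e.eval σ = f.eval σ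
  | .and P Q => P.Holds σ ∧ Q.Holds σ

/-- The time to evaluate a test. -/
def Test.cost (σ : State) : Test → ℕ
  | .lt e f => e.cost σ + f.cost σ + (e.eval σ).size + (f.eval σ).size + 1
  | .eq e f => e.cost σ + f.cost σ + (e.eval σ).size + (f.eval σ).size + 1
  | .and P Q => P.cost σ + Q.cost σ + 1

/-- `Run C σ t τ`: started in state `σ`, the command `C` halts after time `t` in state `τ`. -/
inductive Run : Cmd → State → ℕ → State → Prop
  | skip (σ : State) : Run .skip σ 1 σ
  | assign (σ : State) (z : Reg) (e : Expr) :
      Run (.assign z e) σ (e.cost σ + (e.eval σ).size + 1) (σ.setReg z (e.eval σ))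
  | store (σ : State) (A : Arr) (e f : Expr) :
      Run (.store A e f) σ (e.cost σ + f.cost σ + (e.eval σ).size + (f.eval σ).size + 1)
        (σ.setMem A (e.eval σ) (f.eval σ))
  | seq {C D : Cmd} {σ τ ρ : State} {t t' : ℕ} :
      Run C σ t τ → Run D τ t' ρ → Run (.seq C D) σ (t + t') ρ
  | branch_true {P : Test} {C D : Cmd} {σ τ : State} {t : ℕ} :
      P.Holds σ → Run C σ t τ → Run (.branch P C D) σ (P.cost σ + 1 + t) τ
  | branch_false {P : Test} {C D : Cmd} {σ τ : State} {t : ℕ} :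
      ¬ P.Holds σ → Run D σ t τ → Run (.branch P C D) σ (P.cost σ + 1 + t) τ
  | loop_done {P : Test} {C : Cmd} {σ : State} :
      ¬ P.Holds σ → Run (.loop P C) σ (P.cost σ + 1) σ
  | loop_step {P : Test} {C : Cmd} {σ τ ρ : State} {t t' : ℕ} :
      P.Holds σ → Run C σ t τ → Run (.loop P C) τ t' ρ →
      Run (.loop P C) σ (P.cost σ + 1 + t + t') ρ

/-- Execution is deterministic: running time and final state are unique. -/
theorem Run.unique {C : Cmd} {σ τ τ' : State} {t t' : ℕ}
    (h₁ : Run C σ t τ) (h₂ : Run C σ t' τ') : t = t' ∧ τ = τ' := by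
  induction h₁ generalizing t' τ' with
  | skip => cases h₂; exact ⟨rfl, rfl⟩
  | assign => cases h₂; exact ⟨rfl, rfl⟩
  | store => cases h₂; exact ⟨rfl, rfl⟩
  | seq _ _ ih₁ ih₂ =>
    cases h₂ with
    | seq k₁ k₂ =>
      obtain ⟨rfl, rfl⟩ := ih₁ k₁
      obtain ⟨rfl, rfl⟩ := ih₂ k₂
      exact ⟨rfl, rfl⟩
  | branch_true hP _ ih =>
    cases h₂ with
    | branch_true _ k => obtain ⟨rfl, rfl⟩ := ih k; exact ⟨rfl, rfl⟩
    | branch_false hn _ => exact absurd hP hn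
  | branch_false hP _ ih =>
    cases h₂ with
    | branch_true hn _ => exact absurd hn hP
    | branch_false _ k => obtain ⟨rfl, rfl⟩ := ih k; exact ⟨rfl, rfl⟩
  | loop_done hP =>
    cases h₂ with
    | loop_done _ => exact ⟨rfl, rfl⟩
    | loop_step hn _ _ => exact absurd hn hP
  | loop_step hP _ _ ih₁ ih₂ =>
    cases h₂ with
    | loop_done hn => exact absurd hP hn
    | loop_step _ k₁ k₂ =>
      obtain ⟨rfl, rfl⟩ := ih₁ k₁
      obtain ⟨rfl, rfl⟩ := ih₂ k₂
      exact ⟨rfl, rfl⟩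

/-! ### Notation for programs -/

instance : Add Expr := ⟨Expr.bin .add⟩
instance : Sub Expr := ⟨Expr.bin .sub⟩
instance : Mul Expr := ⟨Expr.bin .mul⟩
instance : Div Expr := ⟨Expr.bin .div⟩
instance : Mod Expr := ⟨Expr.bin .mod⟩
instance (n : ℕ) : OfNat Expr n := ⟨Expr.num n⟩

/-- `§z` is the content of the register `z`. -/
scoped prefix:max "§" => Expr.reg
scoped infix:60 " ⟵ " => Cmd.assign
scoped infixr:55 " ;; " => Cmd.seq
scoped infix:60 " ≺ " => Test.lt
scoped infix:60 " ≐ " => Test.eq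

open Reg Arr Cmd

/-! ### The pieces of the algorithm -/

/-- `a := ⌈M ^ (1/3)⌉`. -/
def ceilCubeRoot (M : Expr) : Cmd :=
  a ⟵ 0 ;; loop (§a * §a * §a ≺ M) (a ⟵ §a + 1)

/-- `b := ⌈a ^ (1/2)⌉`. -/
def ceilSqrt : Cmd :=
  b ⟵ 0 ;; loop (§b * §b ≺ §a) (b ⟵ §b + 1)

/-- Euclid's algorithm for `g := gcd (N, e)`; if `g > 1`, record the factor `g` of `N`. -/
def gcdTest (e : Expr) : Cmd :=
  g ⟵ §N ;; r ⟵ e ;;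
  loop (0 ≺ §r) (k ⟵ §g % §r ;; g ⟵ §r ;; r ⟵ §k) ;;
  branch (1 ≺ §g) (outU ⟵ §g ;; outV ⟵ §N / §g) skip

/-- All inverses modulo `m`: `inv[x] := x⁻¹ mod m` for `1 ≤ x < m` prime to `m`, and `inv[x] := 0`
for the other `x`. For `r = 2, 3, …` the powers `r, r², …` of `r` modulo `m` are run through until
a residue class already encountered is hit (at the start, only `1` is); its inverse, multiplied
successively by `r`, then gives the inverses of those powers, taken in reverse order. -/
def invertAll : Cmd :=
  r ⟵ 0 ;;
  loop (§r ≺ §m) (store mark §r 0 ;; store inv §r 0 ;; r ⟵ §r + 1) ;;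
  store mark 1 1 ;; store inv 1 1 ;;
  r ⟵ 2 ;;
  loop (§r ≺ §m) (
    p ⟵ §r ;; k ⟵ 0 ;;
    loop (.cell mark §p ≐ 0) (
      store mark §p 1 ;; store stack §k §p ;; k ⟵ §k + 1 ;; p ⟵ (§p * §r) % §m) ;;
    q ⟵ .cell inv §p ;;
    loop (0 ≺ §k) (
      k ⟵ §k - 1 ;; q ⟵ (§q * §r) % §m ;; store inv (.cell stack §k) §q) ;;
    r ⟵ §r + 1)

/-- Throw the point `(e, f)` into its cell: cell `(i, j)` of the plane is the set of points with
`i w ≤ x < (i+1) w`, `j h ≤ y < (j+1) h`, and it has the number `i * cols + j`. -/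
def throwPoint (δ : Fin 2) (e f : Expr) : Cmd :=
  n ⟵ §n + 1 ;;
  store (px δ) §n e ;; store (py δ) §n f ;;
  c ⟵ (e / §w) * §cols + f / §h ;;
  store (next δ) §n (.cell (head δ) §c) ;;
  store (head δ) §c §n

/-- Empty all cells that meet the square `[0, 2a) × [0, 2a)`. -/
def clearCells (δ : Fin 2) : Cmd :=
  rows ⟵ (2 * §a) / §w + 2 ;; cols ⟵ (2 * §a) / §h + 2 ;;
  c ⟵ 0 ;; loop (§c ≺ §rows * §cols) (store (head δ) §c 0 ;; c ⟵ §c + 1)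

/-- For each `x` in `0 < x < m` prime to `m`, compute the `y` with `0 ≤ y < m`, `xy ≡ N mod m`,
and carry out the command `C`. -/
def forSolutions (C : Cmd) : Cmd :=
  invertAll ;;
  n ⟵ 0 ;; x ⟵ 1 ;;
  loop (§x ≺ §m) (
    branch (0 ≺ .cell inv §x) (y ⟵ ((§N % §m) * .cell inv §x) % §m ;; C) skip ;;
    x ⟵ §x + 1)

/-- List all solutions of `xy ≡ N mod a` with `0 < x, y < a` and throw them into the cells. -/
def listMod0 : Cmd :=
  m ⟵ §a ;; clearCells 0 ;; forSolutions (throwPoint 0 §x §y)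

/-- List all solutions of `xy ≡ N mod (a - 1)` with `0 < x, y < a - 1` and throw them into the
cells, together with their translates by `a - 1` in either or both coordinates. (The translates
realise the wrapping around at the right and top borders.) -/
def listMod1 : Cmd :=
  m ⟵ §a - 1 ;; clearCells 1 ;;
  forSolutions (
    throwPoint 1 §x §y ;; throwPoint 1 (§x + §m) §y ;;
    throwPoint 1 §x (§y + §m) ;; throwPoint 1 (§x + §m) (§y + §m))

/-- Compare the point `s` modulo `a` with the point `t` modulo `a - 1`: if they are `(u₀, v₀)` and
`(u₀ + u₁, v₀ + v₁)`, the candidates are `u = u₁ a + u₀` and `v = v₁ a + v₀`; test `N = u v`. -/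
def comparePair : Cmd :=
  u ⟵ (.cell (px 1) §t - .cell (px 0) §s) * §a + .cell (px 0) §s ;;
  v ⟵ (.cell (py 1) §t - .cell (py 0) §s) * §a + .cell (py 0) §s ;;
  branch (.and (§u * §v ≐ §N) (.and (1 ≺ §u) (1 ≺ §v))) (outU ⟵ §u ;; outV ⟵ §v) skip

/-- Compare all points modulo `a` in the cell `(i, j)` with all points modulo `a - 1` in the cell
`(i', j')`. -/
def compareCells : Cmd :=
  s ⟵ .cell (head 0) (§i * §cols + §j) ;;
  loop (0 ≺ §s) (
    t ⟵ .cell (head 1) (§i' * §cols + §j') ;;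
    loop (0 ≺ §t) (comparePair ;; t ⟵ .cell (next 1) §t) ;;
    s ⟵ .cell (next 0) §s)

/-- Run through all cells of the square `[0, a) × [0, a)` and through their immediate
neighbours. -/
def scan : Cmd :=
  i ⟵ 0 ;; loop (§i * §w ≺ §a) (
    j ⟵ 0 ;; loop (§j * §h ≺ §a) (
      i' ⟵ §i - 1 ;; loop (§i' ≺ §i + 2) (
        j' ⟵ §j - 1 ;; loop (§j' ≺ §j + 2) (
          compareCells ;; j' ⟵ §j' + 1) ;;
        i' ⟵ §i' + 1) ;;
      j ⟵ §j + 1) ;;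
    i ⟵ §i + 1)

/-- The search with cells of width `w` and height `h`. -/
def search : Cmd := listMod0 ;; listMod1 ;; scan

/-! ### The two algorithms -/

/-- Hide and Seek for `N = UV` with `U ≤ V < 2U`: `a = ⌈(2N)^(1/3)⌉`, and squares of side
`⌈a^(1/2)⌉`. -/
def balanced : Cmd :=
  ceilCubeRoot (2 * §N) ;;
  gcdTest §a ;; gcdTest (§a - 1) ;;
  branch (§outU ≐ 0) (ceilSqrt ;; w ⟵ §b ;; h ⟵ §b ;; search) skip

/-- Hide and Seek in general: `a = ⌈N^(1/3)⌉`; trial division by the integers up to `a`; then the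
search in rectangles of width `w = 2, 4, 8, …` and height `h = ⌈2a / w⌉` until `N` is factored. -/
def general : Cmd :=
  ceilCubeRoot §N ;;
  d ⟵ 2 ;;
  loop (.and (§d ≺ §a + 1) (§outU ≐ 0)) (
    branch (§N % §d ≐ 0) (outU ⟵ §d ;; outV ⟵ §N / §d) skip ;; d ⟵ §d + 1) ;;
  w ⟵ 2 ;;
  loop (§outU ≐ 0) (
    h ⟵ (2 * §a + §w - 1) / §w ;; search ;; w ⟵ 2 * §w)

/-- On input `N` the program `C` halts within time `T`, with a nontrivial factorization of `N`
as its output. -/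
def FactorsWithin (C : Cmd) (N : ℕ) (T : ℝ) : Prop :=
  ∃ (t : ℕ) (σ : State), Run C (State.init N) t σ ∧ (t : ℝ) ≤ T ∧
    1 < σ.reg outU ∧ 1 < σ.reg outV ∧ σ.reg outU * σ.reg outV = N

end HideSeek

namespace HideSeek

/-! ### Reasoning about programs -/

/-! ### Bounded states, weights of expressions and frames -/

/-! Write `U = u₁ a + u₀` and `V = v₁ a + v₀` with `u₀, v₀ < a`. The point `(u₀, v₀)` lies on the
hyperbola `xy ≡ N` modulo `a`; since `a ≡ 1` modulo `a - 1`, the point `(u₀ + u₁, v₀ + v₁)` lies on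
it modulo `a - 1`. If `u₁ ≤ w` and `v₁ ≤ h`, the two points are in the same cell or in neighbouring
ones, and comparing them restores `U` and `V` (`exists_hit`). For balanced factors `V² < 2N ≤ a³`,
hence `u₁, v₁ ≤ ⌈√a⌉`. In general `u₁ v₁ a² ≤ N ≤ a³`, so `u₁ v₁ ≤ a`; once `w` is the power of two
in `(u₁, 2u₁]`, the height `h ≥ 2a / w` is at least `v₁`. This takes at most logarithmically many
searches.

The time of a search is governed by the number of comparisons. By the arithmetic-geometric
inequality (`cellCost_le`) it is bounded by sums of squares of cell populations, that is, by the
number of pairs of points of one hyperbola closer than `w` and `h` (`sum_sq_inCell_le`). The heart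
of the proof is the bound `card_closePairs_le` of order `D³ (m + wh)` for that number, where `D`
bounds the relevant numbers of divisors. If `(x, y)` and `(x + s, y + t)` are both on the hyperbola,
then `t x² + s t x + s N ≡ 0` modulo `m`. Such a congruence has many solutions only if a large `e`
divides `s`, `t` and `m`, or a large square `f²` divides `st - 4N` (`card_quadSols_le`); such `(s,
t)` are correspondingly rare (`card_offsets_le`). As `wh` is of order `a` and `D` is `O(N^δ)` for
every `δ > 0` (`exists_card_divisors_le`), a search takes `a N^{o(1)}` steps.

On the machine level, `wp` counts elementary steps. In a state whose numbers have at most `L` bits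
every step costs at most `unit L`, a constant times `L²`, and `L` may be taken of order `log N`. -/

/-- All numbers in the state have binary length at most `L`. -/
structure Bdd (L : ℕ) (σ : State) : Prop where
  reg : ∀ z, σ.reg z < 2 ^ L
  mem : ∀ A l, σ.mem A l < 2 ^ L

/-- In a state bounded by `L`, the value of `e` has binary length at most `e.deg * L`. -/
def Expr.deg : Expr → ℕ
  | .num n => n + 1
  | .reg _ => 1
  | .cell _ _ => 1
  | .bin _ e f => e.deg + f.deg

/-- In a state bounded by `L`, evaluating `e` takes time at most `e.wt * L ^ 2`. -/
def Expr.wt : Expr → ℕ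
  | .num n => n + 2
  | .reg _ => 2
  | .cell _ e => e.wt + e.deg + 2
  | .bin _ e f => e.wt + f.wt + (e.deg + f.deg + 1) ^ 2

/-- In a state bounded by `L`, evaluating `P` takes time at most `P.wt * L ^ 2`. -/
def Test.wt : Test → ℕ
  | .lt e f => e.wt + f.wt + e.deg + f.deg + 1
  | .eq e f => e.wt + f.wt + e.deg + f.deg + 1
  | .and P Q => P.wt + Q.wt + 1

/-- The register `z` is written by the command. -/
def Cmd.writes (z : Reg) : Cmd → Bool
  | .skip => false
  | .assign z' _ => decide (z' = z)
  | .store _ _ _ => false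
  | .seq C D => C.writes z || D.writes z
  | .branch _ C D => C.writes z || D.writes z
  | .loop _ C => C.writes z

/-- The array `A` is written by the command. -/
def Cmd.stores (A : Arr) : Cmd → Bool
  | .skip => false
  | .assign _ _ => false
  | .store A' _ _ => decide (A' = A)
  | .seq C D => C.stores A || D.stores A
  | .branch _ C D => C.stores A || D.stores A
  | .loop _ C => C.stores A

/-- The registers and arrays not written by `C` agree in `σ` and `τ`. -/
structure Frame (C : Cmd) (σ τ : State) : Prop where
  reg : ∀ z, C.writes z = false → τ.reg z = σ.reg z
  mem : ∀ A, C.stores A = false → τ.mem A = σ.mem A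

theorem Frame.refl (C : Cmd) (σ : State) : Frame C σ σ := ⟨fun _ _ => rfl, fun _ _ => rfl⟩

theorem Frame.trans {C : Cmd} {σ τ ρ : State} (h : Frame C σ τ) (k : Frame C τ ρ) :
    Frame C σ ρ :=
  ⟨fun z hz => (k.reg z hz).trans (h.reg z hz), fun A hA => (k.mem A hA).trans (h.mem A hA)⟩

@[simp] theorem State.setReg_reg (σ : State) (z z' : Reg) (n : ℕ) :
    (σ.setReg z n).reg z' = if z' = z then n else σ.reg z' := by
  simp [State.setReg, Function.update_apply]

@[simp] theorem State.setReg_mem (σ : State) (z : Reg) (n : ℕ) : (σ.setReg z n).mem = σ.mem := rfl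

@[simp] theorem State.setMem_reg (σ : State) (A : Arr) (l n : ℕ) :
    (σ.setMem A l n).reg = σ.reg := rfl

@[simp] theorem State.setMem_mem (σ : State) (A A' : Arr) (l n : ℕ) :
    (σ.setMem A l n).mem A' = if A' = A then Function.update (σ.mem A) l n else σ.mem A' := by
  by_cases h : A' = A
  · subst h; simp [State.setMem]
  · simp [State.setMem, h]

/-- Which registers and arrays survive a command is decided by its syntax, so the side conditions on
concrete programs below are closed by `rfl`. -/
theorem Run.frame {C : Cmd} {σ τ : State} {t : ℕ} (h : Run C σ t τ) : Frame C σ τ := by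
  induction h with
  | skip => exact Frame.refl _ _
  | assign σ z e =>
    refine ⟨fun z' hz => ?_, fun A _ => rfl⟩
    simp only [Cmd.writes, decide_eq_false_iff_not] at hz
    simp [Ne.symm hz]
  | store σ A e f =>
    refine ⟨fun z' hz => rfl, fun A' hA => ?_⟩
    simp only [Cmd.stores, decide_eq_false_iff_not] at hA
    simp [Ne.symm hA]
  | seq _ _ ih₁ ih₂ =>
    refine ⟨fun z hz => ?_, fun A hA => ?_⟩
    · simp only [Cmd.writes, Bool.or_eq_false_iff] at hz
      rw [ih₂.reg z hz.2, ih₁.reg z hz.1]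
    · simp only [Cmd.stores, Bool.or_eq_false_iff] at hA
      rw [ih₂.mem A hA.2, ih₁.mem A hA.1]
  | branch_true _ _ ih =>
    refine ⟨fun z hz => ?_, fun A hA => ?_⟩
    · simp only [Cmd.writes, Bool.or_eq_false_iff] at hz
      exact ih.reg z hz.1
    · simp only [Cmd.stores, Bool.or_eq_false_iff] at hA
      exact ih.mem A hA.1
  | branch_false _ _ ih =>
    refine ⟨fun z hz => ?_, fun A hA => ?_⟩
    · simp only [Cmd.writes, Bool.or_eq_false_iff] at hz
      exact ih.reg z hz.2
    · simp only [Cmd.stores, Bool.or_eq_false_iff] at hA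
      exact ih.mem A hA.2
  | loop_done => exact Frame.refl _ _
  | loop_step _ _ _ ih₁ ih₂ =>
    exact ⟨fun z hz => (ih₂.reg z hz).trans (ih₁.reg z hz),
      fun A hA => (ih₂.mem A hA).trans (ih₁.mem A hA)⟩

theorem Expr.deg_pos : ∀ e : Expr, 1 ≤ e.deg
  | .num n => by simp [Expr.deg]
  | .reg _ => le_rfl
  | .cell _ _ => le_rfl
  | .bin _ e f => by have := e.deg_pos; simp only [Expr.deg]; omega

theorem Op.eval_lt (o : Op) {x y p q : ℕ} (hp : 1 ≤ p) (hq : 1 ≤ q) (hx : x < 2 ^ p)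
    (hy : y < 2 ^ q) : o.eval x y < 2 ^ (p + q) := by
  have h2 : 2 ≤ 2 ^ p := by simpa using Nat.pow_le_pow_right (n := 2) (by norm_num) hp
  have h3 : 2 ≤ 2 ^ q := by simpa using Nat.pow_le_pow_right (n := 2) (by norm_num) hq
  rw [pow_add]
  cases o with
  | add => simp only [Op.eval]; nlinarith
  | sub => simp only [Op.eval]; have := Nat.sub_le x y; nlinarith
  | mul => exact Nat.mul_lt_mul'' hx hy
  | div => simp only [Op.eval]; have := Nat.div_le_self x y; nlinarith
  | mod => simp only [Op.eval]; have := Nat.mod_le x y; nlinarith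

theorem Expr.eval_lt {L : ℕ} (hL : 1 ≤ L) {σ : State} (hσ : Bdd L σ) :
    ∀ e : Expr, e.eval σ < 2 ^ (e.deg * L)
  | .num n => by
    refine (Nat.lt_two_pow_self (n := n)).trans_le (Nat.pow_le_pow_right (by norm_num) ?_)
    simp only [Expr.deg]; nlinarith
  | .reg z => by simpa [Expr.eval, Expr.deg] using hσ.reg z
  | .cell A e => by simpa [Expr.eval, Expr.deg] using hσ.mem A _
  | .bin o e f => by
    have he := e.deg_pos
    have hf := f.deg_pos
    simp only [Expr.eval, Expr.deg, add_mul]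
    exact o.eval_lt (by nlinarith) (by nlinarith) (e.eval_lt hL hσ) (f.eval_lt hL hσ)

/-- The bound is quadratic in `L` because an operation costs the square of the joint length of its
operands, and these lengths are constant multiples of `L`. The constant `wt` depends on the
expression alone. -/
theorem Expr.cost_le {L : ℕ} (hL : 1 ≤ L) {σ : State} (hσ : Bdd L σ) :
    ∀ e : Expr, e.cost σ ≤ e.wt * L ^ 2
  | .num n => by
    have h : n.size ≤ n := Nat.size_le.2 Nat.lt_two_pow_self
    have h1 : 1 ≤ L ^ 2 := Nat.one_le_pow _ _ hL
    simp only [Expr.cost, Expr.wt]; nlinarith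
  | .reg z => by
    have h := Nat.size_le.2 (hσ.reg z)
    simp only [Expr.cost, Expr.wt]; nlinarith
  | .cell A e => by
    have h := Nat.size_le.2 (hσ.mem A (e.eval σ))
    have h1 := e.cost_le hL hσ
    have h2 := Nat.size_le.2 (e.eval_lt hL hσ)
    have h3 : e.deg * L ≤ e.deg * L ^ 2 := by gcongr; nlinarith
    simp only [Expr.cost, Expr.wt]; nlinarith
  | .bin o e f => by
    have h1 := e.cost_le hL hσ
    have h2 := Nat.size_le.2 (e.eval_lt hL hσ)
    have h3 := f.cost_le hL hσ
    have h4 := Nat.size_le.2 (f.eval_lt hL hσ)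
    have h5 : ((e.eval σ).size + (f.eval σ).size + 1) ^ 2 ≤ ((e.deg + f.deg + 1) * L) ^ 2 := by
      gcongr; nlinarith
    simp only [Expr.cost, Expr.wt]; nlinarith

theorem Test.cost_le {L : ℕ} (hL : 1 ≤ L) {σ : State} (hσ : Bdd L σ) :
    ∀ P : Test, P.cost σ ≤ P.wt * L ^ 2
  | .lt e f | .eq e f => by
    have h1 := e.cost_le hL hσ
    have h2 := Nat.size_le.2 (e.eval_lt hL hσ)
    have h3 := f.cost_le hL hσ
    have h4 := Nat.size_le.2 (f.eval_lt hL hσ)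
    have h5 : e.deg * L ≤ e.deg * L ^ 2 := by gcongr; nlinarith
    have h6 : f.deg * L ≤ f.deg * L ^ 2 := by gcongr; nlinarith
    simp only [Test.cost, Test.wt]; nlinarith
  | .and P Q => by
    have h1 := P.cost_le hL hσ
    have h2 := Q.cost_le hL hσ
    simp only [Test.cost, Test.wt]; nlinarith

/-! ### Weakest preconditions with a step count -/

/-- A bound for the time of one elementary step of a program in states bounded by `L`. -/
def unit (L : ℕ) : ℕ := 1000 * L ^ 2

/-- From `σ` the command `C` halts, in a state `τ` bounded by `L` and within `n` time units,
with `Q n τ`. -/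
def wp (L : ℕ) (C : Cmd) (σ : State) (Q : ℕ → State → Prop) : Prop :=
  ∃ n t τ, Run C σ t τ ∧ t ≤ n * unit L ∧ Bdd L τ ∧ Q n τ

theorem Bdd.setReg {L : ℕ} {σ : State} (hσ : Bdd L σ) (z : Reg) {n : ℕ} (hn : n < 2 ^ L) :
    Bdd L (σ.setReg z n) := by
  refine ⟨fun z' => ?_, hσ.mem⟩
  rw [State.setReg_reg]
  split_ifs
  exacts [hn, hσ.reg z']

theorem Bdd.setMem {L : ℕ} {σ : State} (hσ : Bdd L σ) (A : Arr) (l : ℕ) {n : ℕ}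
    (hn : n < 2 ^ L) : Bdd L (σ.setMem A l n) := by
  refine ⟨hσ.reg, fun A' l' => ?_⟩
  rw [State.setMem_mem]
  split_ifs with h
  · rw [Function.update_apply]
    split_ifs
    exacts [hn, hσ.mem _ _]
  · exact hσ.mem _ _

section

variable {L : ℕ} {C D : Cmd} {σ : State} {Q R : ℕ → State → Prop}

theorem wp.mono (h : wp L C σ R)
    (hQ : ∀ n τ, Bdd L τ → Frame C σ τ → R n τ → Q n τ) : wp L C σ Q := by
  obtain ⟨n, t, τ, hr, ht, hb, h⟩ := h
  exact ⟨n, t, τ, hr, ht, hb, hQ n τ hb hr.frame h⟩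

theorem wp_skip (hL : 1 ≤ L) (hσ : Bdd L σ) (h : Q 1 σ) : wp L .skip σ Q :=
  ⟨1, 1, σ, .skip σ, by unfold unit; nlinarith, hσ, h⟩

theorem wp_seq (h : wp L C σ fun n τ => wp L D τ fun n' ρ => Q (n + n') ρ) :
    wp L (.seq C D) σ Q := by
  obtain ⟨n, t, τ, hr, ht, -, n', t', ρ, hr', ht', hb, h⟩ := h
  exact ⟨n + n', t + t', ρ, .seq hr hr', by nlinarith, hb, h⟩

/-- For the concrete expressions of the programs the weight is a numeral, and the default proof of
`hw` evaluates it. The bound 498 leaves room for the length of the stored value within `unit L`. -/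
theorem wp_assign {z : Reg} {e : Expr} (hL : 1 ≤ L) (hσ : Bdd L σ) (hv : e.eval σ < 2 ^ L)
    (h : Bdd L (σ.setReg z (e.eval σ)) → Q 1 (σ.setReg z (e.eval σ)))
    (hw : e.wt ≤ 498 := by exact Nat.le_of_ble_eq_true rfl) : wp L (.assign z e) σ Q := by
  have hb := hσ.setReg z hv
  refine ⟨1, _, _, .assign σ z e, ?_, hb, h hb⟩
  have h1 := e.cost_le hL hσ
  have h2 := Nat.size_le.2 hv
  have h3 : e.wt * L ^ 2 ≤ 498 * L ^ 2 := by gcongr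
  unfold unit; nlinarith

theorem wp_store {A : Arr} {e f : Expr} (hL : 1 ≤ L) (hσ : Bdd L σ) (hu : e.eval σ < 2 ^ L)
    (hv : f.eval σ < 2 ^ L)
    (h : Bdd L (σ.setMem A (e.eval σ) (f.eval σ)) → Q 1 (σ.setMem A (e.eval σ) (f.eval σ)))
    (he : e.wt ≤ 400 := by exact Nat.le_of_ble_eq_true rfl)
    (hf : f.wt ≤ 400 := by exact Nat.le_of_ble_eq_true rfl) : wp L (.store A e f) σ Q := by
  have hb := hσ.setMem A (e.eval σ) hv
  refine ⟨1, _, _, .store σ A e f, ?_, hb, h hb⟩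
  have h1 := e.cost_le hL hσ
  have h2 := Nat.size_le.2 hu
  have h3 : e.wt * L ^ 2 ≤ 400 * L ^ 2 := by gcongr
  have h4 := f.cost_le hL hσ
  have h5 := Nat.size_le.2 hv
  have h6 : f.wt * L ^ 2 ≤ 400 * L ^ 2 := by gcongr
  unfold unit; nlinarith

theorem wp_branch {P : Test} (hL : 1 ≤ L) (hσ : Bdd L σ)
    (h₁ : P.Holds σ → wp L C σ fun n τ => Q (1 + n) τ)
    (h₂ : ¬ P.Holds σ → wp L D σ fun n τ => Q (1 + n) τ)
    (hw : P.wt ≤ 999 := by exact Nat.le_of_ble_eq_true rfl) : wp L (.branch P C D) σ Q := by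
  have hc := P.cost_le hL hσ
  have h3 : P.wt * L ^ 2 ≤ 999 * L ^ 2 := by gcongr
  have h4 : P.cost σ + 1 ≤ unit L := by unfold unit; nlinarith
  by_cases hP : P.Holds σ
  · obtain ⟨n, t, τ, hr, ht, hb, h⟩ := h₁ hP
    exact ⟨1 + n, _, τ, .branch_true hP hr, by nlinarith, hb, h⟩
  · obtain ⟨n, t, τ, hr, ht, hb, h⟩ := h₂ hP
    exact ⟨1 + n, _, τ, .branch_false hP hr, by nlinarith, hb, h⟩

/-- Induction on a bound `v` for the measure, carrying along the number `n` of units already spent,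
so that the invariant can speak about time. The extra unit in `done` pays for the last test. -/
theorem wp_loop_of_measure {P : Test} (I : ℕ → State → Prop) (μ : ℕ → State → ℕ) (hL : 1 ≤ L)
    (hσ : Bdd L σ) (h0 : I 0 σ)
    (step : ∀ n τ, Bdd L τ → Frame (.loop P C) σ τ → I n τ → P.Holds τ →
      wp L C τ fun k ρ => I (n + 1 + k) ρ ∧ μ (n + 1 + k) ρ < μ n τ)
    (done : ∀ n τ, Bdd L τ → Frame (.loop P C) σ τ → I n τ → ¬ P.Holds τ → Q (n + 1) τ)
    (hw : P.wt ≤ 999) : wp L (.loop P C) σ Q := by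
  suffices H : ∀ v n τ, μ n τ ≤ v → Bdd L τ → Frame (.loop P C) σ τ → I n τ →
      wp L (.loop P C) τ fun k ρ => Q (n + k) ρ by
    simpa using H (μ 0 σ) 0 σ le_rfl hσ (Frame.refl _ _) h0
  have hc : ∀ τ, Bdd L τ → P.cost τ + 1 ≤ unit L := by
    intro τ hτ
    have hc := P.cost_le hL hτ
    have h3 : P.wt * L ^ 2 ≤ 999 * L ^ 2 := by gcongr
    unfold unit; nlinarith
  intro v
  induction v with
  | zero =>
    intro n τ hv hτ hF hI
    by_cases hP : P.Holds τ
    · obtain ⟨_, _, _, _, _, _, _, h⟩ := step n τ hτ hF hI hP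
      omega
    · exact ⟨1, _, τ, .loop_done hP, by simpa using hc τ hτ, hτ, done n τ hτ hF hI hP⟩
  | succ v ih =>
    intro n τ hv hτ hF hI
    by_cases hP : P.Holds τ
    · obtain ⟨k, t, ρ, hr, ht, hb, hI', hμ⟩ := step n τ hτ hF hI hP
      have hF' : Frame (.loop P C) σ ρ := hF.trans ⟨hr.frame.reg, hr.frame.mem⟩
      obtain ⟨k', t', ρ', hr', ht', hb', h⟩ := ih (n + 1 + k) ρ (by omega) hb hF' hI'
      refine ⟨1 + k + k', _, ρ', .loop_step hP hr hr', ?_, hb', ?_⟩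
      · have := hc τ hτ
        nlinarith
      · convert h using 1; ring
    · exact ⟨1, _, τ, .loop_done hP, by simpa using hc τ hτ, hτ, done n τ hτ hF hI hP⟩

/-- The rule for loops: `I n τ` is an invariant, where `n` is the number of time units spent, and
the natural number `μ τ` decreases. -/
theorem wp_loop {P : Test} (I : ℕ → State → Prop) (μ : State → ℕ) (hL : 1 ≤ L) (hσ : Bdd L σ)
    (h0 : I 0 σ)
    (step : ∀ n τ, Bdd L τ → Frame (.loop P C) σ τ → I n τ → P.Holds τ →
      wp L C τ fun k ρ => I (n + 1 + k) ρ ∧ μ ρ < μ τ)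
    (done : ∀ n τ, Bdd L τ → Frame (.loop P C) σ τ → I n τ → ¬ P.Holds τ → Q (n + 1) τ)
    (hw : P.wt ≤ 999 := by exact Nat.le_of_ble_eq_true rfl) : wp L (.loop P C) σ Q :=
  wp_loop_of_measure I (fun _ => μ) hL hσ h0 step done hw

/-- The rule for loops whose running time is bounded by the invariant. -/
theorem wp_loop_of_bounded {P : Test} (I : ℕ → State → Prop) (B : ℕ) (hL : 1 ≤ L) (hσ : Bdd L σ)
    (h0 : I 0 σ) (hB : ∀ n τ, I n τ → n ≤ B)
    (step : ∀ n τ, Bdd L τ → Frame (.loop P C) σ τ → I n τ → P.Holds τ →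
      wp L C τ fun k ρ => I (n + 1 + k) ρ)
    (done : ∀ n τ, Bdd L τ → Frame (.loop P C) σ τ → I n τ → ¬ P.Holds τ → Q (n + 1) τ)
    (hw : P.wt ≤ 999 := by exact Nat.le_of_ble_eq_true rfl) : wp L (.loop P C) σ Q :=
  -- Each round spends at least one unit, so the rest of the budget is a decreasing measure.
  wp_loop_of_measure I (fun n _ => B - n) hL hσ h0 (fun n τ h1 h2 h3 h4 =>
    (step n τ h1 h2 h3 h4).mono fun k ρ _ _ h => ⟨h, by have := hB _ _ h; omega⟩) done hw

end

/-! ### Simplification rules for expressions and tests -/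

@[simp] theorem Expr.eval_ofNat (σ : State) (n : ℕ) : Expr.eval σ (no_index (OfNat.ofNat n)) = n := rfl
@[simp] theorem Expr.eval_reg (σ : State) (z : Reg) : Expr.eval σ (§z) = σ.reg z := rfl
@[simp] theorem Expr.eval_cell (σ : State) (A : Arr) (e : Expr) :
    Expr.eval σ (.cell A e) = σ.mem A (e.eval σ) := rfl
@[simp] theorem Expr.eval_add (σ : State) (e f : Expr) :
    Expr.eval σ (e + f) = e.eval σ + f.eval σ := rfl
@[simp] theorem Expr.eval_sub (σ : State) (e f : Expr) :
    Expr.eval σ (e - f) = e.eval σ - f.eval σ := rfl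
@[simp] theorem Expr.eval_mul (σ : State) (e f : Expr) :
    Expr.eval σ (e * f) = e.eval σ * f.eval σ := rfl
@[simp] theorem Expr.eval_div (σ : State) (e f : Expr) :
    Expr.eval σ (e / f) = e.eval σ / f.eval σ := rfl
@[simp] theorem Expr.eval_mod (σ : State) (e f : Expr) :
    Expr.eval σ (e % f) = e.eval σ % f.eval σ := rfl
@[simp] theorem Test.holds_lt (σ : State) (e f : Expr) :
    (Test.lt e f).Holds σ ↔ e.eval σ < f.eval σ := Iff.rfl
@[simp] theorem Test.holds_eq (σ : State) (e f : Expr) :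
    (Test.eq e f).Holds σ ↔ e.eval σ = f.eval σ := Iff.rfl
@[simp] theorem Test.holds_and (σ : State) (P P' : Test) :
    (Test.and P P').Holds σ ↔ P.Holds σ ∧ P'.Holds σ := Iff.rfl

/-! ### Roots and greatest common divisors -/

/-! ### Roots and greatest common divisors -/

section

variable {L : ℕ} {σ : State}

/-- `hM` says that `M` does not depend on the register `a`, which is counted upwards. The last
clause expresses minimality of the root. -/
theorem wp_ceilCubeRoot (hL : 1 ≤ L) (hσ : Bdd L σ) {M : Expr} {v : ℕ} (hv : v < 2 ^ L)
    (hM : ∀ τ, Frame (ceilCubeRoot M) σ τ → M.eval τ = v)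
    (hw : (Test.lt (§Reg.a * §Reg.a * §Reg.a) M).wt ≤ 999) :
    wp L (ceilCubeRoot M) σ fun n τ =>
      n ≤ 2 * τ.reg .a + 2 ∧ v ≤ τ.reg .a ^ 3 ∧ ∀ k < τ.reg .a, k ^ 3 < v := by
  unfold ceilCubeRoot
  refine wp_seq (wp_assign hL hσ (by simp) fun hσ1 => ?_)
  have hF1 : Frame (ceilCubeRoot M) σ (σ.setReg .a 0) :=
    ⟨fun z hz => by
      have : z ≠ .a := by rintro rfl; simp [ceilCubeRoot, Cmd.writes] at hz
      simp [this], fun _ _ => rfl⟩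
  refine wp_loop (fun n τ => n = 2 * τ.reg .a ∧ ∀ k < τ.reg .a, k ^ 3 < v)
    (fun τ => v - τ.reg .a) hL hσ1 (by simp) ?_ ?_ hw
  · rintro n τ hτ hF ⟨rfl, hI⟩ hP
    have hMτ := hM τ (hF1.trans ⟨fun z hz => hF.reg z (by simp_all [ceilCubeRoot, Cmd.writes]),
      fun A hA => hF.mem A rfl⟩)
    simp only [Test.holds_lt, Expr.eval_mul, Expr.eval_reg, hMτ] at hP
    have h1 : τ.reg .a < v := by
      refine lt_of_le_of_lt ?_ hP
      rcases Nat.eq_zero_or_pos (τ.reg .a) with h | h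
      · simp [h]
      · nlinarith [Nat.mul_pos h h]
    refine wp_assign hL hτ (by simp; omega) fun hb => ?_
    simp only [Expr.eval_add, Expr.eval_reg, Expr.eval_ofNat, State.setReg_reg, if_true]
    refine ⟨⟨by ring, fun k hk => ?_⟩, by omega⟩
    rcases Nat.lt_succ_iff_lt_or_eq.1 hk with hk | rfl
    · exact hI k hk
    · rw [pow_three, ← mul_assoc]; exact hP
  · rintro n τ hτ hF ⟨rfl, hI⟩ hP
    have hMτ := hM τ (hF1.trans ⟨fun z hz => hF.reg z (by simp_all [ceilCubeRoot, Cmd.writes]),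
      fun A hA => hF.mem A rfl⟩)
    simp only [Test.holds_lt, Expr.eval_mul, Expr.eval_reg, hMτ, not_lt] at hP
    exact ⟨by omega, by rw [pow_three, ← mul_assoc]; exact hP, hI⟩

theorem wp_ceilSqrt (hL : 1 ≤ L) (hσ : Bdd L σ) :
    wp L ceilSqrt σ fun n τ =>
      n ≤ 2 * τ.reg .b + 2 ∧ σ.reg .a ≤ τ.reg .b ^ 2 ∧ ∀ k < τ.reg .b, k ^ 2 < σ.reg .a := by
  unfold ceilSqrt
  have ha := hσ.reg .a
  refine wp_seq (wp_assign hL hσ (by simp) fun hσ1 => ?_)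
  refine wp_loop (fun n τ => n = 2 * τ.reg .b ∧ ∀ k < τ.reg .b, k ^ 2 < σ.reg .a)
    (fun τ => σ.reg .a - τ.reg .b) hL hσ1 (by simp) ?_ ?_
  · rintro n τ hτ hF ⟨rfl, hI⟩ hP
    have hMτ : τ.reg .a = σ.reg .a := by simpa using hF.reg .a rfl
    simp only [Test.holds_lt, Expr.eval_mul, Expr.eval_reg, hMτ] at hP
    have h1 : τ.reg .b < σ.reg .a := lt_of_le_of_lt (Nat.le_mul_self _) hP
    refine wp_assign hL hτ (by simp; omega) fun hb => ?_
    simp only [Expr.eval_add, Expr.eval_reg, Expr.eval_ofNat, State.setReg_reg, if_true]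
    refine ⟨⟨by ring, fun k hk => ?_⟩, by omega⟩
    rcases Nat.lt_succ_iff_lt_or_eq.1 hk with hk | rfl
    · exact hI k hk
    · rw [sq]; exact hP
  · rintro n τ hτ hF ⟨rfl, hI⟩ hP
    have hMτ : τ.reg .a = σ.reg .a := by simpa using hF.reg .a rfl
    simp only [Test.holds_lt, Expr.eval_mul, Expr.eval_reg, hMτ, not_lt] at hP
    exact ⟨by omega, by rw [sq]; exact hP, hI⟩

/-- A linear bound suffices, since `v` will be of the size of `a`: each round of Euclid's algorithm
takes four units and lowers `r` by at least one. -/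
theorem wp_gcdTest (hL : 1 ≤ L) (hσ : Bdd L σ) {e : Expr} {v : ℕ} (hv : v < 2 ^ L)
    (he : e.eval (σ.setReg .g (σ.reg .N)) = v) (hw : e.wt ≤ 498) :
    wp L (gcdTest e) σ fun n τ => n ≤ 4 * v + 6 ∧
      τ.reg .outU = (if 1 < (σ.reg .N).gcd v then (σ.reg .N).gcd v else σ.reg .outU) ∧
      τ.reg .outV =
        (if 1 < (σ.reg .N).gcd v then σ.reg .N / (σ.reg .N).gcd v else σ.reg .outV) := by
  unfold gcdTest
  refine wp_seq (wp_assign hL hσ (hσ.reg .N) fun hσ1 => ?_)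
  refine wp_seq (wp_assign hL hσ1 (by simpa [he] using hv) (fun hσ2 => ?_) hw)
  simp only [Expr.eval_reg, he] at hσ2 ⊢
  refine wp_seq (wp_loop (fun n τ => n + 4 * τ.reg .r ≤ 4 * v ∧
    (τ.reg .g).gcd (τ.reg .r) = (σ.reg .N).gcd v) (fun τ => τ.reg .r) hL hσ2 (by simp) ?_ ?_)
  · rintro n τ hτ hF ⟨h1, h2⟩ hP
    simp only [Test.holds_lt, Expr.eval_ofNat, Expr.eval_reg] at hP
    have hlt := Nat.mod_lt (τ.reg .g) hP
    refine wp_seq (wp_assign hL hτ ?_ fun hτ1 => ?_)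
    · exact (Nat.mod_le _ _).trans_lt (hτ.reg .g)
    refine wp_seq (wp_assign hL hτ1 (hτ1.reg .r) fun hτ2 => ?_)
    refine wp_assign hL hτ2 (hτ2.reg .k) fun hτ3 => ?_
    simp only [Expr.eval_mod, Expr.eval_reg, State.setReg_reg, if_true, reduceCtorEq, if_false]
    refine ⟨⟨by omega, ?_⟩, hlt⟩
    rw [← h2, Nat.gcd_comm, ← Nat.gcd_rec, Nat.gcd_comm]
  · rintro n τ hτ hF ⟨h1, h2⟩ hP
    have hr : τ.reg .r = 0 := by simpa using hP
    have hg : τ.reg .g = (σ.reg .N).gcd v := by rw [← h2, hr, Nat.gcd_zero_right]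
    have hN : τ.reg .N = σ.reg .N := by simpa using hF.reg .N rfl
    have hU : τ.reg .outU = σ.reg .outU := by simpa using hF.reg .outU rfl
    have hV : τ.reg .outV = σ.reg .outV := by simpa using hF.reg .outV rfl
    refine wp_branch hL hτ (fun h => ?_) (fun h => ?_)
    · simp only [Test.holds_lt, Expr.eval_ofNat, Expr.eval_reg, hg] at h
      refine wp_seq (wp_assign hL hτ (hτ.reg .g) fun hτ1 => ?_)
      refine wp_assign hL hτ1 ?_ fun hτ2 => ?_
      · exact (Nat.div_le_self _ _).trans_lt (hτ1.reg .N)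
      simp [hg, hN, h]
      omega
    · simp only [Test.holds_lt, Expr.eval_ofNat, Expr.eval_reg, hg] at h
      refine wp_skip hL hτ ?_
      simp [h, hU, hV]
      omega

end

/-! ### The table of inverses -/

/-! ### Inverses -/

/-- The value `v` is the inverse of `x` modulo `m`, or `0` if there is none. -/
def IsInv (m x v : ℕ) : Prop :=
  (x.Coprime m → v < m ∧ v * x ≡ 1 [MOD m]) ∧ (¬ x.Coprime m → v = 0)

/-- The number of unmarked residues modulo `m`. -/
def unmarked (m : ℕ) (M : ℕ → ℕ) : ℕ := ((Finset.range m).filter fun x => M x = 0).card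

theorem unmarked_le (m : ℕ) (M : ℕ → ℕ) : unmarked m M ≤ m := by
  simpa [unmarked] using Finset.card_filter_le (Finset.range m) fun x => M x = 0

theorem unmarked_update {m x : ℕ} {M : ℕ → ℕ} (hx : x < m) (h : M x = 0) :
    unmarked m (Function.update M x 1) + 1 = unmarked m M := by
  unfold unmarked
  rw [← Finset.card_erase_add_one (s := (Finset.range m).filter fun x => M x = 0) (a := x)
    (by simp [hx, h])]
  congr 2
  ext y
  by_cases hy : y = x <;> simp [hy]

/-- Within one run through the powers of `r`, either all residues met are invertible or none is. -/
theorem coprime_pow_succ_mod (r j m : ℕ) : (r ^ (j + 1) % m).Coprime m ↔ r.Coprime m := by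
  rw [Nat.Coprime, ← Nat.gcd_rec, Nat.gcd_comm, ← Nat.Coprime,
    Nat.coprime_pow_left_iff (by omega)]

/-- Running through the powers of `r`. -/
def powerLoop : Cmd :=
  .loop (.cell .mark §Reg.p ≐ 0) (.store .mark §Reg.p 1 ;; .store .stack §Reg.k §Reg.p ;;
    Reg.k ⟵ §Reg.k + 1 ;; Reg.p ⟵ (§Reg.p * §Reg.r) % §Reg.m)

/-- Storing the inverses of the powers of `r`. -/
def inverseLoop : Cmd :=
  .loop (0 ≺ §Reg.k) (Reg.k ⟵ §Reg.k - 1 ;; Reg.q ⟵ (§Reg.q * §Reg.r) % §Reg.m ;;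
    .store .inv (.cell .stack §Reg.k) §Reg.q)

section

variable {L : ℕ} {σ : State}

/-- Every round marks a residue that was unmarked, so the loop ends, and the last clause lets the
caller charge its time to the drop in unmarked residues. That all stacked residues were unmarked
beforehand is recorded in order to exclude that `1` is among them. -/
theorem wp_powerLoop (hL : 1 ≤ L) (hσ : Bdd L σ) {m r : ℕ} (hm : σ.reg .m = m)
    (hr : σ.reg .r = r) (hrm : r < m) (hp : σ.reg .p = r) (hk : σ.reg .k = 0) :
    wp L powerLoop σ fun n τ => n = 5 * τ.reg .k + 1 ∧ τ.reg .p = r ^ (τ.reg .k + 1) % m ∧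
      (∀ j < τ.reg .k, τ.mem .stack j = r ^ (j + 1) % m ∧ σ.mem .mark (r ^ (j + 1) % m) = 0) ∧
      (∀ x < m, τ.mem .mark x ≠ 0 ↔
        σ.mem .mark x ≠ 0 ∨ ∃ j < τ.reg .k, x = r ^ (j + 1) % m) ∧
      τ.mem .mark (τ.reg .p) ≠ 0 ∧
      τ.reg .k + unmarked m (τ.mem .mark) = unmarked m (σ.mem .mark) := by
  have hm0 : 0 < m := by omega
  have hmL : m < 2 ^ L := hm ▸ hσ.reg .m
  refine wp_loop (fun n τ => n = 5 * τ.reg .k ∧ τ.reg .p = r ^ (τ.reg .k + 1) % m ∧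
      (∀ j < τ.reg .k, τ.mem .stack j = r ^ (j + 1) % m ∧ σ.mem .mark (r ^ (j + 1) % m) = 0) ∧
      (∀ x < m, τ.mem .mark x ≠ 0 ↔
        σ.mem .mark x ≠ 0 ∨ ∃ j < τ.reg .k, x = r ^ (j + 1) % m) ∧
      τ.reg .k + unmarked m (τ.mem .mark) = unmarked m (σ.mem .mark))
    (fun τ => unmarked m (τ.mem .mark)) hL hσ ?_ ?_ ?_
  · simp [hk, hp, Nat.mod_eq_of_lt hrm]
  · rintro n τ hτ hF ⟨rfl, h1, h2, h3, h4⟩ hP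
    have hm' : τ.reg .m = m := (hF.reg .m rfl).trans hm
    have hr' : τ.reg .r = r := (hF.reg .r rfl).trans hr
    simp only [Test.holds_eq, Expr.eval_cell, Expr.eval_reg, Expr.eval_ofNat] at hP
    have hpm : τ.reg .p < m := h1 ▸ Nat.mod_lt _ hm0
    have hU := unmarked_update hpm hP
    have hle := unmarked_le m (σ.mem .mark)
    have hP0 : σ.mem .mark (τ.reg .p) = 0 := by
      by_contra h
      exact (h3 _ hpm).2 (Or.inl h) hP
    refine wp_seq (wp_store hL hτ (hτ.reg .p) (by simp; omega) fun hτ1 => ?_)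
    refine wp_seq (wp_store hL hτ1 (hτ1.reg .k) (hτ1.reg .p) fun hτ2 => ?_)
    refine wp_seq (wp_assign hL hτ2 (by simp; omega) fun hτ3 => ?_)
    refine wp_assign hL hτ3 ?_ fun hτ4 => ?_
    · simp only [Expr.eval_mod, Expr.eval_reg, State.setReg_reg, State.setMem_reg, reduceCtorEq,
        if_false, hm']
      exact (Nat.mod_lt _ hm0).trans hmL
    simp only [Expr.eval_mod, Expr.eval_mul, Expr.eval_add, Expr.eval_reg, Expr.eval_ofNat,
      State.setReg_reg, State.setReg_mem, State.setMem_reg, State.setMem_mem, reduceCtorEq,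
      if_false, if_true, hm', hr']
    refine ⟨⟨by ring, ?_, ?_, ?_, by omega⟩, by omega⟩
    · rw [h1, pow_succ r (τ.reg .k + 1), Nat.mod_mul_mod]
    · intro j hj
      rw [Function.update_apply]
      split_ifs with h
      · subst h; exact ⟨h1, h1 ▸ hP0⟩
      · exact h2 j (by omega)
    · intro x hx
      rw [Function.update_apply]
      split_ifs with h
      · simp only [ne_eq, one_ne_zero, not_false_eq_true, true_iff]
        exact Or.inr ⟨τ.reg .k, by omega, h.trans h1⟩
      · rw [h3 x hx]
        refine or_congr_right ⟨fun ⟨j, hj, e⟩ => ⟨j, by omega, e⟩, fun ⟨j, hj, e⟩ => ⟨j, ?_, e⟩⟩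
        rcases Nat.lt_succ_iff_lt_or_eq.1 hj with hj | rfl
        · exact hj
        · exact absurd (e.trans h1.symm) h
  · rintro n τ hτ hF ⟨rfl, h1, h2, h3, h4⟩ hP
    exact ⟨rfl, h1, h2, h3, by simpa using hP, h4⟩

/-- If `q` inverts `r ^ (k + 2)`, then `q r` inverts `r ^ (k + 1)`. If `r` is not prime to `m`, the
loop starts with `q = 0` and writes zeros, as `IsInv` demands. -/
theorem wp_inverseLoop (hL : 1 ≤ L) (hσ : Bdd L σ) {m r K : ℕ} (hm : σ.reg .m = m)
    (hr : σ.reg .r = r) (hm0 : 0 < m) (hk : σ.reg .k = K)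
    (hS : ∀ j < K, σ.mem .stack j = r ^ (j + 1) % m)
    (hq : IsInv m (r ^ (K + 1) % m) (σ.reg .q)) :
    wp L inverseLoop σ fun n τ => n = 4 * K + 1 ∧
      (∀ x < m, (∀ j < K, x ≠ r ^ (j + 1) % m) → τ.mem .inv x = σ.mem .inv x) ∧
      ∀ j < K, IsInv m (r ^ (j + 1) % m) (τ.mem .inv (r ^ (j + 1) % m)) := by
  have hmL : m < 2 ^ L := hm ▸ hσ.reg .m
  refine wp_loop (fun n τ => n + 4 * τ.reg .k = 4 * K ∧
      IsInv m (r ^ (τ.reg .k + 1) % m) (τ.reg .q) ∧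
      (∀ x < m, (∀ j < K, x ≠ r ^ (j + 1) % m) → τ.mem .inv x = σ.mem .inv x) ∧
      ∀ j, τ.reg .k ≤ j → j < K → IsInv m (r ^ (j + 1) % m) (τ.mem .inv (r ^ (j + 1) % m)))
    (fun τ => τ.reg .k) hL hσ ?_ ?_ ?_
  · refine ⟨by simp [hk], by rwa [hk], by simp, fun j h1 h2 => by omega⟩
  · rintro n τ hτ hF ⟨h1, h2, h3, h4⟩ hP
    have hm' : τ.reg .m = m := (hF.reg .m rfl).trans hm
    have hr' : τ.reg .r = r := (hF.reg .r rfl).trans hr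
    have hS' : τ.mem .stack = σ.mem .stack := hF.mem .stack rfl
    simp only [Test.holds_lt, Expr.eval_reg, Expr.eval_ofNat] at hP
    obtain ⟨k, hk'⟩ : ∃ k, τ.reg .k = k + 1 := ⟨τ.reg .k - 1, by omega⟩
    rw [hk'] at h1 h2 h4
    have hkL : k < 2 ^ L := by have := hτ.reg .k; omega
    have hqm : τ.reg .q * r % m < m := Nat.mod_lt _ hm0
    have hrk : r ^ (k + 1) % m < m := Nat.mod_lt _ hm0
    have hinv : IsInv m (r ^ (k + 1) % m) (τ.reg .q * r % m) := by
      have e := coprime_pow_succ_mod r k m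
      have e' := coprime_pow_succ_mod r (k + 1) m
      refine ⟨fun h => ⟨hqm, ?_⟩, fun h => ?_⟩
      · have := (h2.1 (e'.2 (e.1 h))).2
        refine Nat.ModEq.trans ?_ this
        calc τ.reg .q * r % m * (r ^ (k + 1) % m) ≡ τ.reg .q * r * r ^ (k + 1) [MOD m] :=
              (Nat.mod_modEq _ _).mul (Nat.mod_modEq _ _)
          _ = τ.reg .q * r ^ (k + 1 + 1) := by ring
          _ ≡ τ.reg .q * (r ^ (k + 1 + 1) % m) [MOD m] := (Nat.ModEq.refl _).mul
              (Nat.mod_modEq _ _).symm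
      · rw [h2.2 (fun h' => h (e.2 (e'.1 h'))), zero_mul, Nat.zero_mod]
    refine wp_seq (wp_assign hL hτ (by simp; omega) fun hτ1 => ?_)
    refine wp_seq (wp_assign hL hτ1 ?_ fun hτ2 => ?_)
    · simp only [Expr.eval_mod, Expr.eval_reg, Expr.eval_mul, State.setReg_reg, reduceCtorEq,
        if_false, hm', hr']
      exact hqm.trans hmL
    refine wp_store hL hτ2 (hτ2.mem _ _) (hτ2.reg _) fun hτ3 => ?_
    simp only [Expr.eval_mod, Expr.eval_mul, Expr.eval_sub, Expr.eval_reg, Expr.eval_ofNat,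
      Expr.eval_cell, State.setReg_reg, State.setReg_mem, State.setMem_reg, State.setMem_mem,
      reduceCtorEq, if_false, if_true, hm', hr', hS', hk', Nat.add_sub_cancel]
    rw [hS k (by omega)]
    refine ⟨⟨by omega, hinv, ?_, ?_⟩, by omega⟩
    · intro x hx hxj
      rw [Function.update_of_ne (hxj k (by omega)), h3 x hx hxj]
    · intro j hj1 hj2
      -- The powers need not be known to be distinct: a value overwritten at a repeated residue is
      -- replaced by another correct one.
      by_cases hjk : r ^ (j + 1) % m = r ^ (k + 1) % m
      · rw [hjk, Function.update_self]; exact hinv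
      · rw [Function.update_of_ne hjk]
        refine h4 j ?_ hj2
        rcases Nat.lt_or_eq_of_le hj1 with h | rfl
        · omega
        · exact absurd rfl hjk
  · rintro n τ hτ hF ⟨h1, h2, h3, h4⟩ hP
    have hk0 : τ.reg .k = 0 := by simpa using hP
    exact ⟨by omega, h3, fun j hj => h4 j (by omega) hj⟩

/-- The time is linear although many `r` are tried: each residue is marked only once, so all the
runs together have at most `m` entries. -/
theorem wp_invertAll (hL : 1 ≤ L) (hσ : Bdd L σ) {m : ℕ} (hm : σ.reg .m = m) (hm2 : 2 ≤ m) :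
    wp L invertAll σ fun n τ => n ≤ 22 * m + 10 ∧ ∀ x < m, IsInv m x (τ.mem .inv x) := by
  have hmL : m < 2 ^ L := hm ▸ hσ.reg .m
  unfold invertAll
  refine wp_seq (wp_assign hL hσ (by simp) fun hσ1 => ?_)
  refine wp_seq (wp_loop (fun n τ => n = 4 * τ.reg .r ∧ τ.reg .r ≤ m ∧
    ∀ x < τ.reg .r, τ.mem .mark x = 0 ∧ τ.mem .inv x = 0) (fun τ => m - τ.reg .r) hL hσ1
    (by simp) ?_ ?_)
  · rintro n τ hτ hF ⟨rfl, h1, h2⟩ hP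
    have hm' : τ.reg .m = m := (hF.reg .m rfl).trans hm
    simp only [Test.holds_lt, Expr.eval_reg, hm'] at hP
    refine wp_seq (wp_store hL hτ (hτ.reg .r) (by simp) fun hτ1 => ?_)
    refine wp_seq (wp_store hL hτ1 (hτ1.reg .r) (by simp) fun hτ2 => ?_)
    refine wp_assign hL hτ2 (by simp; omega) fun hτ3 => ?_
    simp only [Expr.eval_add, Expr.eval_reg, Expr.eval_ofNat, State.setReg_reg, State.setReg_mem,
      State.setMem_reg, State.setMem_mem, reduceCtorEq, if_false, if_true]
    refine ⟨⟨by ring, hP, fun x hx => ?_⟩, by omega⟩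
    simp only [Function.update_apply]
    split_ifs with h
    · exact ⟨rfl, rfl⟩
    · exact h2 x (by omega)
  rintro n τ hτ hF ⟨rfl, h1, h2⟩ hP
  have hm' : τ.reg .m = m := (hF.reg .m rfl).trans hm
  simp only [Test.holds_lt, Expr.eval_reg, hm', not_lt] at hP
  have hrm : τ.reg .r = m := le_antisymm h1 hP
  rw [hrm] at h2 ⊢
  clear hF
  refine wp_seq (wp_store hL hτ (by simp; omega) (by simp; omega) fun hτ1 => ?_)
  refine wp_seq (wp_store hL hτ1 (by simp; omega) (by simp; omega) fun hτ2 => ?_)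
  refine wp_seq (wp_assign hL hτ2 (by simp; omega) fun hτ3 => ?_)
  -- A round with `K` new residues takes `9 K + 7` units. It is paid by 10 units for each residue
  -- that gets marked and 8 for each `r`; the summand 16 reflects the start at `r = 2`. A residue is
  -- either settled or still unmarked with entry `0`.
  refine wp_loop (fun n τ => n + 10 * unmarked m (τ.mem .mark) + 16 ≤ 10 * m + 8 * τ.reg .r ∧
    τ.reg .r ≤ m ∧ τ.mem .mark 1 ≠ 0 ∧ (∀ x < m, IsInv m x (τ.mem .inv x) ∨
      τ.mem .mark x = 0 ∧ τ.mem .inv x = 0) ∧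
    ∀ x, 1 ≤ x → x < τ.reg .r → τ.mem .mark x ≠ 0) (fun τ => m - τ.reg .r) hL hτ3 ?_ ?_ ?_
  · simp only [Expr.eval_ofNat, State.setReg_reg, State.setReg_mem,
      State.setMem_mem, reduceCtorEq, if_false, if_true]
    refine ⟨?_, hm2, by simp, fun x hx => ?_, fun x hx1 hx2 => ?_⟩
    · have := unmarked_le m (Function.update (τ.mem .mark) 1 1)
      omega
    · simp only [Function.update_apply]
      split_ifs with h
      · subst h
        exact Or.inl ⟨fun _ => ⟨by omega, rfl⟩, fun h => absurd (Nat.coprime_one_left m) h⟩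
      · exact Or.inr (h2 x hx)
    · obtain rfl : x = 1 := by omega
      simp
  · rintro n ρ hρ hF ⟨h3, h4, h5, h6, h7⟩ hP
    have hm'' : ρ.reg .m = m := by simpa [hm'] using hF.reg .m rfl
    simp only [Test.holds_lt, Expr.eval_reg, hm''] at hP
    set r := ρ.reg .r with hr
    refine wp_seq (wp_assign hL hρ (hρ.reg .r) fun hρ1 => ?_)
    refine wp_seq (wp_assign hL hρ1 (by simp) fun hρ2 => ?_)
    refine wp_seq ((wp_powerLoop hL hρ2 (m := m) (r := r) (by simpa using hm'') (by simp [hr]) hP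
      (by simp [hr]) (by simp)).mono ?_)
    simp only [State.setReg_mem]
    rintro n1 τ1 hτ1 hF1 ⟨rfl, a1, a2, a3, a4, a5⟩
    have hm1 : τ1.reg .m = m := (hF1.reg .m rfl).trans hm''
    have hr1 : τ1.reg .r = r := hF1.reg .r rfl
    have hi1 : τ1.mem .inv = ρ.mem .inv := hF1.mem .inv rfl
    have hpm : τ1.reg .p < m := a1 ▸ Nat.mod_lt _ (by omega)
    refine wp_seq (wp_assign hL hτ1 (hτ1.mem _ _) fun hτ2 => ?_)
    -- The run stops at a marked residue. If it was marked earlier, the table already has its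
    -- inverse. Otherwise the run has met itself; for invertible `r` cancellation would give `r ^ (i
    -- + 1) ≡ 1` for a stacked power, but `1` was marked from the start. So `r` is not invertible,
    -- and the entry `0` is right.
    have hq : IsInv m (r ^ (τ1.reg .k + 1) % m) (ρ.mem .inv (τ1.reg .p)) := by
      rw [← a1]
      rcases h6 _ hpm with h | ⟨h, h'⟩
      · exact h
      · refine ⟨fun hc => ?_, fun _ => h'⟩
        exfalso
        rcases (a3 _ hpm).1 a4 with h8 | ⟨j, hj, h8⟩
        · exact h8 h
        · rw [a1] at h8 hc
          have hrc := (coprime_pow_succ_mod _ _ _).1 hc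
          obtain ⟨i, hi⟩ : ∃ i, τ1.reg .k = j + (i + 1) := ⟨τ1.reg .k - j - 1, by omega⟩
          have h9 : r ^ (i + 1) ≡ 1 [MOD m] := by
            refine Nat.ModEq.cancel_left_of_coprime (c := r ^ (j + 1)) ?_ ?_
            · rw [Nat.gcd_comm]; exact Nat.Coprime.pow_left _ hrc
            · rw [mul_one, ← pow_add]
              rw [hi] at h8
              have e : j + 1 + (i + 1) = j + (i + 1) + 1 := by ring
              rw [e]; exact h8
          have h10 := (a2 i (by omega)).2
          rw [h9, Nat.mod_eq_of_lt (by omega)] at h10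
          exact h5 h10
    refine wp_seq ((wp_inverseLoop hL hτ2 (m := m) (r := r) (K := τ1.reg .k) (by simpa using hm1)
      (by simpa using hr1) (by omega) (by simp) (fun j hj => (a2 j hj).1)
      (by simpa [hi1] using hq)).mono ?_)
    rintro n2 τ3 hτ3 hF3 ⟨rfl, b1, b2⟩
    have hr3 : τ3.reg .r = r := (hF3.reg .r rfl).trans (by simpa using hr1)
    have hM3 : τ3.mem .mark = τ1.mem .mark := (hF3.mem .mark rfl)
    refine wp_assign hL hτ3 (by simp; omega) fun hτ4 => ?_
    simp only [Expr.eval_add, Expr.eval_reg, Expr.eval_ofNat, State.setReg_reg, State.setReg_mem,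
      if_true, hr3, hM3]
    refine ⟨⟨by omega, hP, (a3 1 (by omega)).2 (Or.inl h5), fun x hx => ?_,
      fun x hx1 hx2 => (a3 x (by omega)).2 ?_⟩, by omega⟩
    · by_cases hj : ∃ j < τ1.reg .k, x = r ^ (j + 1) % m
      · obtain ⟨j, hj, rfl⟩ := hj
        exact Or.inl (b2 j hj)
      · have e1 : τ3.mem .inv x = ρ.mem .inv x := by
          rw [b1 x hx fun j hj' h => hj ⟨j, hj', h⟩, State.setReg_mem, hi1]
        rw [e1]
        refine (h6 x hx).imp_right fun h => ⟨?_, h.2⟩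
        by_contra h8
        exact ((a3 x hx).1 h8).elim (fun h9 => h9 h.1) hj
    · rcases Nat.lt_succ_iff_lt_or_eq.1 hx2 with h | rfl
      · exact Or.inl (h7 x hx1 h)
      -- If `r` was unmarked, at least one round was executed, and its first residue is `r` itself.
      · by_cases h8 : ρ.mem .mark r = 0
        · refine Or.inr ⟨0, ?_, by simp [Nat.mod_eq_of_lt hP]⟩
          by_contra h9
          have h9 : τ1.reg .k = 0 := by omega
          rw [h9, zero_add, pow_one, Nat.mod_eq_of_lt hP] at a1
          rw [a1] at a4
          rcases (a3 r hP).1 a4 with h10 | ⟨j, hj, -⟩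
          · exact h10 h8
          · omega
        · exact Or.inl h8
  · rintro n ρ hρ hF ⟨h3, h4, h5, h6, h7⟩ hP
    have hm'' : ρ.reg .m = m := by simpa [hm'] using hF.reg .m rfl
    simp only [Test.holds_lt, Expr.eval_reg, hm'', not_lt] at hP
    refine ⟨by omega, fun x hx => ?_⟩
    rcases h6 x hx with h | ⟨h, h'⟩
    · exact h
    -- Only the residue `0` can still be unmarked; it has no inverse because `m ≥ 2`.
    · rcases Nat.eq_zero_or_pos x with rfl | hx0
      · refine ⟨fun hc => ?_, fun _ => h'⟩
        rw [Nat.coprime_zero_left] at hc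
        omega
      · exact absurd h (h7 x hx0 (by omega))

end

/-! ### Points in cells -/

/-! ### Points in cells -/

/-- In the linked list with entries `X`, `Y` and pointers `Z`, the points of `l` are found from the
pointer `p` on; all pointers are at most `n`. -/
def Chain (X Y Z : ℕ → ℕ) (n : ℕ) : ℕ → List (ℕ × ℕ) → Prop
  | p, [] => p = 0
  | p, q :: l => 0 < p ∧ p ≤ n ∧ X p = q.1 ∧ Y p = q.2 ∧ Chain X Y Z n (Z p) l

/-- Pointers in a chain never exceed `n`, so writing a new entry at `n + 1` leaves the existing
lists intact. -/
theorem Chain.congr {X Y Z X' Y' Z' : ℕ → ℕ} {n n' : ℕ} (hn : n ≤ n')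
    (hX : ∀ p ≤ n, X' p = X p) (hY : ∀ p ≤ n, Y' p = Y p) (hZ : ∀ p ≤ n, Z' p = Z p) :
    ∀ {l : List (ℕ × ℕ)} {p : ℕ}, Chain X Y Z n p l → Chain X' Y' Z' n' p l
  | [], _, h => h
  | _ :: _, p, ⟨h0, h1, h2, h3, h4⟩ =>
    ⟨h0, h1.trans hn, (hX p h1).trans h2, (hY p h1).trans h3,
      (hZ p h1).symm ▸ Chain.congr hn hX hY hZ h4⟩

/-- The number of the cell of a point. -/
def cellNo (w h cols : ℕ) (q : ℕ × ℕ) : ℕ := q.1 / w * cols + q.2 / h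

/-- The points of `l` are listed, sorted by cells (of numbers below `R`), in the arrays for `δ`. -/
def Grid (δ : Fin 2) (w h cols R : ℕ) (l : List (ℕ × ℕ)) (σ : State) : Prop :=
  ∀ c < R, Chain (σ.mem (.px δ)) (σ.mem (.py δ)) (σ.mem (.next δ)) l.length (σ.mem (.head δ) c)
    (l.filter fun q => cellNo w h cols q = c)

/-- The state while points are being listed. -/
structure Listing (δ : Fin 2) (w h cols R : ℕ) (l : List (ℕ × ℕ)) (σ : State) : Prop where
  w_eq : σ.reg .w = w
  h_eq : σ.reg .h = h
  cols_eq : σ.reg .cols = cols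
  n_eq : σ.reg .n = l.length
  grid : Grid δ w h cols R l σ

section

variable {L : ℕ} {σ : State}

/-- The coordinates `e` and `f` are evaluated repeatedly while the point is inserted; `he` and `hf`
ensure that the writes to `n`, `c` and the arrays do not change them. -/
theorem wp_throwPoint (hL : 1 ≤ L) (hσ : Bdd L σ) {δ : Fin 2} {w h cols R : ℕ}
    {l : List (ℕ × ℕ)} (hl : Listing δ w h cols R l σ) {e f : Expr} {x y : ℕ}
    (he : ∀ τ : State, (∀ z, z ≠ .n → z ≠ .c → τ.reg z = σ.reg z) → e.eval τ = x)
    (hf : ∀ τ : State, (∀ z, z ≠ .n → z ≠ .c → τ.reg z = σ.reg z) → f.eval τ = y)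
    (hx : x < 2 ^ L) (hy : y < 2 ^ L) (hn : l.length + 1 < 2 ^ L)
    (hc : cellNo w h cols (x, y) < 2 ^ L)
    (he1 : e.wt ≤ 15) (he2 : e.deg ≤ 2) (hf1 : f.wt ≤ 15) (hf2 : f.deg ≤ 2) :
    wp L (throwPoint δ e f) σ fun k τ => k = 6 ∧ Listing δ w h cols R ((x, y) :: l) τ := by
  obtain ⟨h1, h2, h3, h4, h5⟩ := hl
  unfold throwPoint
  refine wp_seq (wp_assign hL hσ (by simpa [h4] using hn) fun hσ1 => ?_)
  have e1 := he (σ.setReg .n (l.length + 1)) (by simp +contextual)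
  have f1 := hf (σ.setReg .n (l.length + 1)) (by simp +contextual)
  simp only [Expr.eval_add, Expr.eval_reg, h4, Expr.eval_ofNat] at hσ1 ⊢
  refine wp_seq (wp_store hL hσ1 (hσ1.reg .n) (by rw [e1]; exact hx) (fun hσ2 => ?_) ?_ ?_)
  rotate_left
  · exact Nat.le_of_ble_eq_true rfl
  · omega
  simp only [Expr.eval_reg, State.setReg_reg, if_true, e1] at hσ2 ⊢
  have f2 : f.eval ((σ.setReg .n (l.length + 1)).setMem (.px δ) (l.length + 1) x) = y :=
    hf _ (by simp +contextual)
  refine wp_seq (wp_store hL hσ2 (hσ2.reg .n) (by rw [f2]; exact hy) (fun hσ3 => ?_) ?_ ?_)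
  rotate_left
  · exact Nat.le_of_ble_eq_true rfl
  · omega
  simp only [Expr.eval_reg, State.setReg_reg, State.setMem_reg, if_true, f2] at hσ3 ⊢
  set σ3 := ((σ.setReg .n (l.length + 1)).setMem (.px δ) (l.length + 1) x).setMem (.py δ)
    (l.length + 1) y with hσ3d
  have e3 : e.eval σ3 = x := he _ (by simp +contextual [hσ3d])
  have f3 : f.eval σ3 = y := hf _ (by simp +contextual [hσ3d])
  have hw3 : σ3.reg .w = w := by simp [hσ3d, h1]
  have hh3 : σ3.reg .h = h := by simp [hσ3d, h2]
  have hc3 : σ3.reg .cols = cols := by simp [hσ3d, h3]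
  refine wp_seq (wp_assign hL hσ3 ?_ (fun hσ4 => ?_) ?_)
  · simp only [Expr.eval_add, Expr.eval_mul, Expr.eval_div, Expr.eval_reg, e3, f3, hw3, hh3, hc3]
    exact hc
  rotate_left
  -- Here `e` and `f` are variables, so the weight of the cell number must be written out and
  -- estimated by hand.
  · change (e.wt + 2 + (e.deg + 1 + 1) ^ 2 + 2 + (e.deg + 1 + 1 + 1) ^ 2) +
      (f.wt + 2 + (f.deg + 1 + 1) ^ 2) + (e.deg + 1 + 1 + (f.deg + 1) + 1) ^ 2 ≤ 498
    nlinarith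
  simp only [Expr.eval_add, Expr.eval_mul, Expr.eval_div, Expr.eval_reg, e3, f3, hw3, hh3, hc3]
    at hσ4 ⊢
  refine wp_seq (wp_store hL hσ4 (hσ4.reg .n) (hσ4.mem _ _) fun hσ5 => ?_)
  refine wp_store hL hσ5 (hσ5.reg .c) (hσ5.reg .n) fun hσ6 => ?_
  refine ⟨rfl, by simp [hσ3d, h1], by simp [hσ3d, h2], by simp [hσ3d, h3], by simp [hσ3d], ?_⟩
  simp only [Grid, hσ3d, Expr.eval_reg, Expr.eval_cell, State.setReg_reg, State.setReg_mem,
    State.setMem_reg, State.setMem_mem, reduceCtorEq, if_false, if_true, List.length_cons]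
  have key : ∀ {p : ℕ} {l' : List (ℕ × ℕ)},
      Chain (σ.mem (.px δ)) (σ.mem (.py δ)) (σ.mem (.next δ)) l.length p l' →
      Chain (Function.update (σ.mem (.px δ)) (l.length + 1) x)
        (Function.update (σ.mem (.py δ)) (l.length + 1) y)
        (Function.update (σ.mem (.next δ)) (l.length + 1)
          (σ.mem (.head δ) (x / w * cols + y / h))) (l.length + 1) p l' := fun hch =>
    hch.congr (by omega) (fun p hp => Function.update_of_ne (by omega) _ _)
      (fun p hp => Function.update_of_ne (by omega) _ _)
      (fun p hp => Function.update_of_ne (by omega) _ _)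
  intro c hcR
  by_cases hcc : c = x / w * cols + y / h
  · subst hcc
    rw [List.filter_cons_of_pos (by simp [cellNo]), Function.update_self]
    refine ⟨by omega, le_rfl, by simp, by simp, ?_⟩
    rw [Function.update_self]
    exact key (h5 _ hcR)
  · rw [List.filter_cons_of_neg fun hh => hcc (of_decide_eq_true hh).symm,
      Function.update_of_ne hcc]
    exact key (h5 _ hcR)

/-- The hypothesis `haL`, which recurs below, provides enough bits for everything stored during a
search: cell numbers below `(2 a + 2) ^ 2`, pointers, and the candidates for `U` and `V`. -/
theorem wp_clearCells (hL : 1 ≤ L) (hσ : Bdd L σ) (δ : Fin 2) {a w h : ℕ}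
    (ha : σ.reg .a = a) (hw : σ.reg .w = w) (hh : σ.reg .h = h)
    (haL : 16 * (a + 2) ^ 2 ≤ 2 ^ L) :
    wp L (clearCells δ) σ fun n τ => n ≤ 3 * ((2 * a / w + 2) * (2 * a / h + 2)) + 4 ∧
      τ.reg .cols = 2 * a / h + 2 ∧
      ∀ c < (2 * a / w + 2) * (2 * a / h + 2), τ.mem (.head δ) c = 0 := by
  have hw2 : 2 * a / w + 2 ≤ 2 * a + 2 := by have := Nat.div_le_self (2 * a) w; omega
  have hh2 : 2 * a / h + 2 ≤ 2 * a + 2 := by have := Nat.div_le_self (2 * a) h; omega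
  have hR : (2 * a / w + 2) * (2 * a / h + 2) ≤ (2 * a + 2) * (2 * a + 2) :=
    Nat.mul_le_mul hw2 hh2
  have hRL : (2 * a + 2) * (2 * a + 2) < 2 ^ L := by nlinarith
  have h2L : 2 * a + 2 < 2 ^ L := by nlinarith
  unfold clearCells
  refine wp_seq (wp_assign hL hσ (by simp [ha, hw]; omega) fun hσ1 => ?_)
  refine wp_seq (wp_assign hL hσ1 (by simp [ha, hh]; omega) fun hσ2 => ?_)
  refine wp_seq (wp_assign hL hσ2 (by simp) fun hσ3 => ?_)
  simp only [Expr.eval_add, Expr.eval_mul, Expr.eval_div, Expr.eval_reg, Expr.eval_ofNat,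
    State.setReg_reg, reduceCtorEq, if_false, ha, hw, hh] at hσ3 ⊢
  set ro := 2 * a / w + 2
  set co := 2 * a / h + 2
  refine wp_loop (fun n τ => n = 3 * τ.reg .c ∧ τ.reg .c ≤ ro * co ∧
    ∀ c < τ.reg .c, τ.mem (.head δ) c = 0) (fun τ => ro * co - τ.reg .c) hL hσ3 (by simp) ?_ ?_
  · rintro n τ hτ hF ⟨rfl, h1, h2⟩ hP
    have hr : τ.reg .rows = ro := by simpa using hF.reg .rows rfl
    have hc : τ.reg .cols = co := by simpa using hF.reg .cols rfl
    simp only [Test.holds_lt, Expr.eval_mul, Expr.eval_reg, hr, hc] at hP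
    refine wp_seq (wp_store hL hτ (hτ.reg .c) (by simp) fun hτ1 => ?_)
    refine wp_assign hL hτ1 (by simp; omega) fun hτ2 => ?_
    simp only [Expr.eval_add, Expr.eval_reg, Expr.eval_ofNat, State.setReg_reg, State.setReg_mem,
      State.setMem_reg, State.setMem_mem, if_true]
    refine ⟨⟨by ring, by omega, fun c hc => ?_⟩, by omega⟩
    rw [Function.update_apply]
    split_ifs
    · rfl
    · exact h2 c (by omega)
  · rintro n τ hτ hF ⟨rfl, h1, h2⟩ hP
    have hr : τ.reg .rows = ro := by simpa using hF.reg .rows rfl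
    have hc : τ.reg .cols = co := by simpa using hF.reg .cols rfl
    simp only [Test.holds_lt, Expr.eval_mul, Expr.eval_reg, hr, hc, not_lt] at hP
    exact ⟨by omega, hc, fun c hc => h2 c (by omega)⟩

/-- The points `F x y`, for the `x' < x` with inverse `v x' > 0` modulo `m` and the solution `y` of
`x' y ≡ N` modulo `m`. -/
def gather (N m : ℕ) (v : ℕ → ℕ) (F : ℕ → ℕ → List (ℕ × ℕ)) : ℕ → List (ℕ × ℕ)
  | 0 => []
  | x + 1 => if 0 < v x then F x (N % m * v x % m) ++ gather N m v F x else gather N m v F x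

theorem length_gather_le {N m B : ℕ} {v : ℕ → ℕ} {F : ℕ → ℕ → List (ℕ × ℕ)}
    (hF : ∀ x y, (F x y).length ≤ B) (x : ℕ) : (gather N m v F x).length ≤ B * x := by
  induction x with
  | zero => simp [gather]
  | succ x ih =>
    have := hF x (N % m * v x % m)
    unfold gather
    split_ifs
    · rw [List.length_append]; linarith
    · linarith

/-- Inversion takes `22 m` units, and each `x` adds the time `K` of `C` and four more. At most four
points per `x` keep the pointers within bounds. The inverses are returned as a function `v`,
independent of the array that held them. -/
theorem wp_forSolutions (hL : 1 ≤ L) (hσ : Bdd L σ) {C : Cmd} {δ : Fin 2}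
    {N m w h cols R K : ℕ} {F : ℕ → ℕ → List (ℕ × ℕ)} (hF4 : ∀ x y, (F x y).length ≤ 4)
    (hm2 : 2 ≤ m) (hN : σ.reg .N = N) (hm : σ.reg .m = m) (hw : σ.reg .w = w)
    (hh : σ.reg .h = h) (hcols : σ.reg .cols = cols) (hg : Grid δ w h cols R [] σ)
    (hCm : C.writes .m = false) (hCN : C.writes .N = false) (hCx : C.writes .x = false)
    (hCi : C.stores .inv = false)
    (hC : ∀ (τ : State) (l : List (ℕ × ℕ)) (x y : ℕ), Bdd L τ → τ.reg .m = m → τ.reg .x = x →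
      τ.reg .y = y → x < m → y < m → l.length ≤ 4 * x → Listing δ w h cols R l τ →
      wp L C τ fun k ρ => k ≤ K ∧ Listing δ w h cols R (F x y ++ l) ρ) :
    wp L (forSolutions C) σ fun n τ => n ≤ (K + 26) * m + 13 ∧
      ∃ v, (∀ x < m, IsInv m x (v x)) ∧ Listing δ w h cols R (gather N m v F m) τ := by
  have hmL : m < 2 ^ L := hm ▸ hσ.reg .m
  unfold forSolutions
  refine wp_seq ((wp_invertAll hL hσ hm hm2).mono ?_)
  rintro n1 τ1 hτ1 hF1 ⟨hn1, hv⟩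
  refine wp_seq (wp_assign hL hτ1 (by simp) fun hτ2 => ?_)
  refine wp_seq (wp_assign hL hτ2 (by simp; omega) fun hτ3 => ?_)
  set v := τ1.mem .inv with hvd
  have hv0 : v 0 = 0 := (hv 0 (by omega)).2 (by rw [Nat.coprime_zero_left]; omega)
  refine wp_loop (fun n τ => n + (K + 4) ≤ (K + 4) * τ.reg .x ∧ 1 ≤ τ.reg .x ∧ τ.reg .x ≤ m ∧
    Listing δ w h cols R (gather N m v F (τ.reg .x)) τ) (fun τ => m - τ.reg .x) hL hτ3 ?_ ?_ ?_
  · simp only [Expr.eval_ofNat, State.setReg_reg, if_true]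
    refine ⟨by omega, le_rfl, by omega, ?_⟩
    have e : gather N m v F 1 = [] := by simp [gather, hv0]
    rw [e]
    refine ⟨?_, ?_, ?_, by simp, ?_⟩
    · simpa [hw] using hF1.reg .w rfl
    · simpa [hh] using hF1.reg .h rfl
    · simpa [hcols] using hF1.reg .cols rfl
    · simp only [Grid, State.setReg_mem]
      rw [hF1.mem (.px δ) rfl, hF1.mem (.py δ) rfl, hF1.mem (.next δ) rfl, hF1.mem (.head δ) rfl]
      exact hg
  · rintro n τ hτ hF ⟨h1, h2, h3, h4⟩ hP
    have hm' : τ.reg .m = m := by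
      have := hF.reg .m (by simp [Cmd.writes, hCm])
      rw [this]
      simpa [hm] using hF1.reg .m rfl
    have hN' : τ.reg .N = N := by
      have := hF.reg .N (by simp [Cmd.writes, hCN])
      rw [this]
      simpa [hN] using hF1.reg .N rfl
    have hi' : τ.mem .inv = v := by
      have := hF.mem .inv (by simp [Cmd.stores, hCi])
      rw [this]
      simp [hvd]
    simp only [Test.holds_lt, Expr.eval_reg, hm'] at hP
    obtain ⟨x, hx⟩ : ∃ x, τ.reg .x = x := ⟨_, rfl⟩
    rw [hx] at h1 h2 h3 h4 hP ⊢
    have hadv : ∀ (k : ℕ) (ρ : State), Bdd L ρ → k ≤ K + 2 → ρ.reg .x = x →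
        Listing δ w h cols R (gather N m v F (x + 1)) ρ →
        wp L (Reg.x ⟵ §Reg.x + 1) ρ fun n' ρ' => (n + 1 + (k + n') + (K + 4) ≤
          (K + 4) * ρ'.reg .x ∧ 1 ≤ ρ'.reg .x ∧ ρ'.reg .x ≤ m ∧
          Listing δ w h cols R (gather N m v F (ρ'.reg .x)) ρ') ∧ m - ρ'.reg .x < m - x := by
      rintro k ρ hρ hk hρx ⟨g1, g2, g3, g4, g5⟩
      refine wp_assign hL hρ (by simp [hρx]; omega) fun hρ1 => ?_
      simp only [Expr.eval_add, Expr.eval_reg, Expr.eval_ofNat, State.setReg_reg, if_true, hρx]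
      refine ⟨⟨by linarith, by omega, by omega, ?_⟩, by omega⟩
      exact ⟨by simpa using g1, by simpa using g2, by simpa using g3, by simpa using g4, g5⟩
    refine wp_seq (wp_branch hL hτ (fun hpos => ?_) (fun hpos => ?_))
    · simp only [Test.holds_lt, Expr.eval_cell, Expr.eval_reg, Expr.eval_ofNat, hi', hx] at hpos
      refine wp_seq (wp_assign hL hτ ?_ fun hτ4 => ?_)
      · simp only [Expr.eval_mod, Expr.eval_reg, hm']
        exact (Nat.mod_lt _ (by omega)).trans hmL
      simp only [Expr.eval_mod, Expr.eval_mul, Expr.eval_reg, Expr.eval_cell, hN', hm', hi', hx]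
        at hτ4 ⊢
      obtain ⟨g1, g2, g3, g4, g5⟩ := h4
      refine (hC _ (gather N m v F x) x (N % m * v x % m) hτ4 (by simpa using hm')
        (by simpa using hx) (by simp) hP (Nat.mod_lt _ (by omega)) (length_gather_le hF4 x)
        ⟨by simpa using g1, by simpa using g2, by simpa using g3, by simpa using g4, g5⟩).mono ?_
      rintro k ρ hρ hFρ ⟨hk, hl⟩
      refine hadv _ ρ hρ (by omega) ?_ ?_
      · rw [hFρ.reg .x hCx]; simpa using hx
      · rw [gather, if_pos hpos]; exact hl
    · simp only [Test.holds_lt, Expr.eval_cell, Expr.eval_reg, Expr.eval_ofNat, hi', hx] at hpos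
      refine wp_skip hL hτ (hadv _ τ hτ (by omega) hx ?_)
      rw [gather, if_neg hpos]; exact h4
  · rintro n τ hτ hF ⟨h1, h2, h3, h4⟩ hP
    have hm' : τ.reg .m = m := by
      have := hF.reg .m (by simp [Cmd.writes, hCm])
      rw [this]
      simpa [hm] using hF1.reg .m rfl
    simp only [Test.holds_lt, Expr.eval_reg, hm', not_lt] at hP
    have hx : τ.reg .x = m := le_antisymm h3 hP
    rw [hx] at h1 h4
    exact ⟨by nlinarith, v, hv, h4⟩

end

/-! ### Listing the solutions -/

/-! ### The listed points are the points of the modular hyperbola -/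

/-- `q` solves `xy ≡ N` modulo `m`, with `x` prime to `m`, and lies in `[0, 2m) × [0, 2m)`. -/
def IsPoint (N m : ℕ) (q : ℕ × ℕ) : Prop :=
  q.1 < 2 * m ∧ q.2 < 2 * m ∧ q.1.Coprime m ∧ q.1 * q.2 ≡ N [MOD m]

theorem mem_gather {N m : ℕ} {v : ℕ → ℕ} {F : ℕ → ℕ → List (ℕ × ℕ)} {q : ℕ × ℕ} {X : ℕ} :
    q ∈ gather N m v F X ↔ ∃ x < X, 0 < v x ∧ q ∈ F x (N % m * v x % m) := by
  induction X with
  | zero => simp [gather]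
  | succ X ih =>
    unfold gather
    split_ifs with h
    · rw [List.mem_append, ih]
      constructor
      · rintro (hq | ⟨x, hx, h⟩)
        · exact ⟨X, by omega, h, hq⟩
        · exact ⟨x, by omega, h⟩
      · rintro ⟨x, hx, h1, h2⟩
        rcases Nat.lt_succ_iff_lt_or_eq.1 hx with hx | rfl
        · exact Or.inr ⟨x, hx, h1, h2⟩
        · exact Or.inl h2
    · rw [ih]
      constructor
      · rintro ⟨x, hx, h⟩
        exact ⟨x, by omega, h⟩
      · rintro ⟨x, hx, h1, h2⟩
        rcases Nat.lt_succ_iff_lt_or_eq.1 hx with hx | rfl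
        · exact ⟨x, hx, h1, h2⟩
        · exact absurd h1 h

/-- Lists coming from different `x` are disjoint because the first coordinate modulo `m` recovers
`x`. Without repetitions, list lengths become cardinalities in the time analysis. -/
theorem nodup_gather {N m : ℕ} {v : ℕ → ℕ} {F : ℕ → ℕ → List (ℕ × ℕ)} (hm : 0 < m)
    (hF : ∀ x < m, ∀ y < m, (F x y).Nodup)
    (hFm : ∀ x < m, ∀ y < m, ∀ q ∈ F x y, q.1 % m = x) {X : ℕ} (hX : X ≤ m) :
    (gather N m v F X).Nodup := by
  induction X with
  | zero => simp [gather]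
  | succ X ih =>
    unfold gather
    split_ifs with h
    · refine (hF X hX _ (Nat.mod_lt _ hm)).append (ih (by omega)) fun q hq hq' => ?_
      obtain ⟨x, hx, -, hqx⟩ := mem_gather.1 hq'
      have h1 := hFm X hX _ (Nat.mod_lt _ hm) q hq
      have h2 := hFm x (by omega) _ (Nat.mod_lt _ hm) q hqx
      omega
    · exact ih (by omega)

theorem IsInv.pos_iff {m x v : ℕ} (hm : 2 ≤ m) (h : IsInv m x v) : 0 < v ↔ x.Coprime m := by
  constructor
  · intro hv
    by_contra hc
    have := h.2 hc
    omega
  · intro hc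
    have h1 := (h.1 hc).2
    rcases Nat.eq_zero_or_pos v with rfl | hv
    · rw [zero_mul, Nat.ModEq, Nat.zero_mod, Nat.mod_eq_of_lt (by omega)] at h1
      omega
    · exact hv

theorem IsInv.mul_modEq {N m x v : ℕ} (h : IsInv m x v) (hc : x.Coprime m) :
    x * (N % m * v % m) ≡ N [MOD m] := by
  calc x * (N % m * v % m) ≡ x * (N * v) [MOD m] :=
        (Nat.ModEq.refl x).mul ((Nat.mod_modEq _ _).trans ((Nat.mod_modEq _ _).mul_right _))
    _ = N * (v * x) := by ring
    _ ≡ N * 1 [MOD m] := (Nat.ModEq.refl N).mul (h.1 hc).2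
    _ = N := mul_one N

theorem eq_of_mul_modEq {N m x y y' : ℕ} (hc : x.Coprime m) (hy : y < m) (hy' : y' < m)
    (h : x * y ≡ N [MOD m]) (h' : x * y' ≡ N [MOD m]) : y = y' := by
  have := Nat.ModEq.cancel_left_of_coprime (by rwa [Nat.gcd_comm]) (h.trans h'.symm)
  rwa [Nat.ModEq, Nat.mod_eq_of_lt hy, Nat.mod_eq_of_lt hy'] at this

theorem coprime_mod {x m : ℕ} : (x % m).Coprime m ↔ x.Coprime m := by
  rw [Nat.Coprime, ← Nat.gcd_rec, Nat.gcd_comm]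

section

variable {L : ℕ} {σ : State}

/-- The points thrown for the modulus `a - 1`: a solution and its translates. -/
def translates (m x y : ℕ) : List (ℕ × ℕ) := [(x + m, y + m), (x, y + m), (x + m, y), (x, y)]

theorem cellNo_lt {w h a : ℕ} {q : ℕ × ℕ} (h1 : q.1 < 2 * a) (h2 : q.2 < 2 * a) :
    cellNo w h (2 * a / h + 2) q < (2 * a / w + 2) * (2 * a / h + 2) := by
  have h3 := Nat.div_le_div_right (c := w) h1.le
  have h4 := Nat.div_le_div_right (c := h) h2.le
  unfold cellNo
  calc q.1 / w * (2 * a / h + 2) + q.2 / h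
      < 2 * a / w * (2 * a / h + 2) + (2 * a / h + 2) := by
        have := Nat.mul_le_mul_right (2 * a / h + 2) h3
        omega
    _ ≤ _ := by
        rw [add_mul]
        exact Nat.add_le_add_left (by omega) _

theorem cells_lt {w h a L : ℕ} (haL : 16 * (a + 2) ^ 2 ≤ 2 ^ L) :
    (2 * a / w + 2) * (2 * a / h + 2) < 2 ^ L := by
  have hw2 : 2 * a / w + 2 ≤ 2 * a + 2 := by have := Nat.div_le_self (2 * a) w; omega
  have hh2 : 2 * a / h + 2 ≤ 2 * a + 2 := by have := Nat.div_le_self (2 * a) h; omega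
  have := Nat.mul_le_mul hw2 hh2
  nlinarith

/-- That all listed points are on the hyperbola is needed for the running time; that no solution in
`[0, a)²` is missing is needed for success. -/
theorem wp_listMod0 (hL : 1 ≤ L) (hσ : Bdd L σ) {N a w h : ℕ} (ha2 : 2 ≤ a)
    (hN : σ.reg .N = N) (ha : σ.reg .a = a) (hw : σ.reg .w = w) (hh : σ.reg .h = h)
    (haL : 16 * (a + 2) ^ 2 ≤ 2 ^ L) :
    wp L listMod0 σ fun n τ =>
      n ≤ 32 * a + 3 * ((2 * a / w + 2) * (2 * a / h + 2)) + 18 ∧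
      ∃ l : List (ℕ × ℕ), l.Nodup ∧ (∀ q ∈ l, IsPoint N a q) ∧
        (∀ q, q.1 < a → q.2 < a → q.1.Coprime a → q.1 * q.2 ≡ N [MOD a] → q ∈ l) ∧
        Grid 0 w h (2 * a / h + 2) ((2 * a / w + 2) * (2 * a / h + 2)) l τ := by
  have hm0 : 0 < a := by omega
  have haL' : 16 * (a + 2) < 2 ^ L := by nlinarith
  have hcL := cells_lt (w := w) (h := h) haL
  unfold listMod0
  refine wp_seq (wp_assign hL hσ (by simp; omega) fun hσ1 => ?_)
  refine wp_seq ((wp_clearCells hL hσ1 0 (a := a) (w := w) (h := h) (by simpa using ha)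
    (by simpa using hw) (by simpa using hh) haL).mono ?_)
  rintro n τ hτ hF ⟨hn, hcols, hhead⟩
  have hm : τ.reg .m = a := by simpa [ha] using hF.reg .m rfl
  refine (wp_forSolutions (N := N) (m := a) (w := w) (h := h) (F := fun x y => [(x, y)]) (K := 6)
    hL hτ (by simp) ha2 (by simpa [hN] using hF.reg .N rfl) hm (by simpa [hw] using hF.reg .w rfl)
    (by simpa [hh] using hF.reg .h rfl) hcols (fun c hc => hhead c hc) rfl rfl rfl rfl ?_).mono ?_
  · intro τ l x y hτ hm hx hy hxm hym hlen hl
    refine (wp_throwPoint hL hτ hl (x := x) (y := y) (fun ρ hρ => ?_) (fun ρ hρ => ?_)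
      (by omega) (by omega) (by omega) ?_ (Nat.le_of_ble_eq_true rfl) (Nat.le_of_ble_eq_true rfl)
      (Nat.le_of_ble_eq_true rfl) (Nat.le_of_ble_eq_true rfl)).mono ?_
    · simpa [hx] using hρ .x (by simp) (by simp)
    · simpa [hy] using hρ .y (by simp) (by simp)
    · exact (cellNo_lt (by simp; omega) (by simp; omega)).trans hcL
    · rintro k ρ _ _ ⟨rfl, h⟩
      exact ⟨le_rfl, h⟩
  · rintro k ρ _ _ ⟨hk, v, hv, hl⟩
    refine ⟨by omega, _, nodup_gather hm0 (by simp) ?_ le_rfl, ?_, ?_, hl.grid⟩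
    · intro x hx y _ q hq
      rw [List.mem_singleton.1 hq, Nat.mod_eq_of_lt hx]
    · intro q hq
      obtain ⟨x, hx, hvx, hq⟩ := mem_gather.1 hq
      rw [List.mem_singleton.1 hq]
      have hc := ((hv x hx).pos_iff ha2).1 hvx
      have := Nat.mod_lt (N % a * v x) hm0
      exact ⟨by simp only; omega, by simp only; omega, hc, (hv x hx).mul_modEq hc⟩
    · rintro ⟨x, y⟩ hx hy hc he
      simp only at hx hy hc he
      refine mem_gather.2 ⟨x, hx, ((hv x hx).pos_iff ha2).2 hc, ?_⟩
      rw [eq_of_mul_modEq hc hy (Nat.mod_lt _ hm0) he ((hv x hx).mul_modEq hc)]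
      simp

theorem wp_listMod1 (hL : 1 ≤ L) (hσ : Bdd L σ) {N a w h m : ℕ} (hm2 : 2 ≤ m)
    (ham : a = m + 1)
    (hN : σ.reg .N = N) (ha : σ.reg .a = a) (hw : σ.reg .w = w) (hh : σ.reg .h = h)
    (haL : 16 * (a + 2) ^ 2 ≤ 2 ^ L) :
    wp L listMod1 σ fun n τ =>
      n ≤ 50 * a + 3 * ((2 * a / w + 2) * (2 * a / h + 2)) + 18 ∧ τ.reg .cols = 2 * a / h + 2 ∧
      ∃ l : List (ℕ × ℕ), l.Nodup ∧ (∀ q, q ∈ l ↔ IsPoint N m q) ∧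
        Grid 1 w h (2 * a / h + 2) ((2 * a / w + 2) * (2 * a / h + 2)) l τ := by
  have hm0 : 0 < m := by omega
  have haL' : 16 * (a + 2) < 2 ^ L := by nlinarith
  have hcL := cells_lt (w := w) (h := h) haL
  unfold listMod1
  refine wp_seq (wp_assign hL hσ (by simp; omega) fun hσ1 => ?_)
  refine wp_seq ((wp_clearCells hL hσ1 1 (a := a) (w := w) (h := h) (by simpa using ha)
    (by simpa using hw) (by simpa using hh) haL).mono ?_)
  rintro n τ hτ hF ⟨hn, hcols, hhead⟩
  have hm : τ.reg .m = m := by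
    have := hF.reg .m rfl
    simp [ha] at this
    omega
  refine (wp_forSolutions (N := N) (m := m) (w := w) (h := h) (F := translates m) (K := 24)
    hL hτ (by simp [translates]) hm2 (by simpa [hN] using hF.reg .N rfl) hm
    (by simpa [hw] using hF.reg .w rfl)
    (by simpa [hh] using hF.reg .h rfl) hcols (fun c hc => hhead c hc) rfl rfl rfl rfl ?_).mono ?_
  · intro τ l x y hτ hm hx hy hxm hym hlen hl
    refine wp_seq ((wp_throwPoint hL hτ hl (x := x) (y := y) (fun ρ hρ => ?_) (fun ρ hρ => ?_)
      (by omega) (by omega) (by omega) ?_ (Nat.le_of_ble_eq_true rfl) (Nat.le_of_ble_eq_true rfl)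
      (Nat.le_of_ble_eq_true rfl) (Nat.le_of_ble_eq_true rfl)).mono ?_)
    · simpa [hx] using hρ .x (by simp) (by simp)
    · simpa [hy] using hρ .y (by simp) (by simp)
    · exact (cellNo_lt (by simp; omega) (by simp; omega)).trans hcL
    rintro k1 τ1 hτ1 hF1 ⟨rfl, hl1⟩
    have hx1 := (hF1.reg .x rfl).trans hx
    have hy1 := (hF1.reg .y rfl).trans hy
    have hm1 := (hF1.reg .m rfl).trans hm
    refine wp_seq ((wp_throwPoint hL hτ1 hl1 (x := x + m) (y := y) (fun ρ hρ => ?_)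
      (fun ρ hρ => ?_) (by omega) (by omega) (by simp; omega) ?_ (Nat.le_of_ble_eq_true rfl)
      (Nat.le_of_ble_eq_true rfl) (Nat.le_of_ble_eq_true rfl)
      (Nat.le_of_ble_eq_true rfl)).mono ?_)
    · simp [hρ .x (by simp) (by simp), hρ .m (by simp) (by simp), hx1, hm1]
    · simp [hρ .y (by simp) (by simp), hy1]
    · exact (cellNo_lt (by simp; omega) (by simp; omega)).trans hcL
    rintro k2 τ2 hτ2 hF2 ⟨rfl, hl2⟩
    have hx2 := (hF2.reg .x rfl).trans hx1
    have hy2 := (hF2.reg .y rfl).trans hy1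
    have hm2 := (hF2.reg .m rfl).trans hm1
    refine wp_seq ((wp_throwPoint hL hτ2 hl2 (x := x) (y := y + m) (fun ρ hρ => ?_)
      (fun ρ hρ => ?_) (by omega) (by omega) (by simp; omega) ?_ (Nat.le_of_ble_eq_true rfl)
      (Nat.le_of_ble_eq_true rfl) (Nat.le_of_ble_eq_true rfl)
      (Nat.le_of_ble_eq_true rfl)).mono ?_)
    · simp [hρ .x (by simp) (by simp), hx2]
    · simp [hρ .y (by simp) (by simp), hρ .m (by simp) (by simp), hy2, hm2]
    · exact (cellNo_lt (by simp; omega) (by simp; omega)).trans hcL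
    rintro k3 τ3 hτ3 hF3 ⟨rfl, hl3⟩
    have hx3 := (hF3.reg .x rfl).trans hx2
    have hy3 := (hF3.reg .y rfl).trans hy2
    have hm3 := (hF3.reg .m rfl).trans hm2
    refine (wp_throwPoint hL hτ3 hl3 (x := x + m) (y := y + m) (fun ρ hρ => ?_)
      (fun ρ hρ => ?_) (by omega) (by omega) (by simp; omega) ?_ (Nat.le_of_ble_eq_true rfl)
      (Nat.le_of_ble_eq_true rfl) (Nat.le_of_ble_eq_true rfl)
      (Nat.le_of_ble_eq_true rfl)).mono ?_
    · simp [hρ .x (by simp) (by simp), hρ .m (by simp) (by simp), hx3, hm3]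
    · simp [hρ .y (by simp) (by simp), hρ .m (by simp) (by simp), hy3, hm3]
    · exact (cellNo_lt (by simp; omega) (by simp; omega)).trans hcL
    rintro k4 τ4 _ _ ⟨rfl, hl4⟩
    exact ⟨by omega, hl4⟩
  · rintro k ρ _ hFρ ⟨hk, v, hv, hl⟩
    refine ⟨by omega, (hFρ.reg .cols rfl).trans hcols, _,
      nodup_gather hm0 ?_ ?_ le_rfl, fun q => ⟨fun hq => ?_, fun hq => ?_⟩, hl.grid⟩
    · intro x hx y hy
      simp [translates]
      omega
    · intro x hx y _ q hq
      simp only [translates, List.mem_cons, List.not_mem_nil, or_false] at hq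
      rcases hq with rfl | rfl | rfl | rfl <;> simp [Nat.mod_eq_of_lt hx]
    · obtain ⟨x, hx, hvx, hq⟩ := mem_gather.1 hq
      have hc := ((hv x hx).pos_iff hm2).1 hvx
      have hy := Nat.mod_lt (N % m * v x) hm0
      have he := (hv x hx).mul_modEq (N := N) hc
      generalize N % m * v x % m = y at hq hy he
      have e1 : x + m ≡ x [MOD m] := by simp
      have e2 : y + m ≡ y [MOD m] := by simp
      simp only [translates, List.mem_cons, List.not_mem_nil, or_false] at hq
      rcases hq with rfl | rfl | rfl | rfl
      · exact ⟨by simp only; omega, by simp only; omega, by simpa using hc,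
          (e1.mul e2).trans he⟩
      · exact ⟨by simp only; omega, by simp only; omega, hc, (e2.mul_left x).trans he⟩
      · exact ⟨by simp only; omega, by simp only; omega, by simpa using hc,
          (e1.mul_right y).trans he⟩
      · exact ⟨by simp only; omega, by simp only; omega, hc, he⟩
    · obtain ⟨x, y⟩ := q
      obtain ⟨h1, h2, hc, he⟩ := hq
      simp only at h1 h2 hc he
      have hxm : x % m < m := Nat.mod_lt _ hm0
      have hc' := coprime_mod.2 hc
      refine mem_gather.2 ⟨x % m, hxm, ((hv _ hxm).pos_iff hm2).2 hc', ?_⟩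
      rw [← eq_of_mul_modEq hc' (Nat.mod_lt y hm0) (Nat.mod_lt _ hm0)
        (((Nat.mod_modEq x m).mul (Nat.mod_modEq y m)).trans he) ((hv _ hxm).mul_modEq hc')]
      have hdm : ∀ z < 2 * m, z = z % m ∨ z = z % m + m := fun z hz => by
        rcases lt_or_ge z m with h | h
        · exact Or.inl (Nat.mod_eq_of_lt h).symm
        · rw [Nat.mod_eq_sub_mod h, Nat.mod_eq_of_lt (by omega)]
          omega
      simp only [translates, List.mem_cons, List.not_mem_nil, or_false, Prod.mk.injEq]
      have := hdm x h1
      have := hdm y h2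
      tauto

end

/-! ### Comparing two cells -/

/-! ### The scan -/

/-- The output is a nontrivial factorization of `N`. -/
def Valid (N : ℕ) (σ : State) : Prop :=
  1 < σ.reg .outU ∧ 1 < σ.reg .outV ∧ σ.reg .outU * σ.reg .outV = N

/-- Between `σ` and `τ` only factorizations of `N` have been output, and one has been if `H`. -/
structure Sound (N : ℕ) (H : Prop) (σ τ : State) : Prop where
  good : (σ.reg .outU = 0 ∨ Valid N σ) → (τ.reg .outU = 0 ∨ Valid N τ)
  keep : Valid N σ → Valid N τ
  found : H → Valid N τ

theorem Sound.of_eq {N : ℕ} {σ τ : State} (hU : τ.reg .outU = σ.reg .outU)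
    (hV : τ.reg .outV = σ.reg .outV) : Sound N False σ τ := by
  have : Valid N τ ↔ Valid N σ := by simp [Valid, hU, hV]
  exact ⟨by rw [this, hU]; exact id, this.2, False.elim⟩

theorem Sound.trans {N : ℕ} {H H' H'' : Prop} {σ τ ρ : State} (h : Sound N H σ τ)
    (h' : Sound N H' τ ρ) (hH : H'' → H ∨ H') : Sound N H'' σ ρ :=
  ⟨fun g => h'.good (h.good g), fun g => h'.keep (h.keep g), fun g =>
    (hH g).elim (fun k => h'.keep (h.found k)) h'.found⟩

/-- The points `q₀` modulo `a` and `q₁` modulo `a - 1` give a factorization of `N`. -/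
def Hit (N a : ℕ) (q₀ q₁ : ℕ × ℕ) : Prop :=
  ((q₁.1 - q₀.1) * a + q₀.1) * ((q₁.2 - q₀.2) * a + q₀.2) = N ∧
    1 < (q₁.1 - q₀.1) * a + q₀.1 ∧ 1 < (q₁.2 - q₀.2) * a + q₀.2

/-- The state during the scan. -/
structure Tables (N a w h cols R : ℕ) (l₀ l₁ : List (ℕ × ℕ)) (σ : State) : Prop where
  N_eq : σ.reg .N = N
  a_eq : σ.reg .a = a
  w_eq : σ.reg .w = w
  h_eq : σ.reg .h = h
  cols_eq : σ.reg .cols = cols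
  grid₀ : Grid 0 w h cols R l₀ σ
  grid₁ : Grid 1 w h cols R l₁ σ

theorem Tables.of_frame {N a w h cols R : ℕ} {l₀ l₁ : List (ℕ × ℕ)} {C : Cmd} {σ τ : State}
    (hT : Tables N a w h cols R l₀ l₁ σ) (hF : Frame C σ τ)
    (hr : ∀ z ∈ [Reg.N, .a, .w, .h, .cols], C.writes z = false)
    (hs : ∀ δ, ∀ A ∈ [Arr.px δ, .py δ, .next δ, .head δ], C.stores A = false) :
    Tables N a w h cols R l₀ l₁ τ := by
  refine ⟨?_, ?_, ?_, ?_, ?_, ?_, ?_⟩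
  · rw [hF.reg _ (hr _ (by simp)), hT.N_eq]
  · rw [hF.reg _ (hr _ (by simp)), hT.a_eq]
  · rw [hF.reg _ (hr _ (by simp)), hT.w_eq]
  · rw [hF.reg _ (hr _ (by simp)), hT.h_eq]
  · rw [hF.reg _ (hr _ (by simp)), hT.cols_eq]
  · have := hT.grid₀
    unfold Grid at this ⊢
    rwa [hF.mem _ (hs 0 _ (by simp)), hF.mem _ (hs 0 _ (by simp)), hF.mem _ (hs 0 _ (by simp)),
      hF.mem _ (hs 0 _ (by simp))]
  · have := hT.grid₁
    unfold Grid at this ⊢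
    rwa [hF.mem _ (hs 1 _ (by simp)), hF.mem _ (hs 1 _ (by simp)), hF.mem _ (hs 1 _ (by simp)),
      hF.mem _ (hs 1 _ (by simp))]

section

variable {L : ℕ} {σ : State}

theorem wp_comparePair (hL : 1 ≤ L) (hσ : Bdd L σ) {N a : ℕ} {q₀ q₁ : ℕ × ℕ}
    (haL : 16 * (a + 2) ^ 2 ≤ 2 ^ L) (hN : σ.reg .N = N) (ha : σ.reg .a = a)
    (hx₀ : σ.mem (.px 0) (σ.reg .s) = q₀.1) (hy₀ : σ.mem (.py 0) (σ.reg .s) = q₀.2)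
    (hx₁ : σ.mem (.px 1) (σ.reg .t) = q₁.1) (hy₁ : σ.mem (.py 1) (σ.reg .t) = q₁.2)
    (h₀ : q₀.1 < 2 * a ∧ q₀.2 < 2 * a) (h₁ : q₁.1 < 2 * a ∧ q₁.2 < 2 * a) :
    wp L comparePair σ fun n τ => n ≤ 5 ∧ Sound N (Hit N a q₀ q₁) σ τ := by
  have hb : ∀ x y : ℕ, x < 2 * a → y < 2 * a → (y - x) * a + x < 2 ^ L := by
    intro x y hx hy
    have : (y - x) * a ≤ 2 * a * a := Nat.mul_le_mul_right a (by omega)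
    nlinarith
  unfold comparePair
  refine wp_seq (wp_assign hL hσ ?_ fun hσ1 => ?_)
  · simp only [Expr.eval_add, Expr.eval_mul, Expr.eval_sub, Expr.eval_cell, Expr.eval_reg, hx₀,
      hx₁, ha]
    exact hb _ _ h₀.1 h₁.1
  refine wp_seq (wp_assign hL hσ1 ?_ fun hσ2 => ?_)
  · simp only [Expr.eval_add, Expr.eval_mul, Expr.eval_sub, Expr.eval_cell, Expr.eval_reg,
      State.setReg_reg, State.setReg_mem, reduceCtorEq, if_false, hy₀, hy₁, ha]
    exact hb _ _ h₀.2 h₁.2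
  simp only [Expr.eval_add, Expr.eval_mul, Expr.eval_sub, Expr.eval_cell, Expr.eval_reg,
    State.setReg_reg, State.setReg_mem, reduceCtorEq, if_false, hx₀, hy₀, hx₁, hy₁, ha] at hσ2 ⊢
  refine wp_branch hL hσ2 (fun hP => ?_) (fun hP => ?_)
  · simp only [Test.holds_and, Test.holds_eq, Test.holds_lt, Expr.eval_mul, Expr.eval_reg,
      Expr.eval_ofNat, State.setReg_reg, reduceCtorEq, if_false, if_true, hN] at hP
    refine wp_seq (wp_assign hL hσ2 (hσ2.reg .u) fun hσ3 => ?_)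
    refine wp_assign hL hσ3 (hσ3.reg .v) fun hσ4 => ⟨by norm_num, ?_⟩
    suffices h : Valid N _ from ⟨fun _ => Or.inr h, fun _ => h, fun _ => h⟩
    simp only [Valid, Expr.eval_reg, State.setReg_reg, reduceCtorEq, if_false, if_true]
    exact ⟨hP.2.1, hP.2.2, hP.1⟩
  · simp only [Test.holds_and, Test.holds_eq, Test.holds_lt, Expr.eval_mul, Expr.eval_reg,
      Expr.eval_ofNat, State.setReg_reg, reduceCtorEq, if_false, if_true, hN] at hP
    refine wp_skip hL hσ2 ⟨by norm_num, ?_⟩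
    have := Sound.of_eq (N := N) (σ := σ) (τ := (σ.setReg .u ((q₁.1 - q₀.1) * a + q₀.1)).setReg .v
      ((q₁.2 - q₀.2) * a + q₀.2)) (by simp) (by simp)
    exact ⟨this.good, this.keep, fun hH => absurd hH hP⟩

/-- Comparing the point `s` with the points of a cell. -/
def compareLoop : Cmd := .loop (0 ≺ §Reg.t) (comparePair ;; Reg.t ⟵ .cell (.next 1) §Reg.t)

/-- The invariant keeps the list `l'` of points still to come and a proposition `H` that collects
the hits so far. As `l'` is not a function of the state, termination comes from the time bound:
seven units per point. -/
theorem wp_compareLoop (hL : 1 ≤ L) (hσ : Bdd L σ) {N a k : ℕ} {q₀ : ℕ × ℕ} {l : List (ℕ × ℕ)}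
    (haL : 16 * (a + 2) ^ 2 ≤ 2 ^ L) (hN : σ.reg .N = N) (ha : σ.reg .a = a)
    (hx₀ : σ.mem (.px 0) (σ.reg .s) = q₀.1) (hy₀ : σ.mem (.py 0) (σ.reg .s) = q₀.2)
    (hch : Chain (σ.mem (.px 1)) (σ.mem (.py 1)) (σ.mem (.next 1)) k (σ.reg .t) l)
    (h₀ : q₀.1 < 2 * a ∧ q₀.2 < 2 * a) (h₁ : ∀ q ∈ l, q.1 < 2 * a ∧ q.2 < 2 * a) :
    wp L compareLoop σ fun n τ => n ≤ 7 * l.length + 1 ∧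
      Sound N (∃ q ∈ l, Hit N a q₀ q) σ τ := by
  refine wp_loop_of_bounded (fun n τ => ∃ l' H, n + 7 * l'.length ≤ 7 * l.length ∧
    Chain (σ.mem (.px 1)) (σ.mem (.py 1)) (σ.mem (.next 1)) k (τ.reg .t) l' ∧ (∀ q ∈ l', q ∈ l) ∧
    Sound N H σ τ ∧ ∀ q ∈ l, q ∈ l' ∨ (Hit N a q₀ q → H)) (7 * l.length) hL hσ ?_ ?_ ?_ ?_
  · exact ⟨l, False, by omega, hch, fun q => id, .of_eq rfl rfl, fun q hq => Or.inl hq⟩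
  · rintro n τ ⟨l', H, h, -⟩
    omega
  · rintro n τ hτ hF ⟨l', H, h1, h2, h3, h4, h5⟩ hP
    simp only [Test.holds_lt, Expr.eval_ofNat, Expr.eval_reg] at hP
    cases l' with
    | nil =>
      have : τ.reg .t = 0 := h2
      omega
    | cons q l' =>
      obtain ⟨-, -, c1, c2, c3⟩ := h2
      have m1 := hF.mem (.px 0) rfl
      have m2 := hF.mem (.py 0) rfl
      have m3 := hF.mem (.px 1) rfl
      have m4 := hF.mem (.py 1) rfl
      have m5 := hF.mem (.next 1) rfl
      have r1 := hF.reg .s rfl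
      refine wp_seq ((wp_comparePair hL hτ (q₀ := q₀) (q₁ := q) haL ((hF.reg .N rfl).trans hN)
        ((hF.reg .a rfl).trans ha) (by rw [m1, r1, hx₀]) (by rw [m2, r1, hy₀]) (by rw [m3, c1])
        (by rw [m4, c2]) h₀ (h₁ q (h3 q (by simp)))).mono ?_)
      rintro n' ρ hρ hFρ ⟨hn', hS⟩
      refine wp_assign hL hρ (hρ.mem _ _) fun hρ1 => ?_
      simp only [Expr.eval_cell, Expr.eval_reg, State.setReg_reg, if_true]
      rw [hFρ.mem (.next 1) rfl, m5, hFρ.reg .t rfl]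
      refine ⟨l', H ∨ Hit N a q₀ q, ?_, c3, fun q' hq' => h3 q' (by simp [hq']), ?_, fun q' hq' => ?_⟩
      · rw [List.length_cons] at h1
        omega
      · exact (h4.trans hS id).trans (.of_eq (by simp) (by simp)) Or.inl
      · rcases h5 q' hq' with h | h
        · rcases List.mem_cons.1 h with rfl | h
          · exact Or.inr Or.inr
          · exact Or.inl h
        · exact Or.inr fun g => Or.inl (h g)
  · rintro n τ hτ hF ⟨l', H, h1, h2, h3, h4, h5⟩ hP
    have ht : τ.reg .t = 0 := by simpa using hP
    cases l' with
    | nil =>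
      refine ⟨by omega, h4.good, h4.keep, ?_⟩
      rintro ⟨q, hq, hH⟩
      exact h4.found ((h5 q hq).elim (by simp) fun g => g hH)
    | cons q l' =>
      have := h2.1
      omega

/-- The points of `l` in the cell with number `c`. -/
def inCell (w h cols : ℕ) (l : List (ℕ × ℕ)) (c : ℕ) : List (ℕ × ℕ) :=
  l.filter fun q => cellNo w h cols q = c

/-- The same scheme as in `wp_compareLoop`, one level higher: a point of the first cell takes the
time of the inner loop and three further units. -/
theorem wp_compareCells (hL : 1 ≤ L) (hσ : Bdd L σ) {N a w h cols R : ℕ}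
    {l₀ l₁ : List (ℕ × ℕ)} (haL : 16 * (a + 2) ^ 2 ≤ 2 ^ L)
    (hT : Tables N a w h cols R l₀ l₁ σ)
    (h₀ : ∀ q ∈ l₀, q.1 < 2 * a ∧ q.2 < 2 * a) (h₁ : ∀ q ∈ l₁, q.1 < 2 * a ∧ q.2 < 2 * a)
    {i j i' j' : ℕ} (hi : σ.reg .i = i) (hj : σ.reg .j = j) (hi' : σ.reg .i' = i')
    (hj' : σ.reg .j' = j') (hc₀ : i * cols + j < R) (hc₁ : i' * cols + j' < R) :
    wp L compareCells σ fun n τ =>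
      n ≤ (inCell w h cols l₀ (i * cols + j)).length *
        (7 * (inCell w h cols l₁ (i' * cols + j')).length + 4) + 2 ∧
      Sound N (∃ q₀ ∈ inCell w h cols l₀ (i * cols + j),
        ∃ q₁ ∈ inCell w h cols l₁ (i' * cols + j'), Hit N a q₀ q₁) σ τ := by
  have g₀ := hT.grid₀ _ hc₀
  have g₁ := hT.grid₁ _ hc₁
  change Chain _ _ _ _ _ (inCell w h cols l₀ (i * cols + j)) at g₀
  change Chain _ _ _ _ _ (inCell w h cols l₁ (i' * cols + j')) at g₁
  have h₀' : ∀ q ∈ inCell w h cols l₀ (i * cols + j), q.1 < 2 * a ∧ q.2 < 2 * a :=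
    fun q hq => h₀ q (List.mem_of_mem_filter hq)
  have h₁' : ∀ q ∈ inCell w h cols l₁ (i' * cols + j'), q.1 < 2 * a ∧ q.2 < 2 * a :=
    fun q hq => h₁ q (List.mem_of_mem_filter hq)
  generalize inCell w h cols l₀ (i * cols + j) = L₀ at *
  generalize inCell w h cols l₁ (i' * cols + j') = L₁ at *
  unfold compareCells
  refine wp_seq (wp_assign hL hσ (hσ.mem _ _) fun hσ1 => ?_)
  have e : Expr.eval σ (.cell (.head 0) (§Reg.i * §Reg.cols + §Reg.j)) =
      σ.mem (.head 0) (i * cols + j) := by simp [hi, hj, hT.cols_eq]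
  rw [e] at hσ1 ⊢
  refine wp_loop_of_bounded (fun n τ => ∃ l' H,
    n + l'.length * (7 * L₁.length + 4) ≤ L₀.length * (7 * L₁.length + 4) ∧
    Chain (σ.mem (.px 0)) (σ.mem (.py 0)) (σ.mem (.next 0)) l₀.length (τ.reg .s) l' ∧
    (∀ q ∈ l', q ∈ L₀) ∧ Sound N H σ τ ∧
    ∀ q₀ ∈ L₀, q₀ ∈ l' ∨ ((∃ q₁ ∈ L₁, Hit N a q₀ q₁) → H))
    (L₀.length * (7 * L₁.length + 4)) hL hσ1 ?_ ?_ ?_ ?_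
  · exact ⟨L₀, False, by omega, by simpa using g₀, fun q => id, .of_eq (by simp) (by simp),
      fun q hq => Or.inl hq⟩
  · rintro n τ ⟨l', H, h, -⟩
    omega
  · rintro n τ hτ hF ⟨l', H, h1, h2, h3, h4, h5⟩ hP
    simp only [Test.holds_lt, Expr.eval_ofNat, Expr.eval_reg] at hP
    cases l' with
    | nil =>
      have : τ.reg .s = 0 := h2
      omega
    | cons q l' =>
      obtain ⟨-, -, c1, c2, c3⟩ := h2
      have m1 := hF.mem (.px 0) rfl
      have m2 := hF.mem (.py 0) rfl
      have m3 := hF.mem (.px 1) rfl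
      have m4 := hF.mem (.py 1) rfl
      have m5 := hF.mem (.next 1) rfl
      have m6 := hF.mem (.next 0) rfl
      have m7 := hF.mem (.head 1) rfl
      have r1 := hF.reg .i' rfl
      have r2 := hF.reg .j' rfl
      have r3 := hF.reg .cols rfl
      have r4 := hF.reg .N rfl
      have r5 := hF.reg .a rfl
      simp only [State.setReg_reg, State.setReg_mem, reduceCtorEq, if_false, hi', hj',
        hT.cols_eq, hT.N_eq, hT.a_eq] at m1 m2 m3 m4 m5 m6 m7 r1 r2 r3 r4 r5
      refine wp_seq (wp_assign hL hτ (hτ.mem _ _) fun hτ1 => ?_)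
      have e1 : Expr.eval τ (.cell (.head 1) (§Reg.i' * §Reg.cols + §Reg.j')) =
          σ.mem (.head 1) (i' * cols + j') := by simp [r1, r2, r3, m7]
      rw [e1] at hτ1 ⊢
      refine wp_seq ((wp_compareLoop hL hτ1 (q₀ := q) (l := L₁) (k := l₁.length) haL
        (by simpa using r4) (by simpa using r5) (by simp [m1, c1]) (by simp [m2, c2])
        (by simpa [m3, m4, m5] using g₁) (h₀' q (h3 q (by simp))) h₁').mono ?_)
      rintro n' ρ hρ hFρ ⟨hn', hS⟩
      refine wp_assign hL hρ (hρ.mem _ _) fun hρ1 => ?_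
      have e2 : Expr.eval ρ (.cell (.next 0) §Reg.s) = σ.mem (.next 0) (τ.reg .s) := by
        rw [Expr.eval_cell, Expr.eval_reg, hFρ.mem (.next 0) rfl, hFρ.reg .s rfl]
        simp [m6]
      rw [e2]
      refine ⟨l', H ∨ ∃ q₁ ∈ L₁, Hit N a q q₁, ?_, by simpa using c3,
        fun q' hq' => h3 q' (by simp [hq']), ?_, fun q' hq' => ?_⟩
      · rw [List.length_cons] at h1
        nlinarith
      · exact ((h4.trans (.of_eq (by simp) (by simp)) Or.inl).trans hS id).trans
          (.of_eq (by simp) (by simp)) Or.inl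
      · rcases h5 q' hq' with h | h
        · rcases List.mem_cons.1 h with rfl | h
          · exact Or.inr Or.inr
          · exact Or.inl h
        · exact Or.inr fun g => Or.inl (h g)
  · rintro n τ hτ hF ⟨l', H, h1, h2, h3, h4, h5⟩ hP
    have ht : τ.reg .s = 0 := by simpa using hP
    cases l' with
    | nil =>
      refine ⟨by omega, h4.good, h4.keep, ?_⟩
      rintro ⟨q, hq, hH⟩
      exact h4.found ((h5 q hq).elim (by simp) fun g => g hH)
    | cons q l' =>
      have := h2.1
      omega

/-- A loop that increases the register `z` from `lo` to `hi`. -/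
theorem wp_searchLoop (hL : 1 ≤ L) (hσ : Bdd L σ) {N lo hi : ℕ} {z : Reg} {P : Test} {C : Cmd}
    (cost : ℕ → ℕ) (H : ℕ → Prop) (hlo : σ.reg z = lo) (hle : lo ≤ hi)
    (hP : ∀ τ, Frame (.loop P C) σ τ → (P.Holds τ ↔ τ.reg z < hi))
    (hC : ∀ v τ, Bdd L τ → Frame (.loop P C) σ τ → τ.reg z = v → lo ≤ v → v < hi →
      wp L C τ fun n ρ => n ≤ cost v ∧ ρ.reg z = v + 1 ∧ Sound N (H v) τ ρ)
    (hw : P.wt ≤ 999 := by exact Nat.le_of_ble_eq_true rfl) :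
    wp L (.loop P C) σ fun n τ => n ≤ ∑ v ∈ Finset.Ico lo hi, (cost v + 1) + 1 ∧
      Sound N (∃ v, lo ≤ v ∧ v < hi ∧ H v) σ τ := by
  refine wp_loop (fun n τ => lo ≤ τ.reg z ∧ τ.reg z ≤ hi ∧
    n ≤ ∑ v ∈ Finset.Ico lo (τ.reg z), (cost v + 1) ∧
    Sound N (∃ v, lo ≤ v ∧ v < τ.reg z ∧ H v) σ τ) (fun τ => hi - τ.reg z) hL hσ ?_ ?_ ?_ hw
  · refine ⟨hlo.ge, by omega, by simp, ?_⟩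
    have := Sound.of_eq (N := N) (σ := σ) (τ := σ) rfl rfl
    refine ⟨this.good, this.keep, ?_⟩
    rintro ⟨v, h1, h2, -⟩
    omega
  · rintro n τ hτ hF ⟨h1, h2, h3, h4⟩ hPτ
    have hlt := (hP τ hF).1 hPτ
    refine (hC _ τ hτ hF rfl h1 hlt).mono ?_
    rintro k ρ hρ - ⟨hk, hz, hS⟩
    rw [hz]
    refine ⟨⟨by omega, hlt, ?_, h4.trans hS ?_⟩, by omega⟩
    · rw [Finset.sum_Ico_succ_top h1]
      omega
    · rintro ⟨v, g1, g2, g3⟩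
      rcases Nat.lt_succ_iff_lt_or_eq.1 g2 with g | rfl
      · exact Or.inl ⟨v, g1, g, g3⟩
      · exact Or.inr g3
  · rintro n τ hτ hF ⟨h1, h2, h3, h4⟩ hPτ
    rw [hP τ hF, not_lt] at hPτ
    have : τ.reg z = hi := by omega
    rw [this] at h3 h4
    exact ⟨by omega, h4⟩

end

/-! ### Running over all cells -/

/-- Comparing the points of the cell `(i, j)` with those of its neighbours in the row `i'`. -/
def scanNeighbours : Cmd :=
  .loop (§Reg.j' ≺ §Reg.j + 2) (compareCells ;; Reg.j' ⟵ §Reg.j' + 1)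

/-- Comparing the points of the cell `(i, j)` with those of all its neighbours. -/
def scanCell : Cmd :=
  .loop (§Reg.i' ≺ §Reg.i + 2) (Reg.j' ⟵ §Reg.j - 1 ;; scanNeighbours ;; Reg.i' ⟵ §Reg.i' + 1)

/-- Scanning the row `i`. -/
def scanRow : Cmd :=
  .loop (§Reg.j * §Reg.h ≺ §Reg.a) (Reg.i' ⟵ §Reg.i - 1 ;; scanCell ;; Reg.j ⟵ §Reg.j + 1)

/-- The time for comparing the points of two cells. -/
def pairCost (cols : ℕ) (A B : ℕ → ℕ) (i j i' j' : ℕ) : ℕ :=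
  A (i * cols + j) * (7 * B (i' * cols + j') + 4) + 4

/-- The time for comparing the points of a cell with those of its neighbours. -/
def cellCost (cols : ℕ) (A B : ℕ → ℕ) (i j : ℕ) : ℕ :=
  ∑ i' ∈ Finset.Ico (i - 1) (i + 2),
    (∑ j' ∈ Finset.Ico (j - 1) (j + 2), pairCost cols A B i j i' j' + 4) + 4

/-- The time of the scan, in terms of the numbers `A c`, `B c` of points in the cells. -/
def scanCost (I J cols : ℕ) (A B : ℕ → ℕ) : ℕ :=
  ∑ i ∈ Finset.Ico 0 I, (∑ j ∈ Finset.Ico 0 J, cellCost cols A B i j + 4) + 2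

/-- Turns the machine's test into a bound on the loop counter, the form required by `wp_searchLoop`.
-/
theorem mul_lt_iff_lt {i w a : ℕ} (hw : 0 < w) (ha : 0 < a) : i * w < a ↔ i < (a - 1) / w + 1 := by
  rw [Nat.lt_succ_iff, Nat.le_div_iff_mul_le hw]
  omega

theorem Tables.setReg {N a w h cols R : ℕ} {l₀ l₁ : List (ℕ × ℕ)} {σ : State}
    (hT : Tables N a w h cols R l₀ l₁ σ) {z : Reg} (hz : z ∉ [Reg.N, .a, .w, .h, .cols]) (n : ℕ) :
    Tables N a w h cols R l₀ l₁ (σ.setReg z n) := by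
  simp only [List.mem_cons, List.not_mem_nil, or_false, not_or] at hz
  refine ⟨?_, ?_, ?_, ?_, ?_, hT.grid₀, hT.grid₁⟩
  · rw [State.setReg_reg, if_neg (Ne.symm hz.1), hT.N_eq]
  · rw [State.setReg_reg, if_neg (Ne.symm hz.2.1), hT.a_eq]
  · rw [State.setReg_reg, if_neg (Ne.symm hz.2.2.1), hT.w_eq]
  · rw [State.setReg_reg, if_neg (Ne.symm hz.2.2.2.1), hT.h_eq]
  · rw [State.setReg_reg, if_neg (Ne.symm hz.2.2.2.2), hT.cols_eq]

section

variable {L : ℕ} {σ : State} {N a w h cols R : ℕ} {l₀ l₁ : List (ℕ × ℕ)}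

theorem wp_scanNeighbours (hL : 1 ≤ L) (hσ : Bdd L σ)
    (haL : 16 * (a + 2) ^ 2 ≤ 2 ^ L) (hT : Tables N a w h cols R l₀ l₁ σ)
    (h₀ : ∀ q ∈ l₀, q.1 < 2 * a ∧ q.2 < 2 * a) (h₁ : ∀ q ∈ l₁, q.1 < 2 * a ∧ q.2 < 2 * a)
    {i j i' : ℕ} (hi : σ.reg .i = i) (hj : σ.reg .j = j) (hi' : σ.reg .i' = i')
    (hj' : σ.reg .j' = j - 1) (hjL : j + 2 < 2 ^ L)
    (hc₀ : i * cols + j < R) (hc₁ : ∀ j' < j + 2, i' * cols + j' < R) :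
    wp L scanNeighbours σ fun n τ =>
      n ≤ ∑ j' ∈ Finset.Ico (j - 1) (j + 2), pairCost cols (fun c => (inCell w h cols l₀ c).length)
        (fun c => (inCell w h cols l₁ c).length) i j i' j' + 1 ∧
      Sound N (∃ j', j - 1 ≤ j' ∧ j' < j + 2 ∧ ∃ q₀ ∈ inCell w h cols l₀ (i * cols + j),
          ∃ q₁ ∈ inCell w h cols l₁ (i' * cols + j'), Hit N a q₀ q₁) σ τ := by
  refine wp_searchLoop (N := N) (lo := j - 1) (hi := j + 2) hL hσ (z := .j')
    (fun j' => (inCell w h cols l₀ (i * cols + j)).length *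
      (7 * (inCell w h cols l₁ (i' * cols + j')).length + 4) + 3)
    (fun j' => ∃ q₀ ∈ inCell w h cols l₀ (i * cols + j),
          ∃ q₁ ∈ inCell w h cols l₁ (i' * cols + j'), Hit N a q₀ q₁) hj' (by omega) ?_ ?_
  · intro τ hF
    have : τ.reg .j = j := (hF.reg .j rfl).trans hj
    simp [this]
  · intro j' τ hτ hF hj' _ hj'lt
    have hTτ := hT.of_frame hF (by decide) (by decide)
    refine wp_seq ((wp_compareCells hL hτ haL hTτ h₀ h₁ ((hF.reg .i rfl).trans hi)
      ((hF.reg .j rfl).trans hj) ((hF.reg .i' rfl).trans hi') hj' hc₀ (hc₁ j' hj'lt)).mono ?_)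
    rintro n ρ hρ hF ⟨hn, hS⟩
    have hj' : ρ.reg .j' = j' := (hF.reg .j' rfl).trans hj'
    exact wp_assign hL hρ (by simp [hj']; omega) fun hρ1 =>
      ⟨by omega, by simp [hj'], hS.trans (.of_eq (by simp) (by simp)) Or.inl⟩

/-- The three spare units pay for the two assignments and the test of the surrounding row loop. -/
theorem wp_scanCell (hL : 1 ≤ L) (hσ : Bdd L σ)
    (haL : 16 * (a + 2) ^ 2 ≤ 2 ^ L) (hT : Tables N a w h cols R l₀ l₁ σ)
    (h₀ : ∀ q ∈ l₀, q.1 < 2 * a ∧ q.2 < 2 * a) (h₁ : ∀ q ∈ l₁, q.1 < 2 * a ∧ q.2 < 2 * a)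
    {i j : ℕ} (hi : σ.reg .i = i) (hj : σ.reg .j = j) (hi' : σ.reg .i' = i - 1)
    (hiL : i + 2 < 2 ^ L) (hjL : j + 2 < 2 ^ L)
    (hc : ∀ i' < i + 2, ∀ j' < j + 2, i' * cols + j' < R) :
    wp L scanCell σ fun n τ =>
      n + 3 ≤ cellCost cols (fun c => (inCell w h cols l₀ c).length)
        (fun c => (inCell w h cols l₁ c).length) i j ∧
      Sound N (∃ i', i - 1 ≤ i' ∧ i' < i + 2 ∧ ∃ j', j - 1 ≤ j' ∧ j' < j + 2 ∧
        ∃ q₀ ∈ inCell w h cols l₀ (i * cols + j),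
          ∃ q₁ ∈ inCell w h cols l₁ (i' * cols + j'), Hit N a q₀ q₁) σ τ := by
  refine (wp_searchLoop (N := N) (lo := i - 1) (hi := i + 2) hL hσ (z := .i')
    (fun i' => ∑ j' ∈ Finset.Ico (j - 1) (j + 2),
      pairCost cols (fun c => (inCell w h cols l₀ c).length)
        (fun c => (inCell w h cols l₁ c).length) i j i' j' + 3)
    (fun i' => ∃ j', j - 1 ≤ j' ∧ j' < j + 2 ∧ ∃ q₀ ∈ inCell w h cols l₀ (i * cols + j),
          ∃ q₁ ∈ inCell w h cols l₁ (i' * cols + j'), Hit N a q₀ q₁) hi' (by omega) ?_ ?_).mono ?_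
  · intro τ hF
    have : τ.reg .i = i := (hF.reg .i rfl).trans hi
    simp [this]
  · intro i' τ hτ hF hi' _ hi'lt
    have hi2 : τ.reg .i = i := (hF.reg .i rfl).trans hi
    have hj2 : τ.reg .j = j := (hF.reg .j rfl).trans hj
    refine wp_seq (wp_assign hL hτ (by simp [hj2]; omega) fun hτ1 => ?_)
    refine wp_seq ((wp_scanNeighbours hL hτ1 haL
      ((hT.of_frame hF (by decide) (by decide)).setReg (by decide) _) h₀ h₁
      (i := i) (j := j) (i' := i') (by simpa using hi2) (by simpa using hj2) (by simpa using hi')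
      (by simp [hj2]) hjL (hc i (by omega) j (by omega)) (hc i' hi'lt)).mono ?_)
    rintro n ρ hρ hF ⟨hn, hS⟩
    have hi' : ρ.reg .i' = i' := (hF.reg .i' rfl).trans (by simpa using hi')
    exact wp_assign hL hρ (by simp [hi']; omega) fun hρ1 =>
      ⟨by omega, by simp [hi'], ((Sound.of_eq (by simp) (by simp)).trans hS Or.inr).trans
          (.of_eq (by simp) (by simp)) Or.inl⟩
  · rintro n τ _ _ ⟨hn, hS⟩
    refine ⟨?_, hS⟩
    simp only [add_assoc, Nat.reduceAdd] at hn
    unfold cellCost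
    omega

theorem wp_scanRow (hL : 1 ≤ L) (hσ : Bdd L σ) (ha0 : 0 < a) (hh0 : 0 < h)
    (haL : 16 * (a + 2) ^ 2 ≤ 2 ^ L) (hT : Tables N a w h cols R l₀ l₁ σ)
    (h₀ : ∀ q ∈ l₀, q.1 < 2 * a ∧ q.2 < 2 * a) (h₁ : ∀ q ∈ l₁, q.1 < 2 * a ∧ q.2 < 2 * a)
    {i : ℕ} (hi : σ.reg .i = i) (hj : σ.reg .j = 0) (hiL : i + 2 < 2 ^ L)
    (hc : ∀ i' < i + 2, ∀ j' < (a - 1) / h + 2, i' * cols + j' < R) :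
    wp L scanRow σ fun n τ =>
      n ≤ ∑ j ∈ Finset.Ico 0 ((a - 1) / h + 1), cellCost cols
        (fun c => (inCell w h cols l₀ c).length) (fun c => (inCell w h cols l₁ c).length) i j + 1 ∧
      Sound N (∃ j, j * h < a ∧ ∃ i', i - 1 ≤ i' ∧ i' < i + 2 ∧ ∃ j', j - 1 ≤ j' ∧ j' < j + 2 ∧
        ∃ q₀ ∈ inCell w h cols l₀ (i * cols + j),
          ∃ q₁ ∈ inCell w h cols l₁ (i' * cols + j'), Hit N a q₀ q₁) σ τ := by
  have haL' : a + 2 < 2 ^ L := by nlinarith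
  have hdh : (a - 1) / h ≤ a - 1 := Nat.div_le_self _ _
  refine (wp_searchLoop (N := N) (lo := 0) (hi := (a - 1) / h + 1) hL hσ (z := .j)
    (fun j => cellCost cols (fun c => (inCell w h cols l₀ c).length)
        (fun c => (inCell w h cols l₁ c).length) i j - 1)
    (fun j => ∃ i', i - 1 ≤ i' ∧ i' < i + 2 ∧ ∃ j', j - 1 ≤ j' ∧ j' < j + 2 ∧
        ∃ q₀ ∈ inCell w h cols l₀ (i * cols + j),
          ∃ q₁ ∈ inCell w h cols l₁ (i' * cols + j'), Hit N a q₀ q₁) hj (Nat.zero_le _)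
    ?_ ?_).mono ?_
  · intro τ hF
    have hTτ := hT.of_frame hF (by decide) (by decide)
    simp [hTτ.h_eq, hTτ.a_eq, mul_lt_iff_lt hh0 ha0]
  · intro j τ hτ hF hj _ hjlt
    have hi2 : τ.reg .i = i := (hF.reg .i rfl).trans hi
    refine wp_seq (wp_assign hL hτ (by simp [hi2]; omega) fun hτ1 => ?_)
    refine wp_seq ((wp_scanCell hL hτ1 haL
      ((hT.of_frame hF (by decide) (by decide)).setReg (by decide) _) h₀ h₁
      (i := i) (j := j) (by simpa using hi2) (by simpa using hj) (by simp [hi2]) hiL (by omega)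
      (fun i' hi' j' hj' => hc i' hi' j' (by omega))).mono ?_)
    rintro n ρ hρ hF ⟨hn, hS⟩
    have hj' : ρ.reg .j = j := (hF.reg .j rfl).trans (by simpa using hj)
    exact wp_assign hL hρ (by simp [hj']; omega) fun hρ1 =>
      ⟨by omega, by simp [hj'], ((Sound.of_eq (by simp) (by simp)).trans hS Or.inr).trans
          (.of_eq (by simp) (by simp)) Or.inl⟩
  · rintro n τ _ _ ⟨hn, hS⟩
    refine ⟨hn.trans (le_of_eq ?_), hS.good, hS.keep, ?_⟩
    · refine congrArg (· + 1) (Finset.sum_congr rfl fun j _ => ?_)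
      unfold cellCost; omega
    · rintro ⟨j, hj, hH⟩
      exact hS.found ⟨j, Nat.zero_le _, (mul_lt_iff_lt hh0 ha0).1 hj, hH⟩

theorem wp_scan (hL : 1 ≤ L) (hσ : Bdd L σ) (hcols : cols = 2 * a / h + 2)
    (hR : R = (2 * a / w + 2) * cols) (ha0 : 0 < a) (hw0 : 0 < w) (hh0 : 0 < h)
    (haL : 16 * (a + 2) ^ 2 ≤ 2 ^ L) (hT : Tables N a w h cols R l₀ l₁ σ)
    (h₀ : ∀ q ∈ l₀, q.1 < 2 * a ∧ q.2 < 2 * a) (h₁ : ∀ q ∈ l₁, q.1 < 2 * a ∧ q.2 < 2 * a) :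
    wp L scan σ fun n τ =>
      n ≤ scanCost ((a - 1) / w + 1) ((a - 1) / h + 1) cols
        (fun c => (inCell w h cols l₀ c).length) (fun c => (inCell w h cols l₁ c).length) ∧
      Sound N (∃ i, i * w < a ∧ ∃ j, j * h < a ∧ ∃ i', i - 1 ≤ i' ∧ i' < i + 2 ∧
        ∃ j', j - 1 ≤ j' ∧ j' < j + 2 ∧ ∃ q₀ ∈ inCell w h cols l₀ (i * cols + j),
          ∃ q₁ ∈ inCell w h cols l₁ (i' * cols + j'), Hit N a q₀ q₁) σ τ := by
  have haL' : a + 2 < 2 ^ L := by nlinarith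
  have hdw : (a - 1) / w ≤ 2 * a / w := Nat.div_le_div_right (by omega)
  have hdh : (a - 1) / h ≤ 2 * a / h := Nat.div_le_div_right (by omega)
  have hdw' : (a - 1) / w ≤ a - 1 := Nat.div_le_self _ _
  -- Neighbours may protrude beyond `[0, a)²` by one row or column; such cells were cleared and have
  -- valid numbers too. At index `0` truncated subtraction simply omits the missing neighbour.
  have hidx : ∀ i j, i ≤ 2 * a / w + 1 → j < cols → i * cols + j < R := by
    intro i j hi hj
    have : (i + 1) * cols ≤ (2 * a / w + 2) * cols := Nat.mul_le_mul_right _ (by omega)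
    rw [hR]
    linarith [add_mul i 1 cols]
  refine wp_seq (wp_assign hL hσ (by simp) fun hσ1 => ?_)
  refine (wp_searchLoop (N := N) (lo := 0) (hi := (a - 1) / w + 1) hL hσ1 (z := .i) (fun i =>
    ∑ j ∈ Finset.Ico 0 ((a - 1) / h + 1), cellCost cols
      (fun c => (inCell w h cols l₀ c).length) (fun c => (inCell w h cols l₁ c).length) i j + 3)
    (fun i => ∃ j, j * h < a ∧ ∃ i', i - 1 ≤ i' ∧ i' < i + 2 ∧
        ∃ j', j - 1 ≤ j' ∧ j' < j + 2 ∧ ∃ q₀ ∈ inCell w h cols l₀ (i * cols + j),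
          ∃ q₁ ∈ inCell w h cols l₁ (i' * cols + j'), Hit N a q₀ q₁) (by simp) (Nat.zero_le _)
    ?_ ?_).mono ?_
  · intro τ hF
    have hTτ := (hT.setReg (z := .i) (by decide) _).of_frame hF (by decide) (by decide)
    simp [hTτ.w_eq, hTτ.a_eq, mul_lt_iff_lt hw0 ha0]
  · intro i τ hτ hF hi _ hilt
    have hTτ := (hT.setReg (z := .i) (by decide) _).of_frame hF (by decide) (by decide)
    refine wp_seq (wp_assign hL hτ (by simp) fun hτ1 => ?_)
    refine wp_seq ((wp_scanRow hL hτ1 ha0 hh0 haL (hTτ.setReg (by decide) _) h₀ h₁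
      (i := i) (by simpa using hi) (by simp) (by omega)
      (fun i' hi' j' hj' => hidx _ _ (by omega) (by omega))).mono ?_)
    rintro n ρ hρ hF ⟨hn, hS⟩
    have hi' : ρ.reg .i = i := (hF.reg .i rfl).trans (by simpa using hi)
    exact wp_assign hL hρ (by simp [hi']; omega) fun hρ1 =>
      ⟨by omega, by simp [hi'], ((Sound.of_eq (by simp) (by simp)).trans hS Or.inr).trans
          (.of_eq (by simp) (by simp)) Or.inl⟩
  · rintro n τ _ _ ⟨hn, hS⟩
    refine ⟨?_, (Sound.of_eq (by simp) (by simp)).trans hS fun hH => Or.inr ?_⟩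
    · simp only [add_assoc, Nat.reduceAdd] at hn
      unfold scanCost
      omega
    · obtain ⟨i, hi, hH⟩ := hH
      exact ⟨i, Nat.zero_le _, (mul_lt_iff_lt hw0 ha0).1 hi, hH⟩

end

/-! ### The cost of a search -/

/-! ### The time of the scan -/

/-- After exchanging the sums: an index is a neighbour of at most three others. -/
theorem sum_neighbours_le (g : ℕ → ℕ) (I : ℕ) :
    ∑ i ∈ Finset.Ico 0 I, ∑ i' ∈ Finset.Ico (i - 1) (i + 2), g i' ≤
      3 * ∑ i' ∈ Finset.range (I + 1), g i' := by
  rw [Finset.sum_comm' (t' := Finset.range (I + 1))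
    (s' := fun i' => (Finset.Ico 0 I).filter fun i => i - 1 ≤ i' ∧ i' < i + 2), Finset.mul_sum]
  · refine Finset.sum_le_sum fun i' _ => ?_
    rw [Finset.sum_const, smul_eq_mul]
    refine Nat.mul_le_mul_right _ ?_
    calc _ ≤ (Finset.Ico (i' - 1) (i' + 2)).card := Finset.card_le_card fun i hi => by
          simp only [Finset.mem_filter, Finset.mem_Ico] at hi ⊢
          omega
      _ ≤ 3 := by rw [Nat.card_Ico]; omega
  · intro i i'
    simp only [Finset.mem_Ico, Finset.mem_filter, Finset.mem_range]
    omega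

/-- For `j < cols` the cell numbers `i * cols + j` are distinct. -/
theorem sum_cells_le (g : ℕ → ℕ) {J cols : ℕ} (hJ : J ≤ cols) (I : ℕ) :
    ∑ i ∈ Finset.range I, ∑ j ∈ Finset.range J, g (i * cols + j) ≤
      ∑ c ∈ Finset.range (I * cols), g c := by
  induction I with
  | zero => simp
  | succ I ih =>
    rw [Finset.sum_range_succ, add_mul, one_mul, Finset.sum_range_add]
    exact add_le_add ih (Finset.sum_le_sum_of_subset (Finset.range_mono hJ))

theorem sum_Ico_three_le (i k : ℕ) : ∑ _i' ∈ Finset.Ico (i - 1) (i + 2), k ≤ 3 * k := by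
  rw [Finset.sum_const, smul_eq_mul, Nat.card_Ico]
  exact Nat.mul_le_mul_right _ (by omega)

/-- The inequality `2 x y ≤ x² + y²` separates the two moduli: mixed products become squares, which
count pairs of points belonging to the same modulus. The factor `72 = 9 · 8` comes from the at most
nine neighbours. -/
theorem cellCost_le (cols : ℕ) (A B : ℕ → ℕ) (i j : ℕ) :
    cellCost cols A B i j ≤ 72 * A (i * cols + j) ^ 2 + 4 * (∑ i' ∈ Finset.Ico (i - 1) (i + 2),
      ∑ j' ∈ Finset.Ico (j - 1) (j + 2), B (i' * cols + j') ^ 2) + 52 := by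
  have hp : ∀ i' j', pairCost cols A B i j i' j' ≤
      (8 * A (i * cols + j) ^ 2 + 4) + 4 * B (i' * cols + j') ^ 2 := by
    intro i' j'
    unfold pairCost
    generalize A (i * cols + j) = x
    generalize B (i' * cols + j') = y
    have h1 : x ≤ x ^ 2 := Nat.le_self_pow (by norm_num) x
    have h2 : 2 * (x * y) ≤ x ^ 2 + y ^ 2 := by nlinarith [two_mul_le_add_sq x y]
    nlinarith
  unfold cellCost
  calc _ ≤ ∑ i' ∈ Finset.Ico (i - 1) (i + 2), ((24 * A (i * cols + j) ^ 2 + 16) +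
        4 * ∑ j' ∈ Finset.Ico (j - 1) (j + 2), B (i' * cols + j') ^ 2) + 4 := by
        refine Nat.add_le_add_right (Finset.sum_le_sum fun i' _ => ?_) 4
        have h1 := Finset.sum_le_sum fun j' (_ : j' ∈ Finset.Ico (j - 1) (j + 2)) => hp i' j'
        rw [Finset.sum_add_distrib, ← Finset.mul_sum] at h1
        have h2 := sum_Ico_three_le j (8 * A (i * cols + j) ^ 2 + 4)
        omega
    _ ≤ _ := by
        rw [Finset.sum_add_distrib, ← Finset.mul_sum]
        have h2 := sum_Ico_three_le i (24 * A (i * cols + j) ^ 2 + 16)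
        omega

theorem scanCost_le {I J rows cols : ℕ} (A B : ℕ → ℕ) (hI : I + 1 ≤ rows) (hJ0 : 1 ≤ J)
    (hJ : J + 1 ≤ cols) :
    scanCost I J cols A B ≤ 72 * ∑ c ∈ Finset.range (rows * cols), A c ^ 2 +
      36 * ∑ c ∈ Finset.range (rows * cols), B c ^ 2 + 56 * (rows * cols) + 2 := by
  have hA : ∑ i ∈ Finset.Ico 0 I, ∑ j ∈ Finset.Ico 0 J, A (i * cols + j) ^ 2 ≤
      ∑ c ∈ Finset.range (rows * cols), A c ^ 2 := by
    rw [← Finset.range_eq_Ico, ← Finset.range_eq_Ico]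
    exact (sum_cells_le (fun c => A c ^ 2) (by omega) I).trans (Finset.sum_le_sum_of_subset
      (Finset.range_mono (Nat.mul_le_mul_right _ (by omega))))
  have hB : ∑ i ∈ Finset.Ico 0 I, ∑ j ∈ Finset.Ico 0 J, ∑ i' ∈ Finset.Ico (i - 1) (i + 2),
      ∑ j' ∈ Finset.Ico (j - 1) (j + 2), B (i' * cols + j') ^ 2 ≤
      9 * ∑ c ∈ Finset.range (rows * cols), B c ^ 2 := by
    calc _ = ∑ i ∈ Finset.Ico 0 I, ∑ i' ∈ Finset.Ico (i - 1) (i + 2), ∑ j ∈ Finset.Ico 0 J,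
          ∑ j' ∈ Finset.Ico (j - 1) (j + 2), B (i' * cols + j') ^ 2 :=
          Finset.sum_congr rfl fun i _ => Finset.sum_comm
      _ ≤ ∑ i ∈ Finset.Ico 0 I, ∑ i' ∈ Finset.Ico (i - 1) (i + 2),
          3 * ∑ j' ∈ Finset.range (J + 1), B (i' * cols + j') ^ 2 :=
          Finset.sum_le_sum fun i _ => Finset.sum_le_sum fun i' _ =>
            sum_neighbours_le (fun j' => B (i' * cols + j') ^ 2) J
      _ ≤ 3 * ∑ i' ∈ Finset.range (I + 1),
          3 * ∑ j' ∈ Finset.range (J + 1), B (i' * cols + j') ^ 2 :=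
          sum_neighbours_le (fun i' => 3 * ∑ j' ∈ Finset.range (J + 1), B (i' * cols + j') ^ 2) I
      _ = 9 * ∑ i' ∈ Finset.range (I + 1), ∑ j' ∈ Finset.range (J + 1), B (i' * cols + j') ^ 2 := by
          rw [← Finset.mul_sum]; ring
      _ ≤ _ := Nat.mul_le_mul_left _
          ((sum_cells_le (fun c => B c ^ 2) hJ (I + 1)).trans (Finset.sum_le_sum_of_subset
            (Finset.range_mono (Nat.mul_le_mul_right _ hI))))
  have hIJ : I * J ≤ rows * cols := Nat.mul_le_mul (by omega) (by omega)
  have hIJ' : I ≤ I * J := Nat.le_mul_of_pos_right _ hJ0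
  unfold scanCost
  calc _ ≤ ∑ i ∈ Finset.Ico 0 I, (∑ j ∈ Finset.Ico 0 J, (72 * A (i * cols + j) ^ 2 +
        4 * (∑ i' ∈ Finset.Ico (i - 1) (i + 2),
          ∑ j' ∈ Finset.Ico (j - 1) (j + 2), B (i' * cols + j') ^ 2) + 52) + 4) + 2 :=
        Nat.add_le_add_right (Finset.sum_le_sum fun i _ => Nat.add_le_add_right
          (Finset.sum_le_sum fun j _ => cellCost_le cols A B i j) 4) 2
    _ = 72 * (∑ i ∈ Finset.Ico 0 I, ∑ j ∈ Finset.Ico 0 J, A (i * cols + j) ^ 2) +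
        4 * (∑ i ∈ Finset.Ico 0 I, ∑ j ∈ Finset.Ico 0 J, ∑ i' ∈ Finset.Ico (i - 1) (i + 2),
          ∑ j' ∈ Finset.Ico (j - 1) (j + 2), B (i' * cols + j') ^ 2) + 52 * (I * J) + 4 * I + 2 := by
        simp only [Finset.sum_add_distrib, ← Finset.mul_sum, Finset.sum_const, Nat.card_Ico,
          smul_eq_mul, Nat.sub_zero]
        ring
    _ ≤ _ := by omega

/-! ### Pairs of close points -/

open Classical in
/-- The points of the modular hyperbola. -/
noncomputable def points (N m : ℕ) : Finset (ℕ × ℕ) :=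
  (Finset.range (2 * m) ×ˢ Finset.range (2 * m)).filter (IsPoint N m)

@[simp] theorem mem_points {N m : ℕ} {q : ℕ × ℕ} : q ∈ points N m ↔ IsPoint N m q := by
  simp only [points, Finset.mem_filter, Finset.mem_product, Finset.mem_range, and_iff_right_iff_imp]
  exact fun h => ⟨h.1, h.2.1⟩

/-- Pairs of points of the modular hyperbola at distance less than `w` horizontally and less than
`h` vertically. -/
noncomputable def closePairs (N m w h : ℕ) : Finset ((ℕ × ℕ) × (ℕ × ℕ)) :=
  (points N m ×ˢ points N m).filter fun z =>
    |(z.2.1 : ℤ) - z.1.1| < w ∧ |(z.2.2 : ℤ) - z.1.2| < h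

theorem abs_sub_lt_of_div_eq {x y w : ℕ} (hw : 0 < w) (h : x / w = y / w) :
    |(y : ℤ) - x| < w := by
  have h1 := Nat.div_add_mod x w
  have h2 := Nat.div_add_mod y w
  have h3 := Nat.mod_lt x hw
  have h4 := Nat.mod_lt y hw
  rw [h] at h1
  rw [abs_lt]
  omega

/-- The sum of squares counts the ordered pairs of points sharing a cell, and such points are closer
than `w` and `h`. -/
theorem sum_sq_inCell_le {N m a w h : ℕ} {l : List (ℕ × ℕ)} (hma : m ≤ a) (hw : 0 < w) (hh : 0 < h)
    (hl : l.Nodup) (hlp : ∀ q ∈ l, IsPoint N m q) :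
    ∑ c ∈ Finset.range ((2 * a / w + 2) * (2 * a / h + 2)),
      (inCell w h (2 * a / h + 2) l c).length ^ 2 ≤ (closePairs N m w h).card := by
  classical
  set f := cellNo w h (2 * a / h + 2) with hf
  set S := (l.toFinset ×ˢ l.toFinset).filter fun z => f z.1 = f z.2
  have hb : ∀ q ∈ l, q.1 < 2 * a ∧ q.2 < 2 * a := fun q hq => by
    have := (hlp q hq).1
    have := (hlp q hq).2.1
    omega
  have hSR : ∀ z ∈ S, f z.1 ∈ Finset.range ((2 * a / w + 2) * (2 * a / h + 2)) := by
    intro z hz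
    simp only [S, Finset.mem_filter, Finset.mem_product, List.mem_toFinset] at hz
    have := hb _ hz.1.1
    exact Finset.mem_range.2 (cellNo_lt this.1 this.2)
  have hSc : S ⊆ closePairs N m w h := by
    intro z hz
    simp only [S, Finset.mem_filter, Finset.mem_product, List.mem_toFinset] at hz
    simp only [closePairs, Finset.mem_filter, Finset.mem_product, mem_points]
    refine ⟨⟨hlp _ hz.1.1, hlp _ hz.1.2⟩, ?_⟩
    have h1 := (hb _ hz.1.1).2
    have h2 := (hb _ hz.1.2).2
    have h3 : z.1.2 / h < 2 * a / h + 2 := by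
      have := Nat.div_le_div_right (c := h) h1.le
      omega
    have h4 : z.2.2 / h < 2 * a / h + 2 := by
      have := Nat.div_le_div_right (c := h) h2.le
      omega
    have he := hz.2
    simp only [hf, cellNo] at he
    have hc0 : 0 < 2 * a / h + 2 := Nat.succ_pos _
    simp only [mul_comm _ (2 * a / h + 2)] at he
    -- The column index is smaller than `cols`, so division with remainder recovers row and column
    -- from the cell number.
    have e1 := congrArg (· / (2 * a / h + 2)) he
    have e2 := congrArg (· % (2 * a / h + 2)) he
    simp only [Nat.mul_add_mod, Nat.mod_eq_of_lt h3, Nat.mod_eq_of_lt h4] at e2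
    simp only [Nat.mul_add_div hc0, Nat.div_eq_of_lt h3, Nat.div_eq_of_lt h4, add_zero] at e1
    exact ⟨abs_sub_lt_of_div_eq hw e1, abs_sub_lt_of_div_eq hh e2⟩
  refine le_trans (le_of_eq ?_) (Finset.card_le_card hSc)
  rw [Finset.card_eq_sum_card_fiberwise hSR]
  refine Finset.sum_congr rfl fun c _ => ?_
  have e : ({z ∈ S | f z.1 = c}) = (inCell w h (2 * a / h + 2) l c).toFinset ×ˢ
      (inCell w h (2 * a / h + 2) l c).toFinset := by
    ext z
    simp only [S, inCell, Finset.mem_filter, Finset.mem_product, List.mem_toFinset, ← hf,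
      List.mem_filter, decide_eq_true_eq]
    constructor
    · rintro ⟨⟨⟨h1, h2⟩, h3⟩, h4⟩
      exact ⟨⟨h1, h4⟩, h2, h3 ▸ h4⟩
    · rintro ⟨⟨h1, h2⟩, h3, h4⟩
      exact ⟨⟨⟨h1, h3⟩, h2.trans h4.symm⟩, h2⟩
  rw [e, Finset.card_product, List.toFinset_card_of_nodup (by exact hl.filter _), sq]

/-! ### The search -/

section

variable {L : ℕ} {σ : State}

/-- Time is expressed through numbers of close pairs and success through the existence of a hit;
both are evaluated later, by number theory alone. -/
theorem wp_search (hL : 1 ≤ L) (hσ : Bdd L σ) {N a w h m : ℕ} (hm2 : 2 ≤ m) (ham : a = m + 1)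
    (hw0 : 0 < w) (hh0 : 0 < h) (hN : σ.reg .N = N) (ha : σ.reg .a = a) (hw : σ.reg .w = w)
    (hh : σ.reg .h = h) (haL : 16 * (a + 2) ^ 2 ≤ 2 ^ L) :
    wp L search σ fun n τ =>
      n ≤ 82 * a + 62 * ((2 * a / w + 2) * (2 * a / h + 2)) + 38 +
        72 * (closePairs N a w h).card + 36 * (closePairs N m w h).card ∧
      Sound N (∃ q₀ q₁ : ℕ × ℕ, q₀.1 < a ∧ q₀.2 < a ∧ q₀.1.Coprime a ∧ q₀.1 * q₀.2 ≡ N [MOD a] ∧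
        IsPoint N m q₁ ∧ q₀.1 ≤ q₁.1 ∧ q₁.1 ≤ q₀.1 + w ∧ q₀.2 ≤ q₁.2 ∧ q₁.2 ≤ q₀.2 + h ∧
        Hit N a q₀ q₁) σ τ := by
  unfold search
  refine wp_seq ((wp_listMod0 hL hσ (by omega) hN ha hw hh haL).mono ?_)
  rintro n₀ τ₀ hτ₀ hF₀ ⟨hn₀, l₀, hd₀, hp₀, hc₀, hg₀⟩
  refine wp_seq ((wp_listMod1 hL hτ₀ hm2 ham ((hF₀.reg .N rfl).trans hN)
    ((hF₀.reg .a rfl).trans ha) ((hF₀.reg .w rfl).trans hw) ((hF₀.reg .h rfl).trans hh)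
    haL).mono ?_)
  rintro n₁ τ₁ hτ₁ hF₁ ⟨hn₁, hcols, l₁, hd₁, hp₁, hg₁⟩
  have hg₀' : Grid 0 w h (2 * a / h + 2) ((2 * a / w + 2) * (2 * a / h + 2)) l₀ τ₁ := by
    unfold Grid
    rw [hF₁.mem (.px 0) rfl, hF₁.mem (.py 0) rfl, hF₁.mem (.next 0) rfl, hF₁.mem (.head 0) rfl]
    exact hg₀
  have hb₀ : ∀ q ∈ l₀, q.1 < 2 * a ∧ q.2 < 2 * a := fun q hq => ⟨(hp₀ q hq).1, (hp₀ q hq).2.1⟩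
  have hb₁ : ∀ q ∈ l₁, q.1 < 2 * a ∧ q.2 < 2 * a := fun q hq => by
    have := ((hp₁ q).1 hq).1
    have := ((hp₁ q).1 hq).2.1
    omega
  refine (wp_scan hL hτ₁ rfl rfl (by omega) hw0 hh0 haL ⟨(hF₁.reg .N rfl).trans
    ((hF₀.reg .N rfl).trans hN), (hF₁.reg .a rfl).trans ((hF₀.reg .a rfl).trans ha),
    (hF₁.reg .w rfl).trans ((hF₀.reg .w rfl).trans hw), (hF₁.reg .h rfl).trans
    ((hF₀.reg .h rfl).trans hh), hcols, hg₀', hg₁⟩ hb₀ hb₁).mono ?_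
  rintro n₂ τ₂ hτ₂ hF₂ ⟨hn₂, hS⟩
  have hdw : (a - 1) / w ≤ 2 * a / w := Nat.div_le_div_right (by omega)
  have hdh : (a - 1) / h ≤ 2 * a / h := Nat.div_le_div_right (by omega)
  have hsc := scanCost_le (I := (a - 1) / w + 1) (J := (a - 1) / h + 1) (rows := 2 * a / w + 2)
    (cols := 2 * a / h + 2) (fun c => (inCell w h (2 * a / h + 2) l₀ c).length)
    (fun c => (inCell w h (2 * a / h + 2) l₁ c).length) (by omega) (Nat.succ_pos _) (by omega)
  have hE₀ := sum_sq_inCell_le (le_refl a) hw0 hh0 hd₀ hp₀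
  have hE₁ := sum_sq_inCell_le (a := a) (by omega : m ≤ a) hw0 hh0 hd₁ fun q hq => (hp₁ q).1 hq
  refine ⟨by omega, ?_⟩
  refine ((Sound.of_eq (N := N) (σ := σ) (τ := τ₀) (hF₀.reg .outU rfl) (hF₀.reg .outV rfl)).trans
    (Sound.of_eq (N := N) (σ := τ₀) (τ := τ₁) (hF₁.reg .outU rfl) (hF₁.reg .outV rfl))
    Or.inl).trans hS fun hH => Or.inr ?_
  obtain ⟨q₀, q₁, h1, h2, h3, h4, h5, h6, h7, h8, h9, hH⟩ := hH
  -- A displacement by at most the side of a cell raises the cell index by at most one.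
  have hnb : ∀ {x y w : ℕ}, 0 < w → x ≤ y → y ≤ x + w → x / w - 1 ≤ y / w ∧ y / w < x / w + 2 := by
    intro x y w hw hxy hyx
    have e1 := Nat.div_le_div_right (c := w) hxy
    have e2 := Nat.div_le_div_right (c := w) hyx
    rw [Nat.add_div_right _ hw] at e2
    have e3 := Nat.zero_le (x / w)
    omega
  refine ⟨q₀.1 / w, (Nat.div_mul_le_self _ _).trans_lt h1, q₀.2 / h,
    (Nat.div_mul_le_self _ _).trans_lt h2, q₁.1 / w, (hnb hw0 h6 h7).1, (hnb hw0 h6 h7).2,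
    q₁.2 / h, (hnb hh0 h8 h9).1, (hnb hh0 h8 h9).2, q₀, ?_, q₁, ?_, hH⟩
  · exact List.mem_filter.2 ⟨hc₀ q₀ h1 h2 h3 h4, by simp [cellNo]⟩
  · exact List.mem_filter.2 ⟨(hp₁ q₁).2 h5, by simp [cellNo]⟩

end

/-! ### Quadratic congruences -/

/-! ### The second moment bound -/

theorem card_le_of_dvd_sub {s : Finset ℤ} {A : ℤ} {n k : ℕ} (hk : 0 < k)
    (hs : ∀ z ∈ s, A ≤ z ∧ z < A + n) (hd : ∀ z ∈ s, ∀ z' ∈ s, (k : ℤ) ∣ z - z') :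
    s.card ≤ n / k + 1 := by
  have hk' : (0 : ℤ) < k := by exact_mod_cast hk
  rw [← Finset.card_range (n / k + 1)]
  refine Finset.card_le_card_of_injOn (fun z => ((z - A) / k).toNat) (fun z hz => ?_) ?_
  · obtain ⟨h1, h2⟩ := hs z hz
    have h3 : (z - A) / k ≤ (n : ℤ) / k := Int.ediv_le_ediv hk' (by omega)
    rw [Finset.mem_coe, Finset.mem_range, Nat.lt_succ_iff, Int.toNat_le]
    exact_mod_cast h3
  · intro z hz z' hz' he
    have h1 := Int.ediv_nonneg (sub_nonneg.2 (hs z hz).1) hk'.le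
    have h2 := Int.ediv_nonneg (sub_nonneg.2 (hs z' hz').1) hk'.le
    have h3 : (z - A) / k = (z' - A) / k := by
      simp only at he
      omega
    have h4 : (z - A) % k = (z' - A) % k := by
      apply Int.emod_emod_of_dvd _ (dvd_refl _) |>.symm.trans
      rw [Int.emod_emod_of_dvd _ (dvd_refl _)]
      apply Int.ModEq.symm
      rw [Int.modEq_iff_dvd]
      simpa using hd z hz z' hz'
    have h5 := Int.mul_ediv_add_emod (z - A) k
    have h6 := Int.mul_ediv_add_emod (z' - A) k
    rw [h3, h4] at h5
    omega

/-- The solutions `x` in `[0, 2m)`, prime to `m`, of `t x² + s t x + s N ≡ 0` modulo `m`. -/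
noncomputable def quadSols (N m : ℕ) (s t : ℤ) : Finset ℕ :=
  (Finset.range (2 * m)).filter fun x =>
    x.Coprime m ∧ (m : ℤ) ∣ t * x * x + s * t * x + s * N

theorem mem_quadSols {N m x : ℕ} {s t : ℤ} : x ∈ quadSols N m s t ↔
    x < 2 * m ∧ x.Coprime m ∧ (m : ℤ) ∣ t * x * x + s * t * x + s * N := by
  rw [quadSols, Finset.mem_filter, Finset.mem_range]

/-- The greatest common divisor of `d` and its complementary divisor in `n`. -/
def cogcd (n d : ℕ) : ℕ := d.gcd (n / d)

/-- Two elements of `S` differ by a multiple of `lcm (d, m' / d) = m' / f`, where `f = cogcd m' d`.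
The interval `[0, 2m)` has length `2 e f` times this modulus, which allows at most `2 e f + 1 ≤ 3 e
f` elements. -/
theorem card_fiber_le {m e m' x₀ d : ℕ} {s : ℤ} {S : Finset ℕ} (hm : m = e * m') (hm0 : 0 < m)
    (hd : d ∈ m'.divisors) (hS : ∀ x ∈ S, x < 2 * m)
    (h₁ : ∀ x ∈ S, (d : ℤ) ∣ x - x₀) (h₂ : ∀ x ∈ S, ((m' / d : ℕ) : ℤ) ∣ x + x₀ + s) :
    S.card ≤ 3 * (e * cogcd m' d) := by
  have he0 : 0 < e := Nat.pos_of_mul_pos_right (hm ▸ hm0)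
  have hm'0 : 0 < m' := Nat.pos_of_mul_pos_left (hm ▸ hm0)
  obtain ⟨hdm, -⟩ := Nat.mem_divisors.1 hd
  have hd0 : 0 < d := Nat.pos_of_dvd_of_pos hdm hm'0
  have hdd : d * (m' / d) = m' := Nat.mul_div_cancel' hdm
  have hd'0 : 0 < m' / d := Nat.div_pos (Nat.le_of_dvd hm'0 hdm) hd0
  have hk0 : 0 < d.lcm (m' / d) := Nat.lcm_pos hd0 hd'0
  have hf0 : 0 < cogcd m' d := Nat.gcd_pos_of_pos_left _ hd0
  have hkf : cogcd m' d * d.lcm (m' / d) = m' := by rw [cogcd, Nat.gcd_mul_lcm, hdd]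
  have h := card_le_of_dvd_sub (s := S.map ⟨((↑) : ℕ → ℤ), Nat.cast_injective⟩) (A := 0)
    (n := 2 * m) hk0 ?_ ?_
  · rw [Finset.card_map] at h
    have e1 : 2 * m / d.lcm (m' / d) = 2 * (e * cogcd m' d) := by
      refine Nat.div_eq_of_eq_mul_left hk0 ?_
      rw [hm, mul_assoc 2, mul_assoc e, hkf]
    have := Nat.mul_pos he0 hf0
    omega
  · intro z hz
    obtain ⟨x, hx, rfl⟩ := Finset.mem_map.1 hz
    have := hS x hx
    simp only [Function.Embedding.coeFn_mk]
    omega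
  · intro z hz z' hz'
    obtain ⟨x, hx, rfl⟩ := Finset.mem_map.1 hz
    obtain ⟨x', hx', rfl⟩ := Finset.mem_map.1 hz'
    simp only [Function.Embedding.coeFn_mk]
    have e1 : (d : ℤ) ∣ x - x' := by simpa using dvd_sub (h₁ x hx) (h₁ x' hx')
    have e2 : ((m' / d : ℕ) : ℤ) ∣ x - x' := by
      have := dvd_sub (h₂ x hx) (h₂ x' hx')
      rwa [show (x : ℤ) + x₀ + s - (x' + x₀ + s) = x - x' by ring] at this
    rw [Int.ofNat_dvd_left] at e1 e2 ⊢
    exact Nat.lcm_dvd e1 e2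

/-- Fix a solution `x₀` and let `e = gcd (t, m)`, `m' = m / e`. Subtracting the congruences of `x`
and `x₀` gives `m' ∣ (x - x₀)(x + x₀ + s)`. With `d = gcd (x - x₀, m')` the complementary divisor
`m' / d` divides `x + x₀ + s`, so `card_fiber_le` applies. The conditions in the sum are those under
which a fibre can be nonempty; they make it possible to sum over `(s, t)` afterwards. -/
theorem card_quadSols_le {N m : ℕ} (hm0 : 0 < m) (hN : N.Coprime m) (s t : ℤ) :
    (quadSols N m s t).card ≤ ∑ e ∈ m.divisors, ∑ d ∈ (m / e).divisors,
      if (e : ℤ) ∣ s ∧ (e : ℤ) ∣ t ∧ ((cogcd (m / e) d : ℕ) : ℤ) ^ 2 ∣ s * t - 4 * N then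
        3 * (e * cogcd (m / e) d) else 0 := by
  rcases (quadSols N m s t).eq_empty_or_nonempty with h0 | ⟨x₀, hx₀⟩
  · rw [h0]; simp
  simp only [quadSols, Finset.mem_filter, Finset.mem_range] at hx₀
  obtain ⟨-, hx₀c, hx₀d⟩ := hx₀
  have hcop : ∀ x : ℕ, x.Coprime m → IsCoprime (x : ℤ) m := fun x hx =>
    Nat.isCoprime_iff_coprime.2 hx
  have hm0' : (m : ℤ) ≠ 0 := by exact_mod_cast hm0.ne'
  set e := Int.gcd t m with he
  have he0 : 0 < e := Int.gcd_pos_of_ne_zero_right _ hm0'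
  have het : (e : ℤ) ∣ t := Int.gcd_dvd_left _ _
  have hem : (e : ℤ) ∣ m := Int.gcd_dvd_right _ _
  have hes : (e : ℤ) ∣ s := by
    have h1 : (e : ℤ) ∣ s * N := by
      have h2 : (e : ℤ) ∣ t * (x₀ * x₀ + s * x₀) := het.mul_right _
      have h3 := dvd_sub (hem.trans hx₀d) h2
      rwa [show t * x₀ * x₀ + s * t * x₀ + s * N - t * (x₀ * x₀ + s * x₀) = s * N by ring] at h3
    exact ((hcop N hN).of_isCoprime_of_dvd_right hem).symm.dvd_of_dvd_mul_right h1
  obtain ⟨m', hm'⟩ : e ∣ m := by exact_mod_cast hem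
  obtain ⟨s', hs'⟩ := hes
  obtain ⟨t', ht'⟩ := het
  have hme : m / e = m' := by rw [hm', Nat.mul_div_cancel_left _ he0]
  have he0' : (e : ℤ) ≠ 0 := by exact_mod_cast he0.ne'
  have hm'm : (m' : ℤ) ∣ m := ⟨e, by rw [hm']; push_cast; ring⟩
  have htm : IsCoprime t' (m' : ℤ) := by
    have h1 := Int.isCoprime_iff_gcd_eq_one.2 (Int.gcd_ediv_gcd_ediv_gcd (i := t) (j := m) he0)
    rw [← he] at h1
    have h2 : t / e = t' := by rw [ht', Int.mul_ediv_cancel_left _ he0']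
    have h3 : (m : ℤ) / e = m' := by rw [hm']; push_cast; rw [Int.mul_ediv_cancel_left _ he0']
    rwa [h2, h3] at h1
  have hred : ∀ x : ℕ, (m : ℤ) ∣ t * x * x + s * t * x + s * N →
      (m' : ℤ) ∣ t' * x * x + s * t' * x + s' * N := by
    intro x hx
    have h1 : t * x * x + s * t * x + s * N = e * (t' * x * x + s * t' * x + s' * N) := by
      rw [ht']
      -- Only the constant term takes its factor `e` from `s`; the middle term already has it from
      -- `t`.
      nth_rewrite 2 [hs']
      ring
    rw [h1, hm'] at hx
    push_cast at hx
    exact Int.dvd_of_mul_dvd_mul_left he0' hx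
  have hx₀r := hred x₀ hx₀d
  -- Modulo `m'` the unit `t' x₀²` is a multiple of `s'`.
  have hsm : IsCoprime s' (m' : ℤ) := by
    have h1 : IsCoprime (t' * x₀ * x₀) (m' : ℤ) :=
      (htm.mul_left ((hcop _ hx₀c).of_isCoprime_of_dvd_right hm'm)).mul_left
        ((hcop _ hx₀c).of_isCoprime_of_dvd_right hm'm)
    obtain ⟨k, hk⟩ := hx₀r
    have h2 : t' * x₀ * x₀ = s' * (-(e * t' * x₀ + N)) + m' * k := by
      rw [← hk, hs']; ring
    rw [h2] at h1
    exact h1.of_add_mul_left_left.of_mul_left_left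
  have hfib : ∀ d ∈ m'.divisors,
      ((quadSols N m s t).filter fun x : ℕ => Int.gcd (x - x₀) m' = d).card ≤
      if (e : ℤ) ∣ s ∧ (e : ℤ) ∣ t ∧ ((cogcd m' d : ℕ) : ℤ) ^ 2 ∣ s * t - 4 * N then
        3 * (e * cogcd m' d) else 0 := by
    intro d hd
    have hm'0 : 0 < m' := Nat.pos_of_mul_pos_left (hm' ▸ hm0)
    obtain ⟨hdm, -⟩ := Nat.mem_divisors.1 hd
    have hd0 : 0 < d := Nat.pos_of_dvd_of_pos hdm hm'0
    have hdd : d * (m' / d) = m' := Nat.mul_div_cancel' hdm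
    have hdd' : (m' : ℤ) = d * (m' / d : ℕ) := by exact_mod_cast hdd.symm
    have key : ∀ x ∈ (quadSols N m s t).filter fun x : ℕ => Int.gcd (x - x₀) m' = d,
        x < 2 * m ∧ (d : ℤ) ∣ x - x₀ ∧ ((m' / d : ℕ) : ℤ) ∣ x + x₀ + s := by
      intro x hx
      simp only [quadSols, Finset.mem_filter, Finset.mem_range] at hx
      obtain ⟨⟨hx1, hx2, hx3⟩, hx4⟩ := hx
      have hxr := hred x hx3
      have h1 : (d : ℤ) ∣ x - x₀ := hx4 ▸ Int.gcd_dvd_left _ _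
      refine ⟨hx1, h1, ?_⟩
      obtain ⟨k, hk⟩ := h1
      have h2 : (m' : ℤ) ∣ t' * ((x - x₀) * (x + x₀ + s)) := by
        have := dvd_sub hxr hx₀r
        rwa [show t' * x * x + s * t' * x + s' * N - (t' * x₀ * x₀ + s * t' * x₀ + s' * N) =
          t' * ((x - x₀) * (x + x₀ + s)) by ring] at this
      have h3 := htm.symm.dvd_of_dvd_mul_left h2
      rw [hk, hdd', mul_assoc] at h3
      have h4 := Int.dvd_of_mul_dvd_mul_left (by exact_mod_cast hd0.ne') h3
      refine IsCoprime.dvd_of_dvd_mul_left ?_ h4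
      have h5 := Int.isCoprime_iff_gcd_eq_one.2
        (Int.gcd_ediv_gcd_ediv_gcd (i := (x : ℤ) - x₀) (j := m') (by rw [hx4]; exact hd0))
      rw [hx4, hk, Int.mul_ediv_cancel_left _ (by exact_mod_cast hd0.ne')] at h5
      rw [Int.natCast_div]
      exact h5.symm
    rcases ((quadSols N m s t).filter fun x : ℕ => Int.gcd (x - x₀) m' = d).eq_empty_or_nonempty
      with h0 | ⟨x, hx⟩
    · rw [h0]; simp
    obtain ⟨hx1, hx2, hx3⟩ := key x hx
    rw [if_pos]
    · exact card_fiber_le hm' hm0 hd (fun x hx => (key x hx).1) (fun x hx => (key x hx).2.1)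
        fun x hx => (key x hx).2.2
    · refine ⟨⟨s', hs'⟩, ⟨t', ht'⟩, ?_⟩
      have f1 : ((cogcd m' d : ℕ) : ℤ) ∣ d := Int.natCast_dvd_natCast.2 (Nat.gcd_dvd_left _ _)
      have f2 : ((cogcd m' d : ℕ) : ℤ) ∣ (m' / d : ℕ) :=
        Int.natCast_dvd_natCast.2 (Nat.gcd_dvd_right _ _)
      have f3 : ((cogcd m' d : ℕ) : ℤ) ^ 2 ∣ m' := by
        rw [hdd', sq]
        exact mul_dvd_mul f1 f2
      have f4 : ((cogcd m' d : ℕ) : ℤ) ∣ 2 * x₀ + s := by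
        have := dvd_sub (f2.trans hx3) (f1.trans hx2)
        rwa [show (x : ℤ) + x₀ + s - (x - x₀) = 2 * x₀ + s by ring] at this
      -- Completing the square: `f` divides the difference `2 x₀ + s` of the two factors, and `t' (2
      -- x₀ + s)²` is congruent to `s' (st - 4N)` modulo `m'`, hence modulo `f²`.
      have f5 : ((cogcd m' d : ℕ) : ℤ) ^ 2 ∣ s' * (s * t - 4 * N) := by
        have h1 := dvd_sub ((pow_dvd_pow_of_dvd f4 2).mul_left t')
          ((f3.trans hx₀r).mul_left 4)
        rwa [show t' * (2 * x₀ + s) ^ 2 - 4 * (t' * x₀ * x₀ + s * t' * x₀ + s' * N) =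
          s' * (s * t - 4 * N) by linear_combination t' * s * hs' - s' * s * ht'] at h1
      exact (hsm.of_isCoprime_of_dvd_right f3).symm.dvd_of_dvd_mul_left f5
  have hcard := Finset.card_eq_sum_card_fiberwise (s := quadSols N m s t) (t := m'.divisors)
    (f := fun x : ℕ => Int.gcd (x - x₀) m') (fun x _ => by
      rw [Finset.mem_coe, Nat.mem_divisors]
      refine ⟨?_, (Nat.pos_of_mul_pos_left (hm' ▸ hm0)).ne'⟩
      exact_mod_cast Int.gcd_dvd_right ((x : ℤ) - x₀) m')
  rw [hcard]
  refine (Finset.sum_le_sum hfib).trans ?_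
  -- Only one `e` occurs, but it depends on `t`; adding the terms of all divisors removes this
  -- dependence.
  have hmem : e ∈ m.divisors := Nat.mem_divisors.2 ⟨⟨m', hm'⟩, hm0.ne'⟩
  refine le_trans (le_of_eq ?_) (Finset.single_le_sum (f := fun e => ∑ d ∈ (m / e).divisors,
    if (e : ℤ) ∣ s ∧ (e : ℤ) ∣ t ∧ ((cogcd (m / e) d : ℕ) : ℤ) ^ 2 ∣ s * t - 4 * N then
      3 * (e * cogcd (m / e) d) else 0) (fun _ _ => Nat.zero_le _) hmem)
  rw [hme]

/-! ### Pairs of close points -/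

/-- A factorization of `P` is determined by the absolute value and the sign of its first factor. -/
theorem card_factorizations_le {P : ℤ} (hP : P ≠ 0) {T : Finset (ℤ × ℤ)}
    (hT : ∀ z ∈ T, z.1 * z.2 = P) : T.card ≤ 2 * P.natAbs.divisors.card := by
  rw [mul_comm, ← Fintype.card_bool, ← Finset.card_univ, ← Finset.card_product]
  refine Finset.card_le_card_of_injOn (fun z => (z.1.natAbs, decide (0 < z.1))) (fun z hz => ?_) ?_
  · have h := hT z hz
    simp only [Finset.coe_product, Set.mem_prod, Finset.mem_coe, Nat.mem_divisors, Finset.mem_univ,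
      and_true]
    refine ⟨Int.natAbs_dvd_natAbs.2 ⟨z.2, h.symm⟩, by simpa using hP⟩
  · rintro ⟨s, t⟩ hz ⟨s', t'⟩ hz' he
    have h1 : s * t = P := hT _ hz
    have h2 : s' * t' = P := hT _ hz'
    simp only [Prod.mk.injEq, decide_eq_decide] at he
    have hs : s ≠ 0 := by rintro rfl; exact hP (by rw [← h1, zero_mul])
    have hs' : s' ≠ 0 := by rintro rfl; exact hP (by rw [← h2, zero_mul])
    obtain rfl : s = s' := by omega
    rw [← h2] at h1
    rw [mul_left_cancel₀ hs h1]

/-- The nonzero differences of points that are close to each other. -/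
noncomputable def offsets (w h : ℕ) : Finset (ℤ × ℤ) :=
  (Finset.Ioo (-(w : ℤ)) w ×ˢ Finset.Ioo (-(h : ℤ)) h).filter fun z => z.1 ≠ 0 ∧ z.2 ≠ 0

/-- The products `P = s t` are divisible by `e²` and lie in one class modulo `f²`. Using the larger
of the two moduli, the number of possible `P` is at most `2wh / max(e, f)² + 1`, and `e f ≤ max(e,
f)²` cancels the denominator. Each `P` arises from at most `2 D` pairs. -/
theorem card_offsets_le {w h e f m D : ℕ} {c : ℤ} (he : 0 < e) (hf : 0 < f) (hef : e * f ≤ m)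
    (hD : ∀ n, 0 < n → n ≤ w * h → n.divisors.card ≤ D) :
    e * f * ((offsets w h).filter fun z => (e : ℤ) ∣ z.1 ∧ (e : ℤ) ∣ z.2 ∧
      (f : ℤ) ^ 2 ∣ z.1 * z.2 - c).card ≤ 2 * D * (2 * (w * h) + m) := by
  classical
  set T := (offsets w h).filter fun z => (e : ℤ) ∣ z.1 ∧ (e : ℤ) ∣ z.2 ∧
      (f : ℤ) ^ 2 ∣ z.1 * z.2 - c with hT
  set I := T.image fun z => z.1 * z.2 with hI
  have hTm : ∀ z ∈ T, |z.1 * z.2| < ((w * h : ℕ) : ℤ) ∧ z.1 * z.2 ≠ 0 ∧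
      (e : ℤ) ^ 2 ∣ z.1 * z.2 ∧ (f : ℤ) ^ 2 ∣ z.1 * z.2 - c := by
    intro z hz
    simp only [hT, offsets, Finset.mem_filter, Finset.mem_product, Finset.mem_Ioo] at hz
    obtain ⟨⟨⟨h1, h2⟩, h3, h4⟩, h5, h6, h7⟩ := hz
    refine ⟨?_, mul_ne_zero h3 h4, by rw [sq]; exact mul_dvd_mul h5 h6, h7⟩
    rw [abs_mul]
    push_cast
    exact mul_lt_mul'' (abs_lt.2 h1) (abs_lt.2 h2) (abs_nonneg _) (abs_nonneg _)
  have hk : ∀ k : ℕ, 0 < k → (∀ P ∈ I, ∀ P' ∈ I, ((k ^ 2 : ℕ) : ℤ) ∣ P - P') →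
      I.card ≤ 2 * (w * h) / k ^ 2 + 1 := by
    intro k hk0 hk
    refine card_le_of_dvd_sub (A := -((w * h : ℕ) : ℤ)) (by positivity) (fun P hP => ?_) hk
    obtain ⟨z, hz, rfl⟩ := Finset.mem_image.1 hP
    have := abs_lt.1 (hTm z hz).1
    push_cast at this ⊢
    constructor <;> linarith
  have hIc : e * f * I.card ≤ 2 * (w * h) + m := by
    have hmax : ∀ k : ℕ, e ≤ k → f ≤ k → I.card ≤ 2 * (w * h) / k ^ 2 + 1 →
        e * f * I.card ≤ 2 * (w * h) + m := by
      intro k hek hfk hcard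
      have h1 : e * f ≤ k ^ 2 := by rw [sq]; exact Nat.mul_le_mul hek hfk
      calc e * f * I.card ≤ e * f * (2 * (w * h) / k ^ 2 + 1) := Nat.mul_le_mul_left _ hcard
        _ = e * f * (2 * (w * h) / k ^ 2) + e * f := by ring
        _ ≤ k ^ 2 * (2 * (w * h) / k ^ 2) + m := add_le_add (Nat.mul_le_mul_right _ h1) hef
        _ ≤ _ := Nat.add_le_add_right (Nat.mul_div_le _ _) _
    rcases le_total e f with h | h
    · refine hmax f h le_rfl (hk f hf fun P hP P' hP' => ?_)
      obtain ⟨z, hz, rfl⟩ := Finset.mem_image.1 hP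
      obtain ⟨z', hz', rfl⟩ := Finset.mem_image.1 hP'
      have := dvd_sub (hTm z hz).2.2.2 (hTm z' hz').2.2.2
      rw [show z.1 * z.2 - c - (z'.1 * z'.2 - c) = z.1 * z.2 - z'.1 * z'.2 by ring] at this
      exact_mod_cast this
    · refine hmax e le_rfl h (hk e he fun P hP P' hP' => ?_)
      obtain ⟨z, hz, rfl⟩ := Finset.mem_image.1 hP
      obtain ⟨z', hz', rfl⟩ := Finset.mem_image.1 hP'
      exact_mod_cast dvd_sub (hTm z hz).2.2.1 (hTm z' hz').2.2.1
  have hTI : T.card ≤ 2 * D * I.card := by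
    refine Finset.card_le_mul_card_image T (2 * D) fun P hP => ?_
    obtain ⟨z, hz, rfl⟩ := Finset.mem_image.1 hP
    obtain ⟨h1, h2, -⟩ := hTm z hz
    refine (card_factorizations_le h2 fun z' hz' => (Finset.mem_filter.1 hz').2).trans ?_
    refine Nat.mul_le_mul_left _ (hD _ (Int.natAbs_pos.2 h2) ?_)
    rw [Int.abs_eq_natAbs] at h1
    exact_mod_cast h1.le
  calc e * f * T.card ≤ e * f * (2 * D * I.card) := Nat.mul_le_mul_left _ hTI
    _ = 2 * D * (e * f * I.card) := by ring
    _ ≤ _ := Nat.mul_le_mul_left _ hIc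

/-! ### Pairs with a common coordinate or a given difference -/

theorem IsPoint.coprime_right {N m : ℕ} {q : ℕ × ℕ} (h : IsPoint N m q) (hN : N.Coprime m) :
    q.2.Coprime m := by
  have h1 : (q.1 * q.2).Coprime m := by
    rw [Nat.Coprime, h.2.2.2.gcd_eq]
    exact hN
  exact Nat.Coprime.coprime_mul_left h1

theorem eq_of_modEq_of_div_eq {m y y' : ℕ} (h : y ≡ y' [MOD m]) (h' : y / m = y' / m) :
    y = y' := by
  rw [← Nat.div_add_mod y m, ← Nat.div_add_mod y' m, h, h']

theorem IsPoint.div_lt {N m : ℕ} {q : ℕ × ℕ} (h : IsPoint N m q) : q.1 / m < 2 ∧ q.2 / m < 2 :=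
  ⟨Nat.div_lt_of_lt_mul (by rw [mul_comm]; exact h.1),
    Nat.div_lt_of_lt_mul (by rw [mul_comm]; exact h.2.1)⟩

theorem IsPoint.snd_eq {N m : ℕ} {q q' : ℕ × ℕ} (h : IsPoint N m q) (h' : IsPoint N m q')
    (h1 : q.1 = q'.1) (h2 : q.2 / m = q'.2 / m) : q.2 = q'.2 := by
  refine eq_of_modEq_of_div_eq ?_ h2
  refine Nat.ModEq.cancel_left_of_coprime (c := q.1) (by rw [Nat.gcd_comm]; exact h.2.2.1) ?_
  have := h'.2.2.2
  rw [← h1] at this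
  exact h.2.2.2.trans this.symm

theorem IsPoint.fst_eq {N m : ℕ} {q q' : ℕ × ℕ} (hN : N.Coprime m) (h : IsPoint N m q)
    (h' : IsPoint N m q') (h1 : q.2 = q'.2) (h2 : q.1 / m = q'.1 / m) : q.1 = q'.1 := by
  refine eq_of_modEq_of_div_eq ?_ h2
  refine Nat.ModEq.cancel_right_of_coprime (c := q.2)
    (by rw [Nat.gcd_comm]; exact h.coprime_right hN) ?_
  have := h'.2.2.2
  rw [← h1] at this
  exact h.2.2.2.trans this.symm

/-- The common first coordinate determines both second ones modulo `m`, and each of these has two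
lifts to `[0, 2m)`. -/
theorem card_same_fst_le (N m w h : ℕ) :
    ((closePairs N m w h).filter fun z => z.1.1 = z.2.1).card ≤ 8 * m := by
  have : (Finset.range (2 * m) ×ˢ Finset.range 2 ×ˢ Finset.range 2).card = 8 * m := by
    simp only [Finset.card_product, Finset.card_range]; ring
  rw [← this]
  refine Finset.card_le_card_of_injOn (fun z => (z.1.1, z.1.2 / m, z.2.2 / m)) (fun z hz => ?_) ?_
  · simp only [closePairs, Finset.coe_filter, Finset.mem_filter, Finset.mem_product, mem_points,
      Set.mem_ofPred_eq] at hz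
    simp only [Finset.coe_product, Set.mem_prod, Finset.mem_coe, Finset.mem_range]
    exact ⟨hz.1.1.1.1, hz.1.1.1.div_lt.2, hz.1.1.2.div_lt.2⟩
  · intro z hz z' hz' he
    simp only [closePairs, Finset.coe_filter, Finset.mem_filter, Finset.mem_product, mem_points,
      Set.mem_ofPred_eq] at hz hz'
    simp only [Prod.mk.injEq] at he
    have h1 := hz.1.1.1.snd_eq hz'.1.1.1 he.1 he.2.1
    have h2 : z.2.1 = z'.2.1 := hz.2 ▸ hz'.2 ▸ he.1
    have h3 := hz.1.1.2.snd_eq hz'.1.1.2 h2 he.2.2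
    exact Prod.ext (Prod.ext he.1 h1) (Prod.ext h2 h3)

theorem card_same_snd_le {N m : ℕ} (hN : N.Coprime m) (w h : ℕ) :
    ((closePairs N m w h).filter fun z => z.1.2 = z.2.2).card ≤ 8 * m := by
  have : (Finset.range (2 * m) ×ˢ Finset.range 2 ×ˢ Finset.range 2).card = 8 * m := by
    simp only [Finset.card_product, Finset.card_range]; ring
  rw [← this]
  refine Finset.card_le_card_of_injOn (fun z => (z.1.2, z.1.1 / m, z.2.1 / m)) (fun z hz => ?_) ?_
  · simp only [closePairs, Finset.coe_filter, Finset.mem_filter, Finset.mem_product, mem_points,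
      Set.mem_ofPred_eq] at hz
    simp only [Finset.coe_product, Set.mem_prod, Finset.mem_coe, Finset.mem_range]
    exact ⟨hz.1.1.1.2.1, hz.1.1.1.div_lt.1, hz.1.1.2.div_lt.1⟩
  · intro z hz z' hz' he
    simp only [closePairs, Finset.coe_filter, Finset.mem_filter, Finset.mem_product, mem_points,
      Set.mem_ofPred_eq] at hz hz'
    simp only [Prod.mk.injEq] at he
    have h1 := IsPoint.fst_eq hN hz.1.1.1 hz'.1.1.1 he.1 he.2.1
    have h2 : z.2.2 = z'.2.2 := hz.2 ▸ hz'.2 ▸ he.1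
    have h3 := IsPoint.fst_eq hN hz.1.1.2 hz'.1.1.2 h2 he.2.2
    exact Prod.ext (Prod.ext h1 he.1) (Prod.ext h3 h2)

/-- The difference of a pair of points. -/
def diff (z : (ℕ × ℕ) × (ℕ × ℕ)) : ℤ × ℤ := ((z.2.1 : ℤ) - z.1.1, (z.2.2 : ℤ) - z.1.2)

/-- Once the difference is fixed, the first point determines the pair; its second coordinate is
known from the first up to a translation by `m`, whence the factor 2. -/
theorem card_diff_fiber_le (N m w h : ℕ) (u : ℤ × ℤ) :
    ((closePairs N m w h).filter fun z => diff z = u).card ≤ 2 * (quadSols N m u.1 u.2).card := by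
  have : (quadSols N m u.1 u.2 ×ˢ Finset.range 2).card = 2 * (quadSols N m u.1 u.2).card := by
    rw [Finset.card_product, Finset.card_range, mul_comm]
  rw [← this]
  refine Finset.card_le_card_of_injOn (fun z => (z.1.1, z.1.2 / m)) (fun z hz => ?_) ?_
  · simp only [closePairs, Finset.coe_filter, Finset.mem_filter, Finset.mem_product, mem_points,
      Set.mem_ofPred_eq] at hz
    obtain ⟨⟨⟨h1, h2⟩, -⟩, rfl⟩ := hz
    simp only [Finset.coe_product, Set.mem_prod, Finset.mem_coe, Finset.mem_range, mem_quadSols,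
      diff]
    refine ⟨⟨h1.1, h1.2.2.1, ?_⟩, h1.div_lt.2⟩
    have e1 := Nat.modEq_iff_dvd.1 h1.2.2.2
    have e2 := Nat.modEq_iff_dvd.1 h2.2.2.2
    push_cast at e1 e2
    -- Subtracting the congruences gives `t x + s y + s t ≡ 0`; multiplying by `x` and replacing `x
    -- y` by `N` eliminates `y`.
    have e3 := dvd_add (e1.mul_left ((z.2.1 : ℤ) - z.1.1))
      ((dvd_sub e1 e2).mul_left (z.1.1 : ℤ))
    refine Eq.subst (motive := fun r => (m : ℤ) ∣ r) ?_ e3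
    ring
  · intro z hz z' hz' he
    simp only [closePairs, Finset.coe_filter, Finset.mem_filter, Finset.mem_product, mem_points,
      Set.mem_ofPred_eq] at hz hz'
    simp only [Prod.mk.injEq] at he
    have h1 := hz.1.1.1.snd_eq hz'.1.1.1 he.1 he.2
    have h2 : diff z = diff z' := hz.2.trans hz'.2.symm
    simp only [diff, Prod.mk.injEq] at h2
    exact Prod.ext (Prod.ext he.1 h1) (Prod.ext (by omega) (by omega))

/-- Pairs with a common coordinate number at most `16 m`. For the others the sum over `(s, t)` is
taken inside those over `e` and `d`. The three factors `D` stand for the choices of `e`, of `d`, and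
of the factorization of `s t`. -/
theorem card_closePairs_le {N m w h D : ℕ} (hm : 0 < m) (hN : N.Coprime m)
    (hD : ∀ n, 0 < n → n ≤ max m (w * h) → n.divisors.card ≤ D) :
    (closePairs N m w h).card ≤ 28 * D ^ 3 * (m + w * h) := by
  classical
  have hcop : ∀ e ∈ m.divisors, 0 < e ∧ 0 < m / e ∧ m / e ≤ m := by
    intro e he
    obtain ⟨hem, -⟩ := Nat.mem_divisors.1 he
    have he0 := Nat.pos_of_dvd_of_pos hem hm
    exact ⟨he0, Nat.div_pos (Nat.le_of_dvd hm hem) he0, Nat.div_le_self _ _⟩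
  set Z := closePairs N m w h with hZ
  set Z₁ := Z.filter fun z => diff z ∈ offsets w h with hZ₁
  have hsplit : Z.card ≤ (Z.filter fun z => z.1.1 = z.2.1).card +
      (Z.filter fun z => z.1.2 = z.2.2).card + Z₁.card := by
    refine le_trans (Finset.card_le_card (fun z hz => ?_))
      ((Finset.card_union_le _ _).trans (Nat.add_le_add_right (Finset.card_union_le _ _) _))
    simp only [Finset.mem_union, Finset.mem_filter, hZ₁, hz, true_and, offsets,
      Finset.mem_product, Finset.mem_Ioo, diff]
    have := hz
    simp only [hZ, closePairs, Finset.mem_filter, abs_lt] at this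
    omega
  have h1 : Z₁.card ≤ 12 * D ^ 3 * (2 * (w * h) + m) := by
    have hmaps : ∀ z ∈ Z₁, diff z ∈ offsets w h := fun z hz => (Finset.mem_filter.1 hz).2
    rw [Finset.card_eq_sum_card_fiberwise hmaps]
    have hfib : ∀ u ∈ offsets w h, (Z₁.filter fun z => diff z = u).card ≤
        ∑ e ∈ m.divisors, ∑ d ∈ (m / e).divisors,
          if (e : ℤ) ∣ u.1 ∧ (e : ℤ) ∣ u.2 ∧
            ((cogcd (m / e) d : ℕ) : ℤ) ^ 2 ∣ u.1 * u.2 - 4 * N then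
          6 * (e * cogcd (m / e) d) else 0 := by
      intro u _
      have h2 := (Finset.card_le_card (Finset.filter_subset_filter (fun z => diff z = u)
        (Finset.filter_subset (fun z => diff z ∈ offsets w h) Z))).trans
        (card_diff_fiber_le N m w h u)
      refine h2.trans ((Nat.mul_le_mul_left 2 (card_quadSols_le hm hN u.1 u.2)).trans
        (le_of_eq ?_))
      simp only [Finset.mul_sum, mul_ite, mul_zero]
      refine Finset.sum_congr rfl fun e _ => Finset.sum_congr rfl fun d _ => ?_
      congr 1
      ring
    refine (Finset.sum_le_sum hfib).trans ?_
    rw [Finset.sum_comm]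
    calc _ ≤ ∑ e ∈ m.divisors, D * (12 * D * (2 * (w * h) + m)) := by
          refine Finset.sum_le_sum fun e he => ?_
          obtain ⟨he0, hme0, hme⟩ := hcop e he
          rw [Finset.sum_comm]
          calc _ ≤ ∑ d ∈ (m / e).divisors, 12 * D * (2 * (w * h) + m) := by
                refine Finset.sum_le_sum fun d hd => ?_
                rw [← Finset.sum_filter, Finset.sum_const, smul_eq_mul]
                have hd0 := Nat.pos_of_mem_divisors hd
                have hf0 : 0 < cogcd (m / e) d := Nat.gcd_pos_of_pos_left _ hd0
                have hfm : e * cogcd (m / e) d ≤ m := by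
                  have : cogcd (m / e) d ≤ m / e := (Nat.le_of_dvd hd0
                    (Nat.gcd_dvd_left _ _)).trans (Nat.divisor_le hd)
                  exact (Nat.mul_le_mul_left e this).trans (Nat.mul_div_le m e)
                have := card_offsets_le (w := w) (h := h) (c := 4 * N) he0 hf0 hfm
                  fun n hn hn' => hD n hn (hn'.trans (le_max_right _ _))
                calc _ = 6 * (e * cogcd (m / e) d * _) := by rw [mul_comm, mul_assoc]
                  _ ≤ _ := Nat.mul_le_mul_left 6 this
                  _ = _ := by ring
            _ = (m / e).divisors.card * (12 * D * (2 * (w * h) + m)) := by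
                rw [Finset.sum_const, smul_eq_mul]
            _ ≤ _ := Nat.mul_le_mul_right _ (hD _ hme0 (hme.trans (le_max_left _ _)))
      _ = m.divisors.card * (D * (12 * D * (2 * (w * h) + m))) := by
          rw [Finset.sum_const, smul_eq_mul]
      _ ≤ D * (D * (12 * D * (2 * (w * h) + m))) :=
          Nat.mul_le_mul_right _ (hD m hm (le_max_left _ _))
      _ = _ := by ring
  have h2 : (Z.filter fun z => z.1.1 = z.2.1).card ≤ 8 * m := card_same_fst_le N m w h
  have h3 : (Z.filter fun z => z.1.2 = z.2.2).card ≤ 8 * m := card_same_snd_le hN w h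
  have hD1 : 1 ≤ D := by
    refine le_trans ?_ (hD 1 one_pos (le_max_of_le_left hm))
    simp
  have hD3 : 1 ≤ D ^ 3 := Nat.one_le_pow _ _ hD1
  have h4 : 16 * m ≤ 16 * (D ^ 3 * m) := Nat.mul_le_mul_left _ (Nat.le_mul_of_pos_left _ hD3)
  calc Z.card ≤ 8 * m + 8 * m + 12 * D ^ 3 * (2 * (w * h) + m) := by omega
    _ ≤ _ := by nlinarith [Nat.zero_le (D ^ 3 * (w * h))]

/-! ### Successful searches -/

/-! ### The divisor bound -/

/-- By multiplicativity it is enough to compare `k + 1` with `p ^ (k ε)`. For `p ≥ 2 ^ (1 / ε)` one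
has `k + 1 ≤ 2 ^ k ≤ p ^ (k ε)`; for the finitely many smaller primes Bernoulli's inequality costs a
factor `c` each, hence the constant `c ^ M`. -/
theorem exists_card_divisors_le {ε : ℝ} (hε : 0 < ε) :
    ∃ C : ℝ, 0 ≤ C ∧ ∀ n : ℕ, 0 < n → (n.divisors.card : ℝ) ≤ C * (n : ℝ) ^ ε := by
  have hlog : 0 < Real.log 2 := Real.log_pos (by norm_num)
  set c : ℝ := max 1 (1 / (ε * Real.log 2)) with hc
  have hc1 : 1 ≤ c := le_max_left _ _
  obtain ⟨M, hM⟩ := exists_nat_ge ((2 : ℝ) ^ (1 / ε))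
  set b : ℕ → ℝ := fun p => if p < M then c else 1 with hb
  have hb1 : ∀ p, 1 ≤ b p := fun p => by simp only [hb]; split_ifs; exacts [hc1, le_rfl]
  have hfactor : ∀ p k : ℕ, 2 ≤ p → ((k + 1 : ℕ) : ℝ) ≤ b p * ((p ^ k : ℕ) : ℝ) ^ ε := by
    intro p k hp
    have hp2 : (2 : ℝ) ≤ p := by exact_mod_cast hp
    have hp0 : (0 : ℝ) < p := by linarith
    have e1 : ((p ^ k : ℕ) : ℝ) ^ ε = ((p : ℝ) ^ ε) ^ k := by
      push_cast
      rw [← Real.rpow_natCast, ← Real.rpow_mul hp0.le, mul_comm, Real.rpow_mul hp0.le,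
        Real.rpow_natCast]
    rw [e1]
    simp only [hb]
    split_ifs with h
    · have h1 : (1 + ε * Real.log 2) ≤ (p : ℝ) ^ ε := by
        calc 1 + ε * Real.log 2 ≤ Real.exp (ε * Real.log 2) := by
              linarith [Real.add_one_le_exp (ε * Real.log 2)]
          _ = (2 : ℝ) ^ ε := by rw [Real.rpow_def_of_pos (by norm_num), mul_comm]
          _ ≤ _ := Real.rpow_le_rpow (by norm_num) hp2 hε.le
      have hel : 0 < ε * Real.log 2 := by positivity
      have h2 : 1 + k * (ε * Real.log 2) ≤ ((p : ℝ) ^ ε) ^ k :=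
        (one_add_mul_le_pow (by linarith) k).trans (pow_le_pow_left₀ (by linarith) h1 k)
      have h3 : 1 ≤ c * (ε * Real.log 2) := by
        have : 1 / (ε * Real.log 2) ≤ c := le_max_right _ _
        rwa [div_le_iff₀ hel] at this
      calc ((k + 1 : ℕ) : ℝ) = k * 1 + 1 := by push_cast; ring
        _ ≤ k * (c * (ε * Real.log 2)) + c := by gcongr
        _ = c * (1 + k * (ε * Real.log 2)) := by ring
        _ ≤ _ := by gcongr
    · have h1 : (2 : ℝ) ≤ (p : ℝ) ^ ε := by
        have hMp : (M : ℝ) ≤ p := by exact_mod_cast not_lt.1 h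
        calc (2 : ℝ) = ((2 : ℝ) ^ (1 / ε)) ^ ε := by
              rw [← Real.rpow_mul (by norm_num), one_div_mul_cancel hε.ne', Real.rpow_one]
          _ ≤ _ := Real.rpow_le_rpow (by positivity) (hM.trans hMp) hε.le
      rw [one_mul]
      calc ((k + 1 : ℕ) : ℝ) ≤ (2 : ℝ) ^ k := by exact_mod_cast Nat.lt_two_pow_self
        _ ≤ _ := pow_le_pow_left₀ (by norm_num) h1 k
  refine ⟨c ^ M, by positivity, fun n hn => ?_⟩
  have hprod : (n : ℝ) ^ ε = ∏ p ∈ n.primeFactors, ((p ^ n.factorization p : ℕ) : ℝ) ^ ε := by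
    rw [Real.finsetProd_rpow _ _ (fun _ _ => by positivity)]
    congr 1
    rw [← Nat.cast_prod]
    congr 1
    exact (Nat.prod_factorization_pow_eq_self hn.ne').symm
  have hbprod : ∏ p ∈ n.primeFactors, b p ≤ c ^ M := by
    rw [Finset.prod_ite, Finset.prod_const, Finset.prod_const_one, mul_one]
    refine pow_le_pow_right₀ hc1 ?_
    calc _ ≤ (Finset.range M).card := Finset.card_le_card fun p hp => by
          simpa using (Finset.mem_filter.1 hp).2
      _ = M := Finset.card_range M
  rw [Nat.card_divisors hn.ne', Nat.cast_prod, hprod]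
  calc ∏ p ∈ n.primeFactors, ((n.factorization p + 1 : ℕ) : ℝ)
      ≤ ∏ p ∈ n.primeFactors, (b p * ((p ^ n.factorization p : ℕ) : ℝ) ^ ε) :=
        Finset.prod_le_prod (fun _ _ => by positivity) fun p hp =>
          hfactor p _ (Nat.prime_of_mem_primeFactors hp).two_le
    _ = (∏ p ∈ n.primeFactors, b p) * ∏ p ∈ n.primeFactors,
        ((p ^ n.factorization p : ℕ) : ℝ) ^ ε := Finset.prod_mul_distrib
    _ ≤ _ := mul_le_mul_of_nonneg_right hbprod (Finset.prod_nonneg fun _ _ => by positivity)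

/-! ### Factorizations are found by the search -/

/-- The witnesses are the remainders `(U % a, V % a)` and the digit sums `(U % a + U / a, V % a + V
/ a)`: since `a ≡ 1` modulo `m`, the digit sum of `X` to base `a` is congruent to `X`. -/
theorem exists_hit {N U V a m w h : ℕ} (ham : a = m + 1) (hm2 : 2 ≤ m) (hN : N = U * V)
    (hNa : N.Coprime a) (hNm : N.Coprime m) (hU : 1 < U) (hV : 1 < V) (hUm : U / a ≤ m)
    (hVm : V / a ≤ m) (hUw : U / a ≤ w) (hVh : V / a ≤ h) :
    ∃ q₀ q₁ : ℕ × ℕ, q₀.1 < a ∧ q₀.2 < a ∧ q₀.1.Coprime a ∧ q₀.1 * q₀.2 ≡ N [MOD a] ∧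
      IsPoint N m q₁ ∧ q₀.1 ≤ q₁.1 ∧ q₁.1 ≤ q₀.1 + w ∧ q₀.2 ≤ q₁.2 ∧ q₁.2 ≤ q₀.2 + h ∧
      Hit N a q₀ q₁ := by
  have ha0 : 0 < a := by omega
  have hred : ∀ X : ℕ, X.Coprime m → X / a ≤ m →
      X % a + X / a < 2 * m ∧ X % a + X / a ≡ X [MOD m] := by
    intro X hX hXm
    have h1 := Nat.div_add_mod X a
    have h2 := Nat.mod_lt X ha0
    have h3 : X % a + X / a ≡ X [MOD m] := by
      nth_rewrite 3 [← h1]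
      rw [ham, add_mul, one_mul, add_assoc, add_comm (X / (m + 1))]
      simp [Nat.ModEq]
    -- Both digits are at most `m`. A digit sum equal to `2 m` would be divisible by `m`, although
    -- `X` is prime to `m ≥ 2`.
    refine ⟨lt_of_le_of_ne (by omega) fun h4 => ?_, h3⟩
    have h5 := h3.gcd_eq
    rw [h4, Nat.gcd_mul_left_left, hX] at h5
    omega
  have hUc : U.Coprime m := Nat.Coprime.coprime_mul_right (hN ▸ hNm)
  have hVc : V.Coprime m := Nat.Coprime.coprime_mul_left (hN ▸ hNm)
  obtain ⟨u1, u2⟩ := hred U hUc hUm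
  obtain ⟨v1, v2⟩ := hred V hVc hVm
  refine ⟨(U % a, V % a), (U % a + U / a, V % a + V / a), Nat.mod_lt _ ha0, Nat.mod_lt _ ha0,
    coprime_mod.2 (Nat.Coprime.coprime_mul_right (hN ▸ hNa)), ?_, ⟨u1, v1, ?_, ?_⟩, by simp,
    by simpa using hUw, by simp, by simpa using hVh, ?_⟩
  · rw [hN]
    exact (Nat.mod_modEq _ _).mul (Nat.mod_modEq _ _)
  · rw [Nat.Coprime, u2.gcd_eq]
    exact hUc
  · rw [hN]
    exact u2.mul v2
  · have hU' : U / a * a + U % a = U := by rw [mul_comm]; exact Nat.div_add_mod U a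
    have hV' : V / a * a + V % a = V := by rw [mul_comm]; exact Nat.div_add_mod V a
    simp only [Hit, Nat.add_sub_cancel_left, hU', hV']
    exact ⟨hN.symm, hU, hV⟩

theorem cells_le {a w h : ℕ} (hw : 0 < w) (hh : 0 < h) (hwh : a ≤ w * h) :
    (2 * a / w + 2) * (2 * a / h + 2) ≤ 12 * a + 4 := by
  have h1 := Nat.div_mul_le_self (2 * a) w
  have h2 := Nat.div_mul_le_self (2 * a) h
  have h3 := Nat.div_le_self (2 * a) w
  have h4 := Nat.div_le_self (2 * a) h
  have h5 : 2 * a / w * (2 * a / h) ≤ 4 * a := by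
    have h6 := Nat.mul_le_mul h1 h2
    refine Nat.le_of_mul_le_mul_right ?_ (Nat.mul_pos hw hh)
    calc 2 * a / w * (2 * a / h) * (w * h) = 2 * a / w * w * (2 * a / h * h) := by ring
      _ ≤ 2 * a * (2 * a) := h6
      _ = 4 * a * a := by ring
      _ ≤ 4 * a * (w * h) := Nat.mul_le_mul_left _ hwh
  nlinarith

section

variable {L : ℕ} {σ : State}

/-- The area condition `a ≤ w h ≤ 4 a` balances the number of cells against the number of close
pairs: both are then linear in `a`, up to divisor bounds. -/
theorem wp_search_of_factors (hL : 1 ≤ L) (hσ : Bdd L σ) {N U V a w h m D : ℕ} (hm2 : 2 ≤ m)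
    (ham : a = m + 1) (hw0 : 0 < w) (hh0 : 0 < h) (hN : σ.reg .N = N) (ha : σ.reg .a = a)
    (hw : σ.reg .w = w) (hh : σ.reg .h = h) (haL : 16 * (a + 2) ^ 2 ≤ 2 ^ L)
    (hNUV : N = U * V) (hNa : N.Coprime a) (hNm : N.Coprime m) (hU : 1 < U) (hV : 1 < V)
    (hUm : U / a ≤ m) (hVm : V / a ≤ m) (hwh : a ≤ w * h) (hwh' : w * h ≤ 4 * a)
    (hD : ∀ n, 0 < n → n ≤ 4 * a → n.divisors.card ≤ D) :
    wp L search σ fun n τ => n ≤ 17000 * (D ^ 3 * a) ∧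
      Sound N (U / a ≤ w ∧ V / a ≤ h) σ τ := by
  refine (wp_search hL hσ hm2 ham hw0 hh0 hN ha hw hh haL).mono ?_
  rintro n τ - - ⟨hn, hS⟩
  refine ⟨?_, hS.good, hS.keep, fun hH => hS.found
    (exists_hit ham hm2 hNUV hNa hNm hU hV hUm hVm hH.1 hH.2)⟩
  have hR := cells_le hw0 hh0 hwh
  have hE₀ := card_closePairs_le (m := a) (w := w) (h := h) (D := D) (by omega) hNa
    fun n hn hn' => hD n hn (hn'.trans (max_le (by omega) hwh'))
  have hE₁ := card_closePairs_le (m := m) (w := w) (h := h) (D := D) (by omega) hNm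
    fun n hn hn' => hD n hn (hn'.trans (max_le (by omega) hwh'))
  have hD1 : 1 ≤ D := by
    refine le_trans ?_ (hD 1 one_pos (by omega))
    simp
  have hD3 : a ≤ D ^ 3 * a := Nat.le_mul_of_pos_left _ (Nat.one_le_pow _ _ hD1)
  have hX : ∀ x ≤ a, 28 * D ^ 3 * (x + w * h) ≤ 140 * (D ^ 3 * a) := fun x hx => by
    calc 28 * D ^ 3 * (x + w * h) ≤ 28 * D ^ 3 * (5 * a) := Nat.mul_le_mul_left _ (by omega)
      _ = _ := by ring
  have hX₀ := hX a le_rfl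
  have hX₁ := hX m (by omega)
  omega

end

/-! ### Balanced factors and trial division -/

/-! ### The two algorithms -/

section

variable {L : ℕ} {σ : State}

theorem coprime_of_gcd_le_one {N m : ℕ} (hm : 0 < m) (h : ¬ 1 < N.gcd m) : N.Coprime m := by
  have := Nat.gcd_pos_of_pos_right N hm
  unfold Nat.Coprime
  omega

theorem valid_of_dvd {N g : ℕ} {τ : State} (hg : 1 < g) (hgN : g < N) (hd : g ∣ N)
    (hU : τ.reg .outU = g) (hV : τ.reg .outV = N / g) : Valid N τ := by
  rw [Valid, hU, hV]
  obtain ⟨k, rfl⟩ := hd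
  rw [Nat.mul_div_cancel_left _ (by omega)]
  refine ⟨hg, ?_, rfl⟩
  by_contra h
  have := Nat.mul_le_mul_left g (not_lt.1 h)
  omega

/-- The search of the balanced algorithm. -/
def squareSearch : Cmd := ceilSqrt ;; Reg.w ⟵ §Reg.b ;; Reg.h ⟵ §Reg.b ;; search

/-- From `V² < 2 U V = 2 N ≤ a³` follows `(V / a)² < a`, so both quotients are at most the side of
the squares. -/
theorem wp_squareSearch (hL : 1 ≤ L) (hσ : Bdd L σ) {N U V a m D : ℕ} (hm2 : 2 ≤ m)
    (ham : a = m + 1) (hN : σ.reg .N = N) (ha : σ.reg .a = a) (haL : 16 * (a + 2) ^ 2 ≤ 2 ^ L)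
    (hU : 1 < U) (hUV : U ≤ V) (hVU : V < 2 * U) (hNUV : N = U * V) (ha1 : 2 * N ≤ a ^ 3)
    (hNa : N.Coprime a) (hNm : N.Coprime m)
    (hD : ∀ n, 0 < n → n ≤ 4 * a → n.divisors.card ≤ D) :
    wp L squareSearch σ fun n τ => Valid N τ ∧ n ≤ 17100 * (D ^ 3 * a) := by
  refine wp_seq ((wp_ceilSqrt hL hσ).mono ?_)
  rintro n₄ τ₄ hτ₄ hF₄ ⟨hn₄, hb1, hb2⟩
  have hN₄ : τ₄.reg .N = N := (hF₄.reg .N rfl).trans hN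
  have ha₄ : τ₄.reg .a = a := (hF₄.reg .a rfl).trans ha
  obtain ⟨b, hb⟩ : ∃ b, τ₄.reg .b = b := ⟨_, rfl⟩
  rw [hb] at hn₄ hb1 hb2
  rw [ha] at hb1 hb2
  have hb0 : 0 < b := by
    rcases Nat.eq_zero_or_pos b with rfl | h
    · omega
    · exact h
  have hba : (b - 1) ^ 2 < a := hb2 _ (by omega)
  obtain ⟨c, rfl⟩ : ∃ c, b = c + 1 := ⟨b - 1, by omega⟩
  rw [Nat.add_one_sub_one] at hba
  have hca : c < a := lt_of_le_of_lt (Nat.le_self_pow (by norm_num) c) hba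
  have hb4 : (c + 1) * (c + 1) ≤ 4 * a := by nlinarith
  refine wp_seq (wp_assign hL hτ₄ (hτ₄.reg .b) fun hτ₅ => ?_)
  refine wp_seq (wp_assign hL hτ₅ (hτ₅.reg .b) fun hτ₆ => ?_)
  simp only [Expr.eval_reg, State.setReg_reg, reduceCtorEq, if_false, hb] at hτ₆ ⊢
  have hVa : (V / a) ^ 2 < a := by
    have g1 : V / a * a ≤ V := Nat.div_mul_le_self V a
    have g2 : V * V < 2 * N := by rw [hNUV]; nlinarith
    by_contra g3
    rw [not_lt] at g3
    have g4 : a ^ 3 ≤ (V / a * a) * (V / a * a) := by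
      calc a ^ 3 = a * (a * a) := by ring
        _ ≤ (V / a) ^ 2 * (a * a) := Nat.mul_le_mul_right _ g3
        _ = _ := by ring
    have g5 := Nat.mul_le_mul g1 g1
    omega
  have hVb : V / a ≤ c + 1 := by
    by_contra g
    have : (c + 1) ^ 2 ≤ (V / a) ^ 2 := Nat.pow_le_pow_left (by omega) 2
    omega
  have hVm : V / a ≤ m := by
    by_contra g
    have : a ^ 2 ≤ (V / a) ^ 2 := Nat.pow_le_pow_left (by omega) 2
    nlinarith
  have hUV' : U / a ≤ V / a := Nat.div_le_div_right hUV
  refine (wp_search_of_factors hL hτ₆ (w := c + 1) (h := c + 1) (D := D) hm2 ham (by omega)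
    (by omega) (by simpa using hN₄) (by simpa using ha₄) (by simp) (by simp) haL hNUV hNa hNm hU
    (by omega) (hUV'.trans hVm) hVm (by nlinarith) hb4
    hD).mono ?_
  rintro n₇ τ₇ - - ⟨hn₇, hS⟩
  have hD1 : 1 ≤ D := by
    refine le_trans ?_ (hD 1 one_pos (by omega))
    simp
  have hD3 : a ≤ D ^ 3 * a := Nat.le_mul_of_pos_left _ (Nat.one_le_pow _ _ hD1)
  exact ⟨hS.found ⟨hUV'.trans hVb, hVb⟩, by omega⟩

theorem wp_balanced (hL : 1 ≤ L) (hσ : Bdd L σ) {N U V D : ℕ} (hN : σ.reg .N = N)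
    (hout : σ.reg .outU = 0) (hU : 1 < U) (hUV : U ≤ V) (hVU : V < 2 * U) (hNUV : N = U * V)
    (hNL : 16 * (N + 2) ^ 2 ≤ 2 ^ L) (hD : ∀ n, 0 < n → n ≤ 4 * N → n.divisors.card ≤ D) :
    wp L balanced σ fun n τ => Valid N τ ∧
      ∃ a, 1 ≤ a ∧ (a - 1) ^ 3 < 2 * N ∧ n ≤ 18000 * (D ^ 3 * a) := by
  have hN4 : 4 ≤ N := by nlinarith
  have hD1 : 1 ≤ D := by
    refine le_trans ?_ (hD 1 one_pos (by omega))
    simp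
  have hNL' : 2 * N < 2 ^ L := by nlinarith
  unfold balanced
  refine wp_seq ((wp_ceilCubeRoot hL hσ (v := 2 * N) hNL' ?_ (Nat.le_of_ble_eq_true rfl)).mono ?_)
  · intro τ hF
    simp [hF.reg .N rfl, hN]
  rintro n₁ τ₁ hτ₁ hF₁ ⟨hn₁, ha1, ha2⟩
  have hN₁ : τ₁.reg .N = N := (hF₁.reg .N rfl).trans hN
  have hout₁ : τ₁.reg .outU = 0 := (hF₁.reg .outU rfl).trans hout
  obtain ⟨a, ha⟩ : ∃ a, τ₁.reg .a = a := ⟨_, rfl⟩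
  rw [ha] at hn₁ ha1 ha2
  have ha2' : 2 ≤ a := by
    by_contra h
    have : a ^ 3 ≤ 1 ^ 3 := Nat.pow_le_pow_left (by omega) 3
    omega
  obtain ⟨m, ham⟩ : ∃ m, a = m + 1 := ⟨a - 1, by omega⟩
  have hm3 := ha2 m (by omega)
  -- Guarantees that a greatest common divisor of `N` with `a` or `a - 1` that exceeds 1 is a proper
  -- divisor.
  have haN : a < N := by
    by_contra h
    have : (N - 1) ^ 3 ≤ m ^ 3 := Nat.pow_le_pow_left (by omega) 3
    have h9 : (N - 1) * 9 ≤ (N - 1) ^ 3 := by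
      rw [pow_succ' _ 2, sq]
      exact Nat.mul_le_mul_left _ (Nat.mul_le_mul (by omega : 3 ≤ _) (by omega : 3 ≤ _))
    omega
  have haL : 16 * (a + 2) ^ 2 ≤ 2 ^ L := le_trans (by gcongr) hNL
  have hD3 : a ≤ D ^ 3 * a := Nat.le_mul_of_pos_left _ (Nat.one_le_pow _ _ hD1)
  have hgood : ∀ v ≤ a, 0 < v → 1 < N.gcd v → N.gcd v < N ∧ N.gcd v ∣ N := fun v hv hv0 _ =>
    ⟨(Nat.gcd_le_right _ hv0).trans_lt (by omega), Nat.gcd_dvd_left _ _⟩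
  refine wp_seq ((wp_gcdTest hL hτ₁ (e := §Reg.a) (v := a) (by have := hτ₁.reg .a; omega)
    (by simp [ha]) (Nat.le_of_ble_eq_true rfl)).mono ?_)
  rintro n₂ τ₂ hτ₂ hF₂ ⟨hn₂, hU₂, hV₂⟩
  rw [hN₁] at hU₂ hV₂
  have hN₂ : τ₂.reg .N = N := (hF₂.reg .N rfl).trans hN₁
  have ha₂ : τ₂.reg .a = a := (hF₂.reg .a rfl).trans ha
  refine wp_seq ((wp_gcdTest hL hτ₂ (e := §Reg.a - 1) (v := m) (by have := hτ₂.reg .a; omega)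
    (by simp [ha₂, ham]) (Nat.le_of_ble_eq_true rfl)).mono ?_)
  rintro n₃ τ₃ hτ₃ hF₃ ⟨hn₃, hU₃, hV₃⟩
  rw [hN₂] at hU₃ hV₃
  have hN₃ : τ₃.reg .N = N := (hF₃.reg .N rfl).trans hN₂
  have ha₃ : τ₃.reg .a = a := (hF₃.reg .a rfl).trans ha₂
  have hval : τ₃.reg .outU ≠ 0 → Valid N τ₃ := by
    intro h
    by_cases h1 : 1 < N.gcd m
    · rw [if_pos h1] at hU₃ hV₃
      obtain ⟨g1, g2⟩ := hgood m (by omega) (by omega) h1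
      exact valid_of_dvd h1 g1 g2 hU₃ hV₃
    · rw [if_neg h1] at hU₃ hV₃
      by_cases h2 : 1 < N.gcd a
      · rw [if_pos h2] at hU₂ hV₂
        obtain ⟨g1, g2⟩ := hgood a le_rfl (by omega) h2
        exact valid_of_dvd h2 g1 g2 (hU₃.trans hU₂) (hV₃.trans hV₂)
      · rw [if_neg h2] at hU₂
        exact absurd (hU₃.trans (hU₂.trans hout₁)) h
  refine wp_branch hL hτ₃ (fun h0 => ?_) (fun h0 => ?_)
  swap
  · simp only [Test.holds_eq, Expr.eval_reg, Expr.eval_ofNat] at h0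
    refine wp_skip hL hτ₃ ⟨hval h0, a, by omega, ?_, by omega⟩
    rwa [ham, Nat.add_one_sub_one]
  simp only [Test.holds_eq, Expr.eval_reg, Expr.eval_ofNat] at h0
  have h1 : ¬ 1 < N.gcd m := by
    intro h1
    rw [if_pos h1] at hU₃
    omega
  rw [if_neg h1] at hU₃
  have h2 : ¬ 1 < N.gcd a := by
    intro h2
    rw [if_pos h2] at hU₂
    omega
  have hNa := coprime_of_gcd_le_one (by omega) h2
  have hNm := coprime_of_gcd_le_one (by omega) h1
  -- The only exception would be `a = 2`, that is `N = 4`, which the first greatest common divisor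
  -- factors.
  have hm2 : 2 ≤ m := by
    by_contra h
    obtain rfl : a = 2 := by omega
    have : N = 4 := by omega
    rw [this] at hNa
    exact absurd hNa (by decide)
  refine (wp_squareSearch hL hτ₃ hm2 ham hN₃ ha₃ haL hU hUV hVU hNUV ha1 hNa hNm
    fun n hn hn' => hD n hn (by omega)).mono ?_
  rintro n₇ τ₇ - - ⟨hv, hn₇⟩
  refine ⟨hv, a, by omega, ?_, by omega⟩
  rwa [ham, Nat.add_one_sub_one]

/-- The loop of trial divisions. -/
def trialLoop : Cmd :=
  .loop (.and (§Reg.d ≺ §Reg.a + 1) (§Reg.outU ≐ 0)) (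
    .branch (§Reg.N % §Reg.d ≐ 0) (Reg.outU ⟵ §Reg.d ;; Reg.outV ⟵ §Reg.N / §Reg.d) .skip ;;
    Reg.d ⟵ §Reg.d + 1)

theorem wp_trialLoop (hL : 1 ≤ L) (hσ : Bdd L σ) {N a : ℕ} (hN : σ.reg .N = N)
    (ha : σ.reg .a = a) (hd : σ.reg .d = 2) (hout : σ.reg .outU = 0) (haN : a < N) (ha1 : 1 ≤ a) :
    wp L trialLoop σ fun n τ => n ≤ 5 * a ∧ (τ.reg .outU = 0 ∨ Valid N τ) ∧
      (τ.reg .outU = 0 → ∀ d, 2 ≤ d → d ≤ a → ¬ d ∣ N) := by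
  refine wp_loop (fun n τ => n + 10 ≤ 5 * τ.reg .d ∧ τ.reg .d ≤ a + 1 ∧
    (τ.reg .outU = 0 ∨ Valid N τ) ∧ (τ.reg .outU = 0 → ∀ d, 2 ≤ d → d < τ.reg .d → ¬ d ∣ N))
    (fun τ => a + 1 - τ.reg .d) hL hσ ?_ ?_ ?_
  · refine ⟨by omega, by omega, Or.inl hout, fun _ d h1 h2 => by omega⟩
  · rintro n τ hτ hF ⟨h1, h2, h3, h4⟩ hP
    have hN' : τ.reg .N = N := (hF.reg .N rfl).trans hN
    have ha' : τ.reg .a = a := (hF.reg .a rfl).trans ha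
    have hNL := hτ.reg .N
    simp only [Test.holds_and, Test.holds_lt, Test.holds_eq, Expr.eval_add, Expr.eval_reg,
      Expr.eval_ofNat, ha'] at hP
    obtain ⟨d, hd⟩ : ∃ d, τ.reg .d = d := ⟨_, rfl⟩
    rw [hd] at h1 h2 h4 hP ⊢
    have h4 := h4 hP.2
    refine wp_seq (wp_branch hL hτ (fun hm => ?_) (fun hm => ?_))
    · simp only [Test.holds_eq, Expr.eval_mod, Expr.eval_reg, Expr.eval_ofNat, hN', hd] at hm
      refine wp_seq (wp_assign hL hτ (hτ.reg .d) fun hτ1 => ?_)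
      refine wp_assign hL hτ1 ((Nat.div_le_self _ _).trans_lt (hτ1.reg .N)) fun hτ2 => ?_
      refine wp_assign hL hτ2 (by simp [hd]; omega) fun hτ3 => ?_
      have hv : ∀ ρ : State, ρ.reg .outU = d → ρ.reg .outV = N / d → Valid N ρ := fun ρ e1 e2 =>
        valid_of_dvd (by omega) (by omega) (Nat.dvd_of_mod_eq_zero hm) e1 e2
      simp only [Expr.eval_add, Expr.eval_div, Expr.eval_reg, Expr.eval_ofNat, State.setReg_reg,
        reduceCtorEq, if_false, if_true, hd, hN']
      exact ⟨⟨by omega, by omega, Or.inr (hv _ (by simp) (by simp)), fun h => by omega⟩, by omega⟩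
    · simp only [Test.holds_eq, Expr.eval_mod, Expr.eval_reg, Expr.eval_ofNat, hN', hd] at hm
      refine wp_skip hL hτ (wp_assign hL hτ (by simp [hd]; omega) fun hτ1 => ?_)
      simp only [Expr.eval_add, Expr.eval_reg, Expr.eval_ofNat, State.setReg_reg,
        reduceCtorEq, if_false, if_true, hd]
      refine ⟨⟨by omega, by omega, Or.inl hP.2, fun _ d' h5 h6 h7 => ?_⟩, by omega⟩
      rcases Nat.lt_succ_iff_lt_or_eq.1 h6 with h8 | rfl
      · exact h4 d' h5 h8 h7
      · exact hm (Nat.mod_eq_zero_of_dvd h7)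
  · rintro n τ hτ hF ⟨h1, h2, h3, h4⟩ hP
    have ha' : τ.reg .a = a := (hF.reg .a rfl).trans ha
    simp only [Test.holds_and, Test.holds_lt, Test.holds_eq, Expr.eval_add, Expr.eval_reg,
      Expr.eval_ofNat, ha'] at hP
    refine ⟨by omega, h3, fun h d h5 h6 => h4 h d h5 (by omega)⟩

end

/-! ### The general case -/

section

variable {L : ℕ} {σ : State}

/-- The loop that searches with cells of growing width. -/
def widthLoop : Cmd :=
  .loop (§Reg.outU ≐ 0) (Reg.h ⟵ (2 * §Reg.a + §Reg.w - 1) / §Reg.w ;; search ;;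
    Reg.w ⟵ 2 * §Reg.w)

/-- By `u v ≤ a` the search succeeds at the latest for `w = 2 ^ J` with `u < 2 ^ J ≤ 2 u`. Until
then `w ≤ 2 u ≤ 2 a`, which keeps `w h ≤ 4 a`. Trial division has made `U ≥ a`, hence `u ≥ 1`. -/
theorem wp_widthLoop (hL : 1 ≤ L) (hσ : Bdd L σ) {N U V a m D : ℕ} (hm2 : 2 ≤ m)
    (ham : a = m + 1) (hN : σ.reg .N = N) (ha : σ.reg .a = a) (hw : σ.reg .w = 2)
    (hout : σ.reg .outU = 0) (haL : 16 * (a + 2) ^ 2 ≤ 2 ^ L)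
    (hU : a ≤ U) (hUV : U ≤ V) (hNUV : N = U * V) (hVm : V / a ≤ m) (haN : N ≤ a ^ 3)
    (hNa : N.Coprime a) (hNm : N.Coprime m)
    (hD : ∀ n, 0 < n → n ≤ 4 * a → n.divisors.card ≤ D) :
    wp L widthLoop σ fun n τ => Valid N τ ∧ n ≤ L * (17000 * (D ^ 3 * a) + 3) + 1 := by
  have ha0 : 0 < a := by omega
  obtain ⟨u, hu⟩ : ∃ u, U / a = u := ⟨_, rfl⟩
  obtain ⟨v, hv⟩ : ∃ v, V / a = v := ⟨_, rfl⟩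
  have hu1 : 1 ≤ u := hu ▸ (Nat.one_le_div_iff ha0).2 hU
  have huv : u ≤ v := hu ▸ hv ▸ Nat.div_le_div_right hUV
  have huva : u * v ≤ a := by
    have h1 : u * a ≤ U := hu ▸ Nat.div_mul_le_self U a
    have h2 : v * a ≤ V := hv ▸ Nat.div_mul_le_self V a
    have h3 := Nat.mul_le_mul h1 h2
    refine Nat.le_of_mul_le_mul_right ?_ (Nat.mul_pos ha0 ha0)
    calc u * v * (a * a) = u * a * (v * a) := by ring
      _ ≤ N := hNUV ▸ h3
      _ ≤ a ^ 3 := haN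
      _ = _ := by ring
  rw [hv] at hVm
  have hua : 2 * u ≤ 2 * a := by omega
  have haL' : 4 * a + 2 < 2 ^ L := by nlinarith
  set J := u.size with hJ
  have hJ2 : 2 ^ J ≤ 2 * u := by
    have h1 : 0 < J := Nat.size_pos.2 hu1
    obtain ⟨k, hk⟩ : ∃ k, J = k + 1 := ⟨J - 1, by omega⟩
    have h2 : 2 ^ k ≤ u := Nat.lt_size.1 (by omega)
    rw [hk, pow_succ]
    omega
  have huJ : u < 2 ^ J := Nat.lt_size_self u
  have hJL : J ≤ L := Nat.size_le.2 (by omega)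
  set K := 17000 * (D ^ 3 * a) with hK
  -- After `j` searches `w = 2 ^ (j + 1)`. An earlier search may happen to find another
  -- factorization, so failure is what implies `j < J`.
  refine wp_loop_of_bounded (fun n τ => (τ.reg .outU = 0 ∨ Valid N τ) ∧
    ∃ j ≤ J, τ.reg .w = 2 ^ (j + 1) ∧ n ≤ j * (K + 3) ∧ (¬ Valid N τ → j < J)) (J * (K + 3)) hL hσ
    ?_ ?_ ?_ ?_
  · refine ⟨Or.inl hout, 0, Nat.zero_le _, by simpa using hw, Nat.zero_le _, fun _ => ?_⟩
    exact Nat.size_pos.2 hu1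
  · rintro n τ ⟨-, j, hj, -, hn, -⟩
    exact hn.trans (Nat.mul_le_mul_right _ hj)
  · rintro n τ hτ hF ⟨hg, j, hj, hwj, hn, hjJ⟩ hP
    simp only [Test.holds_eq, Expr.eval_reg, Expr.eval_ofNat] at hP
    have hjJ := hjJ fun h => by have := h.1; omega
    have hN' : τ.reg .N = N := (hF.reg .N rfl).trans hN
    have ha' : τ.reg .a = a := (hF.reg .a rfl).trans ha
    obtain ⟨w, hww⟩ : ∃ w, τ.reg .w = w := ⟨_, rfl⟩
    rw [hww] at hwj
    have hw2 : w ≤ 2 * u := by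
      rw [hwj]
      exact (Nat.pow_le_pow_right (by norm_num) hjJ).trans hJ2
    have hw0 : 0 < w := by rw [hwj]; positivity
    obtain ⟨h, hh⟩ : ∃ h, (2 * a + w - 1) / w = h := ⟨_, rfl⟩
    have hh1 : w * h ≤ 2 * a + w - 1 := hh ▸ Nat.mul_div_le _ _
    have hh2 : 2 * a ≤ w * h := by
      have h1 := Nat.div_add_mod (2 * a + w - 1) w
      have h2 := Nat.mod_lt (2 * a + w - 1) hw0
      rw [hh] at h1
      omega
    have hh0 : 0 < h := by
      rcases Nat.eq_zero_or_pos h with rfl | h0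
      · omega
      · exact h0
    have hhL : h ≤ 4 * a := (hh ▸ Nat.div_le_self _ _ : h ≤ 2 * a + w - 1).trans (by omega)
    have e : Expr.eval τ ((2 * §Reg.a + §Reg.w - 1) / §Reg.w) = h := by
      simp [ha', hww, hh]
    refine wp_seq (wp_assign hL hτ (by rw [e]; omega) fun hτ1 => ?_)
    rw [e] at hτ1 ⊢
    refine wp_seq ((wp_search_of_factors hL hτ1 (U := U) (V := V) (w := w) (h := h) (D := D) hm2
      ham hw0 hh0 (by simpa using hN') (by simpa using ha') (by simpa using hww) (by simp) haL hNUV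
      hNa hNm (by omega) (by omega) (by omega) (by omega) (by omega) (by omega) hD).mono ?_)
    rintro n₁ ρ hρ hFρ ⟨hn₁, hS⟩
    have hwρ : ρ.reg .w = w := (hFρ.reg .w rfl).trans (by simpa using hww)
    have hS' := (Sound.of_eq (N := N) (σ := τ) (τ := τ.setReg .h h) (by simp) (by simp)).trans hS
      Or.inr
    refine wp_assign hL hρ (by simp [hwρ]; omega) fun hρ1 => ?_
    have hV' : ∀ x, Valid N (ρ.setReg .w x) ↔ Valid N ρ := fun x => by simp [Valid]
    have hO' : ∀ x, (ρ.setReg .w x).reg .outU = ρ.reg .outU := fun x => by simp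
    simp only [Expr.eval_mul, Expr.eval_reg, Expr.eval_ofNat, hwρ, hV', hO']
    refine ⟨hS'.good hg, j + 1, hjJ, by simp [hwj, pow_succ]; ring, ?_, fun hnv => ?_⟩
    · rw [add_mul, one_mul]
      omega
    · by_contra hjj
      have hJj : J = j + 1 := by omega
      have huw : u ≤ w := by rw [hwj, ← hJj]; exact huJ.le
      refine hnv (hS'.found ⟨hu ▸ huw, hv ▸ Nat.le_of_mul_le_mul_left ?_ hw0⟩)
      calc w * v ≤ 2 * u * v := Nat.mul_le_mul_right _ hw2
        _ = 2 * (u * v) := mul_assoc _ _ _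
        _ ≤ 2 * a := Nat.mul_le_mul_left _ huva
        _ ≤ w * h := hh2
  · rintro n τ hτ hF ⟨hg, j, hj, hwj, hn, hjJ⟩ hP
    simp only [Test.holds_eq, Expr.eval_reg, Expr.eval_ofNat] at hP
    refine ⟨hg.resolve_left hP, Nat.add_le_add_right (hn.trans ?_) 1⟩
    exact Nat.mul_le_mul_right _ (hj.trans hJL)

/-- If trial division fails, `N` is prime to every positive integer up to `a`, in particular to both
moduli, and both factors exceed `a`. The extra factor `L` bounds the number of widths tried. -/
theorem wp_general (hL : 1 ≤ L) (hσ : Bdd L σ) {N U V D : ℕ} (hN : σ.reg .N = N)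
    (hout : σ.reg .outU = 0) (hU : 1 < U) (hUV : U ≤ V) (hNUV : N = U * V)
    (hNL : 16 * (N + 2) ^ 2 ≤ 2 ^ L) (hD : ∀ n, 0 < n → n ≤ 4 * N → n.divisors.card ≤ D) :
    wp L general σ fun n τ => Valid N τ ∧
      ∃ a, 1 ≤ a ∧ (a - 1) ^ 3 < 2 * N ∧ n ≤ 18000 * (L * (D ^ 3 * a)) := by
  have hN4 : 4 ≤ N := by nlinarith
  have hD1 : 1 ≤ D := by
    refine le_trans ?_ (hD 1 one_pos (by omega))
    simp
  have hNL' : N < 2 ^ L := by nlinarith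
  unfold general
  refine wp_seq ((wp_ceilCubeRoot hL hσ (v := N) hNL' ?_ (Nat.le_of_ble_eq_true rfl)).mono ?_)
  · intro τ hF
    simp [hF.reg .N rfl, hN]
  rintro n₁ τ₁ hτ₁ hF₁ ⟨hn₁, ha1, ha2⟩
  have hN₁ : τ₁.reg .N = N := (hF₁.reg .N rfl).trans hN
  have hout₁ : τ₁.reg .outU = 0 := (hF₁.reg .outU rfl).trans hout
  obtain ⟨a, ha⟩ : ∃ a, τ₁.reg .a = a := ⟨_, rfl⟩
  rw [ha] at hn₁ ha1 ha2
  have ha2' : 2 ≤ a := by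
    by_contra h
    have : a ^ 3 ≤ 1 ^ 3 := Nat.pow_le_pow_left (by omega) 3
    omega
  obtain ⟨m, ham⟩ : ∃ m, a = m + 1 := ⟨a - 1, by omega⟩
  have hm3 := ha2 m (by omega)
  have haN : a < N := by
    by_contra h
    have : (N - 1) ^ 3 ≤ m ^ 3 := Nat.pow_le_pow_left (by omega) 3
    have h9 : (N - 1) * 9 ≤ (N - 1) ^ 3 := by
      rw [pow_succ' _ 2, sq]
      exact Nat.mul_le_mul_left _ (Nat.mul_le_mul (by omega : 3 ≤ _) (by omega : 3 ≤ _))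
    omega
  have haL : 16 * (a + 2) ^ 2 ≤ 2 ^ L := le_trans (by gcongr) hNL
  have hD3 : a ≤ D ^ 3 * a := Nat.le_mul_of_pos_left _ (Nat.one_le_pow _ _ hD1)
  have hLD : D ^ 3 * a ≤ L * (D ^ 3 * a) := Nat.le_mul_of_pos_left _ hL
  have hLL : L ≤ L * (D ^ 3 * a) := Nat.le_mul_of_pos_right _ (by omega)
  have ham3 : (a - 1) ^ 3 < 2 * N := by rw [ham, Nat.add_one_sub_one]; omega
  refine wp_seq (wp_assign hL hτ₁ (by simp; omega) fun hτ₂ => ?_)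
  refine wp_seq ((wp_trialLoop hL hτ₂ (N := N) (a := a) (by simpa using hN₁) (by simpa using ha)
    (by simp) (by simpa using hout₁) haN (by omega)).mono ?_)
  rintro n₃ τ₃ hτ₃ hF₃ ⟨hn₃, hg₃, hd₃⟩
  have hN₃ : τ₃.reg .N = N := (hF₃.reg .N rfl).trans (by simpa using hN₁)
  have ha₃ : τ₃.reg .a = a := (hF₃.reg .a rfl).trans (by simpa using ha)
  refine wp_seq (wp_assign hL hτ₃ (by simp; omega) fun hτ₄ => ?_)
  by_cases h0 : τ₃.reg .outU = 0
  swap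
  · have hv := hg₃.resolve_left h0
    -- After a successful trial division the loop is left at its first test.
    refine wp_loop_of_bounded (fun n τ => n = 0 ∧ τ.reg .outU ≠ 0 ∧ Valid N τ) 0 hL hτ₄
      ⟨rfl, by simpa using h0, by simpa [Valid] using hv⟩ (fun n τ h => h.1.le)
      (fun n τ _ _ h hP => absurd hP h.2.1) ?_
    rintro n τ - - ⟨rfl, -, hv⟩ -
    exact ⟨hv, a, by omega, ham3, by omega⟩
  have hnd := hd₃ h0
  have hndc : ∀ x, 0 < x → x ≤ a → N.Coprime x := by
    intro x hx hxa
    refine coprime_of_gcd_le_one hx fun h => hnd _ h ?_ (Nat.gcd_dvd_left _ _)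
    exact (Nat.gcd_le_right _ hx).trans hxa
  have haU : a < U := by
    by_contra h
    exact hnd U hU (by omega) (hNUV ▸ dvd_mul_right U V)
  have hm2 : 2 ≤ m := by
    by_contra h
    obtain rfl : a = 2 := by omega
    have : 3 * 3 ≤ U * V := Nat.mul_le_mul (by omega) (by omega)
    omega
  -- As `U > a` and `U V ≤ a³`, the cofactor `V` is less than `a²`.
  have hVm : V / a ≤ m := by
    rw [← Nat.lt_add_one_iff, ← ham, Nat.div_lt_iff_lt_mul (by omega)]
    by_contra h
    have h1 : (a + 1) * (a * a) ≤ U * V := Nat.mul_le_mul haU (not_lt.1 h)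
    have h2 : (a + 1) * (a * a) = a ^ 3 + a * a := by ring
    have h3 : 0 < a * a := by positivity
    omega
  refine (wp_widthLoop hL hτ₄ (U := U) (V := V) (D := D) hm2 ham (by simpa using hN₃)
    (by simpa using ha₃) (by simp) (by simpa using h0) haL haU.le hUV hNUV hVm ha1
    (hndc a (by omega) le_rfl) (hndc m (by omega) (by omega))
    fun n hn hn' => hD n hn (by omega)).mono ?_
  rintro n₅ τ₅ - - ⟨hv, hn₅⟩
  refine ⟨hv, a, by omega, ham3, ?_⟩
  have e : L * (17000 * (D ^ 3 * a) + 3) = 17000 * (L * (D ^ 3 * a)) + 3 * L := by ring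
  omega

end

/-! ### Running times -/

theorem bdd_init {L N : ℕ} (hN : N < 2 ^ L) : Bdd L (State.init N) := by
  refine ⟨fun z => ?_, fun A l => Nat.two_pow_pos L⟩
  by_cases hz : z = .N
  · subst hz
    simpa [State.init] using hN
  · simp [State.init, Function.update_of_ne hz]

theorem factorsWithin_of_wp {L N : ℕ} {C : Cmd} {Q : ℕ → Prop} {T : ℝ}
    (h : wp L C (State.init N) fun n τ => Valid N τ ∧ Q n)
    (hT : ∀ n, Q n → ((n * unit L : ℕ) : ℝ) ≤ T) : FactorsWithin C N T := by
  obtain ⟨n, t, τ, hrun, ht, -, hv, hQ⟩ := h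
  exact ⟨t, τ, hrun, le_trans (by exact_mod_cast ht) (hT n hQ), hv⟩

/-- Bounds for the binary lengths and for the numbers of divisors that occur on input `N`. -/
theorem exists_length_divisors_le {δ : ℝ} (hδ : 0 < δ) : ∃ K : ℝ, 0 ≤ K ∧ ∀ N : ℕ, 0 < N →
    ∃ L D : ℕ, 1 ≤ L ∧ N < 2 ^ L ∧ 16 * (N + 2) ^ 2 ≤ 2 ^ L ∧
      (∀ n, 0 < n → n ≤ 4 * N → n.divisors.card ≤ D) ∧
      (L : ℝ) ≤ K * (N : ℝ) ^ δ ∧ (D : ℝ) ≤ K * (N : ℝ) ^ δ := by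
  obtain ⟨C, hC, hdiv⟩ := exists_card_divisors_le hδ
  have hlog : 0 < Real.log 2 := Real.log_pos (by norm_num)
  set K₁ : ℝ := 2 * (1 / (δ * Real.log 2)) + 8 with hK₁
  set K₂ : ℝ := C * 4 ^ δ + 1 with hK₂
  have hK₁0 : 0 ≤ K₁ := by positivity
  refine ⟨max K₁ K₂, hK₁0.trans (le_max_left _ _), fun N hN => ?_⟩
  have hN1 : (1 : ℝ) ≤ N := by exact_mod_cast hN
  have hNδ : 1 ≤ (N : ℝ) ^ δ := Real.one_le_rpow hN1 hδ.le
  have hs : N + 1 ≤ 2 ^ N.size := Nat.lt_size_self N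
  -- The choice `L = 2 size N + 6` is dictated by this inequality.
  have hL : 16 * (N + 2) ^ 2 ≤ 2 ^ (2 * N.size + 6) := by
    calc 16 * (N + 2) ^ 2 ≤ 16 * (2 * 2 ^ N.size) ^ 2 := by gcongr; omega
      _ = 2 ^ (2 * N.size + 6) := by ring
  refine ⟨2 * N.size + 6, ⌈C * ((4 * N : ℕ) : ℝ) ^ δ⌉₊, by omega, by nlinarith, hL,
    fun n hn hnN => ?_, ?_, ?_⟩
  · rw [← Nat.cast_le (α := ℝ)]
    refine (hdiv n hn).trans (le_trans ?_ (Nat.le_ceil _))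
    gcongr
  · refine le_trans ?_ (mul_le_mul_of_nonneg_right (le_max_left _ _) (by positivity))
    obtain ⟨k, hk⟩ : ∃ k, N.size = k + 1 :=
      ⟨N.size - 1, by have := Nat.size_pos.2 hN; omega⟩
    have hk2 : (2 : ℝ) ^ k ≤ N := by exact_mod_cast Nat.lt_size.1 (by omega : k < N.size)
    have hk3 : k * Real.log 2 ≤ (N : ℝ) ^ δ / δ := by
      rw [← Real.log_pow]
      exact (Real.log_le_log (by positivity) hk2).trans (Real.log_le_rpow_div (by positivity) hδ)
    have hk4 : (k : ℝ) ≤ 1 / (δ * Real.log 2) * (N : ℝ) ^ δ := by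
      rw [← le_div_iff₀ hlog] at hk3
      refine hk3.trans_eq ?_
      field_simp
    rw [hk, hK₁]
    push_cast
    linarith
  · refine le_trans ?_ (mul_le_mul_of_nonneg_right (le_max_right _ _) (by positivity))
    refine (Nat.ceil_lt_add_one (by positivity)).le.trans ?_
    push_cast
    rw [Real.mul_rpow (by norm_num) (by positivity), hK₂]
    linarith

/-- Rounding up costs at most one: `a - 1 < (2N)^(1/3) ≤ 2 N^(1/3)`, and `1 ≤ N^(1/3)`. -/
theorem cast_le_rpow_of_pred_cube_lt {N a : ℕ} (hN : 0 < N) (ha : 1 ≤ a)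
    (h : (a - 1) ^ 3 < 2 * N) : (a : ℝ) ≤ 3 * (N : ℝ) ^ (1 / 3 : ℝ) := by
  have hN1 : (1 : ℝ) ≤ N := by exact_mod_cast hN
  obtain ⟨b, rfl⟩ : ∃ b, a = b + 1 := ⟨a - 1, by omega⟩
  rw [Nat.add_sub_cancel] at h
  have hr1 : 1 ≤ (N : ℝ) ^ (1 / 3 : ℝ) := Real.one_le_rpow hN1 (by norm_num)
  have hr3 : ((N : ℝ) ^ (1 / 3 : ℝ)) ^ 3 = N := by
    rw [← Real.rpow_natCast, ← Real.rpow_mul (by positivity)]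
    norm_num
  have hb : (b : ℝ) ≤ 2 * (N : ℝ) ^ (1 / 3 : ℝ) := by
    refine le_of_pow_le_pow_left₀ three_ne_zero (by positivity) ?_
    rw [mul_pow, hr3]
    have h' : (b : ℝ) ^ 3 < 2 * N := by exact_mod_cast h
    linarith
  push_cast
  linarith

theorem exists_time_bound {ε : ℝ} (hε : 0 < ε) : ∃ K : ℝ, ∀ N : ℕ, 0 < N → ∃ L D : ℕ, 1 ≤ L ∧
    N < 2 ^ L ∧ 16 * (N + 2) ^ 2 ≤ 2 ^ L ∧ (∀ n, 0 < n → n ≤ 4 * N → n.divisors.card ≤ D) ∧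
      ∀ n, (∃ a, 1 ≤ a ∧ (a - 1) ^ 3 < 2 * N ∧ n ≤ 18000 * (L * (D ^ 3 * a))) →
        ((n * unit L : ℕ) : ℝ) ≤ K * (N : ℝ) ^ (1 / 3 + ε) := by
  obtain ⟨K, hK, hLD⟩ := exists_length_divisors_le (δ := ε / 6) (by positivity)
  refine ⟨54000000 * K ^ 6, fun N hN => ?_⟩
  obtain ⟨L, D, hL, hNL, hNL', hD, hLK, hDK⟩ := hLD N hN
  refine ⟨L, D, hL, hNL, hNL', hD, ?_⟩
  rintro n ⟨a, ha, haN, hn⟩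
  have hN0 : (0 : ℝ) < N := by exact_mod_cast hN
  have haN' := cast_le_rpow_of_pred_cube_lt hN ha haN
  have e : (N : ℝ) ^ (1 / 3 + ε) = (N : ℝ) ^ (1 / 3 : ℝ) * ((N : ℝ) ^ (ε / 6)) ^ 6 := by
    rw [← Real.rpow_natCast, ← Real.rpow_mul hN0.le, ← Real.rpow_add hN0]
    congr 1
    push_cast
    ring
  calc ((n * unit L : ℕ) : ℝ) ≤ ((18000 * (L * (D ^ 3 * a)) * unit L : ℕ) : ℝ) := by gcongr
    _ = 18000000 * ((L : ℝ) ^ 3 * (D : ℝ) ^ 3 * a) := by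
      rw [unit]
      push_cast
      ring
    _ ≤ 18000000 * ((K * (N : ℝ) ^ (ε / 6)) ^ 3 * (K * (N : ℝ) ^ (ε / 6)) ^ 3 *
        (3 * (N : ℝ) ^ (1 / 3 : ℝ))) := by gcongr
    _ = 54000000 * K ^ 6 * (N : ℝ) ^ (1 / 3 + ε) := by
      rw [e]
      ring

end HideSeek

theorem mainTheorem1 (ε : ℝ) (hε : 0 < ε) :
    (∃ K : ℝ, ∀ N U V : ℕ, 1 < U → U ≤ V → V < 2 * U → N = U * V →
      HideSeek.FactorsWithin HideSeek.balanced N (K * (N : ℝ) ^ (1 / 3 + ε))) ∧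
    (∃ K : ℝ, ∀ N U V : ℕ, 1 < U → U ≤ V → N = U * V →
      HideSeek.FactorsWithin HideSeek.general N (K * (N : ℝ) ^ (1 / 3 + ε))) := by
  obtain ⟨K, hK⟩ := HideSeek.exists_time_bound hε
  refine ⟨⟨K, fun N U V hU hUV hVU hN => ?_⟩, ⟨K, fun N U V hU hUV hN => ?_⟩⟩
  · obtain ⟨L, D, hL, hNL, hNL', hD, hT⟩ := hK N (by rw [hN]; exact Nat.mul_pos (by omega) (by omega))
    refine HideSeek.factorsWithin_of_wp (HideSeek.wp_balanced hL (HideSeek.bdd_init hNL) rfl rfl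
      hU hUV hVU hN hNL' hD) ?_
    rintro n ⟨a, ha, haN, hn⟩
    -- The balanced algorithm performs one search only; its bound is weakened by a factor `L` so
    -- that the same constant serves both.
    exact hT n ⟨a, ha, haN, hn.trans (Nat.mul_le_mul_left _ (Nat.le_mul_of_pos_left _ hL))⟩
  · obtain ⟨L, D, hL, hNL, hNL', hD, hT⟩ := hK N (by rw [hN]; exact Nat.mul_pos (by omega) (by omega))
    exact HideSeek.factorsWithin_of_wp (HideSeek.wp_general hL (HideSeek.bdd_init hNL) rfl rfl
      hU hUV hN hNL' hD) hT
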